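/- Let $d\ge 2$, $0<\mu<2$, $\gamma>0$, and let $V=V_1+V_2+V_3$ be a radial potential, where $V_1,V_2,V_3$ are real continuous functions of $r\in\,]0,\infty[$ such that $V_1(r)=-\gamma r^{-\mu}$ for $r\ge 1$; $V_2(r)=O(r^{-1-\mu/2-\epsilon})$ as $r\to\infty$ for some $\epsilon>0$; $V_1$ and $V_2$ vanish in a neighbourhood of $r=0$; $V_3$ has bounded support and $|V_3(r)|\le Cr^{-2+\kappa}$ for some $C,\kappa>0$. For $l\in\mathbb N\cup\{0\}$ let $u_l$ be the regular solution of the reduced zero-energy Schrödinger equation on $]0,\infty[$, $$-u''+V_lu=0,\qquad V_l(r)=2V(r)+\frac{(l+\frac d2-1)^2-\frac14}{r^2},\qquad \lim_{r\to0}r^{-l-\frac{d-1}2}u(r)=1.$$ Put $s_0=\frac12(1+\frac\mu2)$, and let $B^*_{s_0,0}$ be the space of $f\in L^2_{\rm loc}(\mathbb R^d)$ (square integrable on every ball) with $\sup_{R>1}R^{-2s_0}\int_{|x|<R}|f|^2\,dx<\infty$ and $\lim_{R\to\infty}R^{-2s_0}\int_{|x|<R}|f|^2\,dx=0$. Fix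 $R_0\ge0$ so large that $V(r)<0$ and $V_1(r)=-\gamma r^{-\mu}$ for all $r>R_0$. The phase shift $\sigma_l(0)\in\mathbb R/2\pi\mathbb Z$ is defined by $$\sigma_l(0)=D+\int_{R_0}^\infty\Big(\sqrt{-2V_1(r)}-\sqrt{-2V(r)}\Big)\,dr+\frac{d-3+2l}4\pi,$$ where $D$ is such that, for some $C>0$, with $r=|x|$ and $1_{\{r>R_0\}}$ the indicator function of $\{r>R_0\}$, $$\frac{u_l(r)}{r^{\frac{d-1}2}}-C\,\frac{\sin\big(\int_{R_0}^r\sqrt{-2V_1(r')}\,dr'+D\big)}{(-2V_1(r))^{\frac14}\,r^{\frac{d-1}2}}\,1_{\{r>R_0\}}\in B^*_{s_0,0}.$$ (i) The integral over $]R_0,\infty[$ converges absolutely, $\sigma_l(0)$ exists and is unique modulo $2\pi$ for every $l$, and its representatives $\sigma_l(0)\in\mathbb R$ can be chosen such that, as $l\to\infty$, $$\sigma_l(0)=-\frac{\mu\pi}{2(2-\mu)}\,l+\frac c2+o(l^0),$$ $$\frac c2=-\frac{\pi\mu(d-2)}{4(2-\mu)}+\frac{2\sqrt{2\gamma}}{2-\mu}R_0^{1-\frac\mu2}+\int_{R_0}^\infty\Big(\sqrt{-2V_1(r)}-\sqrt{-2V(r)}\Big)\,dr.$$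 (ii) Put $k=l+\frac{d-3}2$, $V_k(r)=-2\gamma r^{-\mu}+\frac{k(k+1)}{r^2}$ and, for $k>0$, $r_0=\big(\frac{k(k+1)}{2\gamma}\big)^{\frac1{2-\mu}}$, the zero of $V_k$. There are numbers $\delta_l\to0$ (as $l\to\infty$), independent of $r$, such that for every $l$ with $k>0$ there are $a_l>0$ and $\epsilon_l>0$ with, as $r\to\infty$, $$a_l\,u_l(r)=(-V_k(r))^{-\frac14}\Big(\sin\Big(\int_{r_0}^r\sqrt{-V_k(r')}\,dr'+\frac\pi4+\delta_l\Big)+O(r^{-\epsilon_l})\Big).$$ -/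

import Mathlib

open Filter Topology Set MeasureTheory Asymptotics

namespace RadialScattering

noncomputable section

/-- The class of radial potentials `V = V₁ + V₂ + V₃` on the half-line `]0, ∞[`, with leading
term `-γ r ^ (-μ)` for `r ≥ 1`, where `0 < μ < 2` and `γ > 0`. Values at `r ≤ 0` are irrelevant. -/
structure RadialCondition (μ γ : ℝ) (V₁ V₂ V₃ : ℝ → ℝ) : Prop where
  mu_pos : 0 < μ
  mu_lt_two : μ < 2
  gamma_pos : 0 < γ
  continuousOn_one : ContinuousOn V₁ (Ioi 0)
  continuousOn_two : ContinuousOn V₂ (Ioi 0)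
  continuousOn_three : ContinuousOn V₃ (Ioi 0)
  one_eq : ∀ r : ℝ, 1 ≤ r → V₁ r = -γ * r ^ (-μ)
  two_decay : ∃ ε : ℝ, 0 < ε ∧ V₂ =O[atTop] fun r : ℝ => r ^ (-1 - μ / 2 - ε)
  one_vanish : ∀ᶠ r in 𝓝[>] (0 : ℝ), V₁ r = 0
  two_vanish : ∀ᶠ r in 𝓝[>] (0 : ℝ), V₂ r = 0
  three_support : ∃ R : ℝ, ∀ r : ℝ, R < r → V₃ r = 0
  three_bound : ∃ C κ : ℝ, 0 < C ∧ 0 < κ ∧ ∀ r : ℝ, 0 < r → |V₃ r| ≤ C * r ^ (-2 + κ)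

/-- The zero-energy effective potential
`V_l(r) = 2 V(r) + ((l + d/2 - 1)² - 1/4) / r²` for angular momentum `l` in dimension `d`. -/
def effPotential (d : ℕ) (V : ℝ → ℝ) (l : ℕ) (r : ℝ) : ℝ :=
  2 * V r + (((l : ℝ) + (d : ℝ) / 2 - 1) ^ 2 - 1 / 4) / r ^ 2

/-- `u` is a regular solution of the reduced zero-energy Schrödinger equation
`-u'' + V_l u = 0` on `]0, ∞[`: a classical solution with `r ^ (-l - (d-1)/2) u(r) → 1` as
`r ↓ 0`. -/
structure IsRegularSolution (d : ℕ) (V : ℝ → ℝ) (l : ℕ) (u : ℝ → ℝ) : Prop where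
  differentiableAt : ∀ r : ℝ, 0 < r → DifferentiableAt ℝ u r
  equation : ∀ r : ℝ, 0 < r → HasDerivAt (deriv u) (effPotential d V l r * u r) r
  normalization :
    Tendsto (fun r : ℝ => r ^ (-(l : ℝ) - ((d : ℝ) - 1) / 2) * u r) (𝓝[>] 0) (𝓝 1)

/-- The dual Besov space `B*_s` on `ℝ^d`: locally square integrable functions with
`sup_{R > 1} R ^ (-2s) ∫_{|x| < R} |f|² < ∞`. -/
def MemDualBesov {d : ℕ} (s : ℝ) (f : EuclideanSpace ℝ (Fin d) → ℝ) : Prop :=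
  (∀ R : ℝ, MemLp f 2 (volume.restrict (Metric.ball 0 R))) ∧
    ∃ M : ℝ, ∀ R : ℝ, 1 < R → R ^ (-2 * s) * ∫ x in Metric.ball 0 R, f x ^ 2 ≤ M

/-- The subspace `B*_{s,0}` of `B*_s`, given by `R ^ (-2s) ∫_{|x| < R} |f|² → 0` as `R → ∞`. -/
def MemDualBesovZero {d : ℕ} (s : ℝ) (f : EuclideanSpace ℝ (Fin d) → ℝ) : Prop :=
  MemDualBesov s f ∧
    Tendsto (fun R : ℝ => R ^ (-2 * s) * ∫ x in Metric.ball 0 R, f x ^ 2) atTop (𝓝 0)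

/-- The model oscillation
`sin (∫_{R₀}^r √(-2 V₁) + D) / (-2 V₁(r)) ^ (1/4)`, cut off to `r > R₀`, where `V₁ < 0`. -/
def wkbWave (V₁ : ℝ → ℝ) (R₀ D : ℝ) : ℝ → ℝ :=
  (Ioi R₀).indicator fun r =>
    Real.sin ((∫ t in R₀..r, √(-2 * V₁ t)) + D) / (-2 * V₁ r) ^ (1 / 4 : ℝ)

/-- `D` is a phase constant of `u` relative to `V₁` and `R₀`: for some `C > 0`, the function
`(u(r) - C sin (∫_{R₀}^r √(-2 V₁) + D) / (-2 V₁(r)) ^ (1/4)) / r ^ ((d-1)/2)`, `r = |x|`,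
belongs to `B*_{s₀,0}` on `ℝ^d`, where `s₀ = (1 + μ/2) / 2`. -/
def HasPhase (d : ℕ) (μ : ℝ) (V₁ : ℝ → ℝ) (R₀ : ℝ) (u : ℝ → ℝ) (D : ℝ) : Prop :=
  ∃ C : ℝ, 0 < C ∧
    MemDualBesovZero ((1 + μ / 2) / 2) fun x : EuclideanSpace ℝ (Fin d) =>
      u ‖x‖ / ‖x‖ ^ (((d : ℝ) - 1) / 2) -
        C * (wkbWave V₁ R₀ D ‖x‖ / ‖x‖ ^ (((d : ℝ) - 1) / 2))

/-- `∫_{R₀}^∞ (√(-2 V₁) - √(-2 V))`. -/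
def phaseCorrection (V₁ V : ℝ → ℝ) (R₀ : ℝ) : ℝ :=
  ∫ r in Ioi R₀, (√(-2 * V₁ r) - √(-2 * V r))

/-- `s` is a value of the zero-energy phase shift `σ_l(0)`:
`s = D + ∫_{R₀}^∞ (√(-2 V₁) - √(-2 V)) + (d - 3 + 2l) π / 4`, where `D` is a phase constant of
the regular solution. As `D` enters through a sine, `σ_l(0)` is a number modulo `2π`. -/
def IsPhaseShift (d : ℕ) (μ : ℝ) (V₁ V : ℝ → ℝ) (R₀ : ℝ) (l : ℕ) (s : ℝ) : Prop :=
  ∃ u : ℝ → ℝ, IsRegularSolution d V l u ∧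
    ∃ D : ℝ, HasPhase d μ V₁ R₀ u D ∧
      s = D + phaseCorrection V₁ V R₀ + ((d : ℝ) - 3 + 2 * (l : ℝ)) / 4 * Real.pi

/-- The constant `c / 2` of the asymptotics. -/
def halfC (d : ℕ) (μ γ : ℝ) (V₁ V : ℝ → ℝ) (R₀ : ℝ) : ℝ :=
  -(Real.pi * μ * ((d : ℝ) - 2) / (4 * (2 - μ))) +
    2 * √(2 * γ) / (2 - μ) * R₀ ^ (1 - μ / 2) + phaseCorrection V₁ V R₀

/-- The angular momentum parameter `k = l + (d-3)/2`. -/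
def angK (d l : ℕ) : ℝ := (l : ℝ) + ((d : ℝ) - 3) / 2

/-- The model effective potential `V_k(r) = -2γ r ^ (-μ) + k(k+1) / r²`. -/
def modelPotential (μ γ k r : ℝ) : ℝ := -2 * γ * r ^ (-μ) + k * (k + 1) / r ^ 2

/-- The turning point `r₀ = (k(k+1) / (2γ)) ^ (1/(2-μ))`, the zero of `V_k` when `k > 0`. -/
def turningPoint (μ γ k : ℝ) : ℝ := (k * (k + 1) / (2 * γ)) ^ (1 / (2 - μ))

end

end RadialScattering

open RadialScattering

namespace RadialScattering

/-! Put `ν = l + d/2 - 1` and use the Liouville variable `z = ∫_0^r √(2γ t^(-μ)) dt`. Then `w(z) =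
r^(-μ/4) u_l(r)` solves `w'' = (s(s-1)/z² + g - 1) w` with `s = ν/(1-μ/2) + 1/2`. The perturbation
`g` does not depend on `l`; it is `O(z^(-2))` at `0` and `O(z^(-1-ε))` at infinity
(`liouville_transform`, `RadialCondition.pert_bound`). In polar coordinates `(w', w) = ρ (cos θ, sin
θ)` one has `θ' = 1 - P sin² θ` with `P = s(s-1)/z² + g`. Since `P` is integrable at infinity, `ρ →
A > 0` and `θ - z → Θ_l`, so `u_l ~ A r^(μ/4) sin(z + Θ_l)`. Both claims thus reduce to the
behaviour of `Θ_l` for large `l`.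

For `g = 0` the equation is Bessel's, and the phase is exactly `(1-s)π/2` (`exists_bessel_phase`).
Modulo `2π` this is found by carrying the solution along a quarter circle from `R` to `iR`, where it
has an explicit argument. The multiple of `2π` is an integer depending continuously on `s`, and it
vanishes at `s = 1`, where `θ = z`.

For general `g` the angle is squeezed between those for `s ± δ` (`phase_asymptotics`). Sturm
comparison orders the angles up to `Z = K s`. Beyond `Z` the rescaled angle with `tan α = √(1 -
m/z²) tan θ`, `m = s(s-1)`, moves at a speed that is almost independent of the solution, so the
order survives up to a small error (`phase_sub_le_of_adiabatic`). Hence `Θ_l = (1-s)π/2 + o(1)`.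

For (i), `D = Θ_l + z(R₀)` is a phase constant (`RadialCondition.hasPhase`). It is unique modulo
`2π` because a nonzero combination of `sin z` and `cos z` has a nonzero quadratic mean
(`eq_zero_of_tendsto_mean`). For (ii), the WKB integral has a closed form, equal to `z - Λπ/2 +
O(1/z)` with `Λ` the value of `z` at the turning point, and `Λ - ν/(1-μ/2) → 0`. -/

/-! ### Elementary differential inequalities on the half-line. -/

lemma monotoneOn_of_hasDerivAt {f f' : ℝ → ℝ} {D : Set ℝ} (hD : Convex ℝ D)
    (hf : ∀ x ∈ D, HasDerivAt f (f' x) x) (hn : ∀ x ∈ D, 0 ≤ f' x) : MonotoneOn f D :=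
  monotoneOn_of_hasDerivWithinAt_nonneg hD
    (fun x hx => (hf x hx).continuousAt.continuousWithinAt)
    (fun x hx => (hf x (interior_subset hx)).hasDerivWithinAt)
    (fun x hx => hn x (interior_subset hx))

lemma antitoneOn_of_hasDerivAt {f f' : ℝ → ℝ} {D : Set ℝ} (hD : Convex ℝ D)
    (hf : ∀ x ∈ D, HasDerivAt f (f' x) x) (hn : ∀ x ∈ D, f' x ≤ 0) : AntitoneOn f D :=
  antitoneOn_of_hasDerivWithinAt_nonpos hD
    (fun x hx => (hf x hx).continuousAt.continuousWithinAt)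
    (fun x hx => (hf x (interior_subset hx)).hasDerivWithinAt)
    (fun x hx => hn x (interior_subset hx))

lemma eqOn_const_of_hasDerivAt_zero {f : ℝ → ℝ} {D : Set ℝ} (hD : Convex ℝ D)
    (hf : ∀ x ∈ D, HasDerivAt f 0 x) {x y : ℝ} (hx : x ∈ D) (hy : y ∈ D) : f x = f y := by
  have h1 := monotoneOn_of_hasDerivAt hD hf (fun _ _ => le_rfl)
  have h2 := antitoneOn_of_hasDerivAt hD hf (fun _ _ => le_rfl)
  rcases le_total x y with h | h
  · exact le_antisymm (h1 hx hy h) (h2 hx hy h)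
  · exact le_antisymm (h2 hy hx h) (h1 hy hx h)

/-- A primitive on the half-line `]0, ∞[`. -/
lemma hasDerivAt_integral_Ioi {k : ℝ → ℝ} (hk : ContinuousOn k (Ioi 0)) {a z : ℝ}
    (ha : 0 < a) (hz : 0 < z) : HasDerivAt (fun z => ∫ t in a..z, k t) (k z) z := by
  have hsub : uIcc a z ⊆ Ioi 0 := by
    intro x hx
    exact lt_of_lt_of_le (lt_min ha hz) hx.1
  refine intervalIntegral.integral_hasDerivAt_right
    ((hk.mono hsub).intervalIntegrable) ?_ (hk.continuousAt (Ioi_mem_nhds hz))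
  exact hk.stronglyMeasurableAtFilter isOpen_Ioi z hz

/-- A differential inequality `k f ≤ f'` propagates the sign of `f` to the right. -/
lemma nonneg_of_mul_le_deriv {f f' k : ℝ → ℝ} {a b : ℝ} (ha : 0 < a)
    (hk : ContinuousOn k (Ioi 0)) (hf : ∀ z ∈ Icc a b, HasDerivAt f (f' z) z)
    (hle : ∀ z ∈ Icc a b, k z * f z ≤ f' z) (h0 : 0 ≤ f a) : ∀ z ∈ Icc a b, 0 ≤ f z := by
  intro z hz
  set K : ℝ → ℝ := fun z => ∫ t in a..z, k t
  have hK : ∀ x ∈ Icc a b, HasDerivAt K (k x) x := fun x hx =>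
    hasDerivAt_integral_Ioi hk ha (ha.trans_le hx.1)
  -- `exp (-K)` is the integrating factor: the derivative is `(f' - k f) exp (-K) ≥ 0`.
  have hm : MonotoneOn (fun x => f x * Real.exp (-K x)) (Icc a b) := by
    refine monotoneOn_of_hasDerivAt (convex_Icc a b)
      (fun x hx => (hf x hx).mul ((hK x hx).neg.exp)) ?_
    intro x hx
    have := hle x hx
    have he := Real.exp_pos (-K x)
    simp only [Pi.neg_apply]
    nlinarith
  have h1 := hm ⟨le_rfl, hz.1.trans hz.2⟩ hz hz.1
  simp only at h1
  have h2 : 0 ≤ f a * Real.exp (-K a) := mul_nonneg h0 (Real.exp_pos _).le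
  exact nonneg_of_mul_nonneg_left (h2.trans h1) (Real.exp_pos _)

/-- A function whose derivative is `O(z ^ (-1 - ε))` converges at the rate `z ^ (-ε)`. -/
lemma exists_tendsto_of_deriv_le {f f' : ℝ → ℝ} {C ε a : ℝ} (ha : 0 < a) (hε : 0 < ε)
    (hf : ∀ z, a ≤ z → HasDerivAt f (f' z) z)
    (hb : ∀ z, a ≤ z → |f' z| ≤ C * z ^ (-1 - ε)) :
    ∃ L : ℝ, ∀ z, a ≤ z → |f z - L| ≤ C / ε * z ^ (-ε) := by
  have hp : ∀ z, a ≤ z → HasDerivAt (fun z : ℝ => C / ε * z ^ (-ε)) (-(C * z ^ (-1 - ε))) z := by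
    intro z hz
    have := (Real.hasDerivAt_rpow_const (x := z) (p := -ε) (Or.inl (ha.trans_le hz).ne')).const_mul
      (C / ε)
    refine this.congr_deriv ?_
    rw [show -ε - 1 = -1 - ε by ring]
    field_simp
  -- `C/ε * z^(-ε)` is the tail integral of the bound. Subtracting it makes `f` increase, adding it
  -- makes `f` decrease; the limit is the supremum of the lower curve, and the two curves enclose it
  -- at every point.
  have hm : MonotoneOn (fun z => f z - C / ε * z ^ (-ε)) (Ici a) :=
    monotoneOn_of_hasDerivAt (convex_Ici a) (fun x hx => (hf x hx).sub (hp x hx))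
      (fun x hx => by have := (abs_le.1 (hb x hx)).1; linarith)
  have hA : AntitoneOn (fun z => f z + C / ε * z ^ (-ε)) (Ici a) :=
    antitoneOn_of_hasDerivAt (convex_Ici a) (fun x hx => (hf x hx).add (hp x hx))
      (fun x hx => by have := (abs_le.1 (hb x hx)).2; linarith)
  have hC : 0 ≤ C := by
    have h := (abs_nonneg _).trans (hb a le_rfl)
    exact nonneg_of_mul_nonneg_left h (Real.rpow_pos_of_pos ha _)
  have hnn : ∀ z, a ≤ z → 0 ≤ C / ε * z ^ (-ε) := fun z hz =>
    mul_nonneg (div_nonneg hC hε.le) (Real.rpow_nonneg (ha.le.trans hz) _)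
  have hcross : ∀ x y, a ≤ x → a ≤ y →
      f x - C / ε * x ^ (-ε) ≤ f y + C / ε * y ^ (-ε) := by
    intro x y hx hy
    rcases le_total x y with h | h
    · have := hm hx hy h
      have := hnn y hy
      simp only at *
      linarith
    · have := hA hy hx h
      have := hnn x hx
      simp only at *
      linarith
  set S := (fun z => f z - C / ε * z ^ (-ε)) '' Ici a
  have hne : S.Nonempty := ⟨_, a, le_refl a, rfl⟩
  have hbd : BddAbove S := ⟨f a + C / ε * a ^ (-ε), by
    rintro _ ⟨x, hx, rfl⟩; exact hcross x a hx (le_refl a)⟩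
  refine ⟨sSup S, fun z hz => abs_le.2 ⟨?_, ?_⟩⟩
  · have : sSup S ≤ f z + C / ε * z ^ (-ε) :=
      csSup_le hne (by rintro _ ⟨x, hx, rfl⟩; exact hcross x z hx hz)
    linarith
  · have : f z - C / ε * z ^ (-ε) ≤ sSup S := le_csSup hbd ⟨z, hz, rfl⟩
    linarith

/-- A solution of `f'' = q f` on `]0, ∞[` with vanishing Cauchy data at a point vanishes. -/
lemma eq_zero_of_cauchy_data_zero {f f' q : ℝ → ℝ} (hq : ContinuousOn q (Ioi 0))
    (hf : ∀ z, 0 < z → HasDerivAt f (f' z) z) (hf' : ∀ z, 0 < z → HasDerivAt f' (q z * f z) z)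
    {a : ℝ} (ha : 0 < a) (h0 : f a = 0) (h1 : f' a = 0) {z : ℝ} (hz : 0 < z) :
    f z = 0 ∧ f' z = 0 := by
  -- Gronwall for the energy: `|E'| ≤ (1 + M) E` on the compact segment, in either direction from
  -- `a`.
  set E : ℝ → ℝ := fun z => f z ^ 2 + f' z ^ 2
  set D := uIcc a z
  have hpos : ∀ x ∈ D, 0 < x := fun x hx => lt_of_lt_of_le (lt_min ha hz) hx.1
  obtain ⟨M, hM⟩ := isCompact_uIcc.exists_bound_of_continuousOn
    (hq.mono (fun x hx => hpos x hx) : ContinuousOn q D)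
  have hE : ∀ x ∈ D, HasDerivAt E (2 * (1 + q x) * (f x * f' x)) x := by
    intro x hx
    refine (((hf x (hpos x hx)).pow 2).add ((hf' x (hpos x hx)).pow 2)).congr_deriv ?_
    push_cast; ring
  have hbound : ∀ x ∈ D, |2 * (1 + q x) * (f x * f' x)| ≤ (1 + M) * E x := by
    intro x hx
    have h2 : |q x| ≤ M := hM x hx
    have h3 : |1 + q x| ≤ 1 + M := (abs_add_le _ _).trans (by simpa using h2)
    have h4 : |2 * (f x * f' x)| ≤ E x := by
      rw [abs_le]; constructor <;> nlinarith [sq_nonneg (f x + f' x), sq_nonneg (f x - f' x)]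
    calc |2 * (1 + q x) * (f x * f' x)| = |1 + q x| * |2 * (f x * f' x)| := by
          rw [← abs_mul]; congr 1; ring
      _ ≤ _ := mul_le_mul h3 h4 (abs_nonneg _) ((abs_nonneg _).trans h3)
  have hEa : E a = 0 := by simp [E, h0, h1]
  have hEz : E z ≤ 0 := by
    rcases le_total a z with h | h
    · have hm : AntitoneOn (fun x => E x * Real.exp (-(1 + M) * x)) D := by
        refine antitoneOn_of_hasDerivAt (convex_uIcc a z) (fun x hx => (hE x hx).mul
          (((hasDerivAt_id x).const_mul (-(1 + M))).exp)) ?_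
        intro x hx
        have := (abs_le.1 (hbound x hx)).2
        have he := Real.exp_pos (-(1 + M) * x)
        simp only [id]
        nlinarith
      have := hm left_mem_uIcc right_mem_uIcc h
      simp only [hEa, zero_mul] at this
      exact nonpos_of_mul_nonpos_left this (Real.exp_pos _)
    · have hm : MonotoneOn (fun x => E x * Real.exp ((1 + M) * x)) D := by
        refine monotoneOn_of_hasDerivAt (convex_uIcc a z) (fun x hx => (hE x hx).mul
          (((hasDerivAt_id x).const_mul (1 + M)).exp)) ?_
        intro x hx
        have := (abs_le.1 (hbound x hx)).1
        have he := Real.exp_pos ((1 + M) * x)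
        simp only [id]
        nlinarith
      have := hm right_mem_uIcc left_mem_uIcc h
      simp only [hEa, zero_mul] at this
      exact nonpos_of_mul_nonpos_left this (Real.exp_pos _)
  constructor <;> nlinarith [sq_nonneg (f z), sq_nonneg (f' z)]

/-! ### Prüfer coordinates. -/

/-- `θ` is a Prüfer angle of an equation `w'' = (P - 1) w` on `]0, ∞[` along a solution with
`z w' / w → s` as `z ↓ 0`. -/
structure IsPruferAngle (P : ℝ → ℝ) (s : ℝ) (θ : ℝ → ℝ) : Prop where
  hasDerivAt : ∀ z, 0 < z → HasDerivAt θ (1 - P z * Real.sin (θ z) ^ 2) z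
  init : Tendsto (fun z => θ z / z) (𝓝[>] 0) (𝓝 s⁻¹)

/-- Polar coordinates for the pair `(w', w)` along a solution of `w'' = (P - 1) w`. -/
lemma exists_prufer {P w w' : ℝ → ℝ} {s : ℝ} (hs : 0 < s) (hP : ContinuousOn P (Ioi 0))
    (hw : ∀ z, 0 < z → HasDerivAt w (w' z) z)
    (hw' : ∀ z, 0 < z → HasDerivAt w' ((P z - 1) * w z) z)
    (hpos : ∀ᶠ z in 𝓝[>] (0 : ℝ), 0 < w z)
    (hlim : Tendsto (fun z => z * w' z / w z) (𝓝[>] 0) (𝓝 s)) :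
    ∃ θ ρ : ℝ → ℝ, IsPruferAngle P s θ ∧ (∀ z, 0 < z → 0 < ρ z) ∧
      (∀ z, 0 < z → HasDerivAt ρ (ρ z * (P z * (Real.sin (θ z) * Real.cos (θ z)))) z) ∧
      ∀ z, 0 < z → w z = ρ z * Real.sin (θ z) ∧ w' z = ρ z * Real.cos (θ z) := by
  have hev : ∀ᶠ z in 𝓝[>] (0 : ℝ), 0 < w z ∧ 0 < w' z := by
    filter_upwards [hpos, hlim.eventually (lt_mem_nhds hs), self_mem_nhdsWithin] with z h1 h2 h3
    refine ⟨h1, ?_⟩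
    have h4 : 0 < z * w' z := by
      have := mul_pos h2 h1
      rwa [div_mul_cancel₀ _ h1.ne'] at this
    exact pos_of_mul_pos_right h4 (le_of_lt h3)
  obtain ⟨b, hb, hab⟩ := mem_nhdsGT_iff_exists_Ioo_subset.1 hev
  replace hb : 0 < b := hb
  set a := b / 2
  have ha : 0 < a := by positivity
  have hwa : ∀ z, 0 < z → z ≤ a → 0 < w z ∧ 0 < w' z := fun z h1 h2 =>
    hab ⟨h1, lt_of_le_of_lt h2 (half_lt_self hb)⟩
  set N : ℝ → ℝ := fun z => w z ^ 2 + w' z ^ 2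
  have hN : ∀ z, 0 < z → 0 < N z := by
    intro z hz
    have h0 : 0 ≤ N z := by positivity
    refine lt_of_le_of_ne h0 fun h => ?_
    have h1 : w z = 0 := by simp only [N] at h; nlinarith [sq_nonneg (w z), sq_nonneg (w' z)]
    have h2 : w' z = 0 := by simp only [N] at h; nlinarith [sq_nonneg (w z), sq_nonneg (w' z)]
    have h3 := (eq_zero_of_cauchy_data_zero (q := fun z => P z - 1)
      (hP.sub continuousOn_const) hw hw' hz h1 h2 ha).1
    exact (hwa a ha le_rfl).1.ne' h3
  have hcw : ContinuousOn w (Ioi 0) := fun z hz => (hw z hz).continuousAt.continuousWithinAt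
  have hcw' : ContinuousOn w' (Ioi 0) := fun z hz => (hw' z hz).continuousAt.continuousWithinAt
  -- This is what `θ'` must be. Integrating it from `a` gives a differentiable angle with no choice
  -- of branches; the polar representation is verified afterwards.
  set k : ℝ → ℝ := fun z => 1 - P z * w z ^ 2 / N z
  have hk : ContinuousOn k (Ioi 0) :=
    continuousOn_const.sub ((hP.mul (hcw.pow 2)).div ((hcw.pow 2).add (hcw'.pow 2))
      (fun z hz => (hN z hz).ne'))
  set θ : ℝ → ℝ := fun z => Real.arctan (w a / w' a) + ∫ t in a..z, k t
  have hθ : ∀ z, 0 < z → HasDerivAt θ (k z) z := fun z hz =>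
    (hasDerivAt_integral_Ioi hk ha hz).const_add _
  set ρ : ℝ → ℝ := fun z => √(N z)
  have hρ : ∀ z, 0 < z → 0 < ρ z := fun z hz => Real.sqrt_pos.2 (hN z hz)
  have hρ2 : ∀ z, 0 < z → ρ z ^ 2 = N z := fun z hz => Real.sq_sqrt (hN z hz).le
  have hρd : ∀ z, 0 < z → HasDerivAt ρ (ρ z * (P z * (w z * w' z) / N z)) z := by
    intro z hz
    have h1 : HasDerivAt N (2 * P z * (w z * w' z)) z := by
      refine (((hw z hz).pow 2).add ((hw' z hz).pow 2)).congr_deriv ?_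
      push_cast; ring
    refine (h1.sqrt (hN z hz).ne').congr_deriv ?_
    have h3 := (hρ z hz).ne'
    change 2 * P z * (w z * w' z) / (2 * ρ z) = _
    rw [← hρ2 z hz]
    field_simp
  -- The unit vector `(w', w)/ρ`, expressed in the frame rotated by `θ`, has zero derivative, so it
  -- keeps the value it has at `a`.
  have hX : ∀ z, 0 < z →
      (w z * Real.cos (θ z) - w' z * Real.sin (θ z)) / ρ z = 0 ∧
      (w z * Real.sin (θ z) + w' z * Real.cos (θ z)) / ρ z = 1 := by
    intro z hz
    have hNk : ∀ x, 0 < x → N x ≠ 0 := fun x hx => (hN x hx).ne'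
    have hXd : ∀ x ∈ Ioi (0 : ℝ), HasDerivAt
        (fun z => (w z * Real.cos (θ z) - w' z * Real.sin (θ z)) / ρ z) 0 x := by
      intro x hx
      have := (((hw x hx).mul (hθ x hx).cos).sub ((hw' x hx).mul (hθ x hx).sin)).div
        (hρd x hx) (hρ x hx).ne'
      refine this.congr_deriv ?_
      have h1 := (hρ x hx).ne'
      have h2 := hNk x hx
      simp only [k, Pi.mul_apply, Pi.sub_apply]
      rw [div_eq_zero_iff]; left
      field_simp
      simp only [N]
      ring
    have hYd : ∀ x ∈ Ioi (0 : ℝ), HasDerivAt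
        (fun z => (w z * Real.sin (θ z) + w' z * Real.cos (θ z)) / ρ z) 0 x := by
      intro x hx
      have := (((hw x hx).mul (hθ x hx).sin).add ((hw' x hx).mul (hθ x hx).cos)).div
        (hρd x hx) (hρ x hx).ne'
      refine this.congr_deriv ?_
      have h1 := (hρ x hx).ne'
      have h2 := hNk x hx
      simp only [k, Pi.mul_apply, Pi.add_apply]
      rw [div_eq_zero_iff]; left
      field_simp
      simp only [N]
      ring
    have hw'a := (hwa a ha le_rfl).2
    have e1 : θ a = Real.arctan (w a / w' a) := by simp [θ]
    have e2 : √(1 + (w a / w' a) ^ 2) = ρ a / w' a := by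
      rw [show 1 + (w a / w' a) ^ 2 = N a / w' a ^ 2 by simp only [N]; field_simp; ring,
        Real.sqrt_div' _ (by positivity), Real.sqrt_sq hw'a.le]
    have hra := (hρ a ha).ne'
    have hNa := hρ2 a ha
    rw [eqOn_const_of_hasDerivAt_zero (convex_Ioi 0) hXd (show z ∈ Ioi 0 from hz)
        (show a ∈ Ioi 0 from ha),
      eqOn_const_of_hasDerivAt_zero (convex_Ioi 0) hYd (show z ∈ Ioi 0 from hz)
        (show a ∈ Ioi 0 from ha)]
    rw [e1, Real.cos_arctan, Real.sin_arctan, e2]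
    constructor
    · field_simp; ring
    · field_simp
      rw [hNa]
  have hrep : ∀ z, 0 < z → w z = ρ z * Real.sin (θ z) ∧ w' z = ρ z * Real.cos (θ z) := by
    intro z hz
    obtain ⟨h1, h2⟩ := hX z hz
    have hr := (hρ z hz).ne'
    rw [div_eq_zero_iff, or_iff_left hr] at h1
    rw [div_eq_one_iff_eq hr] at h2
    have h3 := Real.sin_sq_add_cos_sq (θ z)
    constructor
    · linear_combination Real.cos (θ z) * h1 + Real.sin (θ z) * h2 - w z * h3
    · linear_combination -Real.sin (θ z) * h1 + Real.cos (θ z) * h2 - w' z * h3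
  refine ⟨θ, ρ, ⟨?_, ?_⟩, hρ, ?_, hrep⟩
  · intro z hz
    refine (hθ z hz).congr_deriv ?_
    have hr := (hρ z hz).ne'
    simp only [k]
    rw [(hrep z hz).1, ← hρ2 z hz]
    field_simp
  -- On `]0, a]` both `w` and `w'` are positive, so the angle is the principal one and `θ/z`
  -- inherits the limit of `w/(z w')`.
  · have hnear : ∀ z ∈ Ioc 0 a, θ z = Real.arctan (w z / w' z) := by
      intro z hz
      have hd : ∀ x ∈ Ioc 0 a, HasDerivAt (fun z => θ z - Real.arctan (w z / w' z)) 0 x := by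
        intro x hx
        have hx0 := (hwa x hx.1 hx.2).2.ne'
        refine ((hθ x hx.1).sub ((hw x hx.1).div (hw' x hx.1) hx0).arctan).congr_deriv ?_
        have hNx := (hN x hx.1).ne'
        have e : 1 + (w x / w' x) ^ 2 = N x / w' x ^ 2 := by simp only [N]; field_simp; ring
        simp only [k]
        rw [Pi.div_apply, e]
        field_simp
        simp only [N]
        ring
      have := eqOn_const_of_hasDerivAt_zero (convex_Ioc 0 a) hd hz ⟨ha, le_rfl⟩
      simp only [θ, intervalIntegral.integral_same] at this ⊢
      linarith
    have hy : Tendsto (fun z => w z / w' z / z) (𝓝[>] 0) (𝓝 s⁻¹) := by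
      refine (hlim.inv₀ hs.ne').congr' ?_
      filter_upwards with z
      rw [inv_div, div_div, mul_comm z]
    have hy0 : Tendsto (fun z => w z / w' z) (𝓝[>] 0) (𝓝 0) := by
      have h1 : Tendsto (fun z : ℝ => z) (𝓝[>] 0) (𝓝 0) := nhdsWithin_le_nhds
      have := hy.mul h1
      rw [mul_zero] at this
      refine this.congr' ?_
      filter_upwards [self_mem_nhdsWithin] with z hz
      exact div_mul_cancel₀ _ (ne_of_gt hz)
    have hat : Tendsto (fun y => y⁻¹ * Real.arctan y) (𝓝[≠] 0) (𝓝 1) := by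
      have := (Real.hasDerivAt_arctan 0).tendsto_slope_zero
      simpa using this
    have hy0' : Tendsto (fun z => w z / w' z) (𝓝[>] 0) (𝓝[≠] 0) := by
      refine tendsto_nhdsWithin_iff.2 ⟨hy0, ?_⟩
      filter_upwards [Ioc_mem_nhdsGT ha] with z hz
      exact (div_pos (hwa z hz.1 hz.2).1 (hwa z hz.1 hz.2).2).ne'
    have := (hat.comp hy0').mul hy
    rw [one_mul] at this
    refine this.congr' ?_
    filter_upwards [Ioc_mem_nhdsGT ha] with z hz
    have h0 := (div_pos (hwa z hz.1 hz.2).1 (hwa z hz.1 hz.2).2).ne'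
    rw [hnear z hz]
    simp only [Function.comp]
    rw [mul_comm, ← mul_assoc, div_mul_eq_mul_div, mul_inv_cancel₀ h0]
    ring
  · intro z hz
    refine (hρd z hz).congr_deriv ?_
    rw [← hρ2 z hz, (hrep z hz).1, (hrep z hz).2]
    field_simp


/-! ### Sturm comparison and asymptotic phases. -/

/-- With `sinc` the sine becomes a continuous coefficient times its argument, so
`nonneg_of_mul_le_deriv`, a linear statement, applies to Prüfer angles and their differences. -/
lemma sinc_mul_self (x : ℝ) : Real.sinc x * x = Real.sin x := by
  rcases eq_or_ne x 0 with rfl | h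
  · simp
  · rw [Real.sinc_of_ne_zero h, div_mul_cancel₀ _ h]

/-- Exhibits the factor `sin (a - b)` in the difference of two Prüfer equations. -/
lemma sin_sq_sub_sin_sq (a b : ℝ) :
    Real.sin a ^ 2 - Real.sin b ^ 2 = Real.sin (a - b) * Real.sin (a + b) := by
  rw [Real.sin_sub, Real.sin_add]
  have h1 := Real.sin_sq_add_cos_sq a
  have h2 := Real.sin_sq_add_cos_sq b
  linear_combination (-Real.sin a ^ 2) * h2 + Real.sin b ^ 2 * h1

namespace IsPruferAngle

variable {P P₁ P₂ θ θ₁ θ₂ : ℝ → ℝ} {s s₁ s₂ : ℝ}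

lemma continuousOn (h : IsPruferAngle P s θ) : ContinuousOn θ (Ioi 0) :=
  fun z hz => (h.hasDerivAt z hz).continuousAt.continuousWithinAt

lemma tendsto_zero (h : IsPruferAngle P s θ) : Tendsto θ (𝓝[>] 0) (𝓝 0) := by
  have h1 : Tendsto (fun z : ℝ => z) (𝓝[>] 0) (𝓝 0) := nhdsWithin_le_nhds
  have := h.init.mul h1
  rw [mul_zero] at this
  refine this.congr' ?_
  filter_upwards [self_mem_nhdsWithin] with z hz
  exact div_mul_cancel₀ _ (ne_of_gt hz)

/-- Sturm comparison for Prüfer angles. -/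
lemma sturm (h₁ : IsPruferAngle P₁ s₁ θ₁) (h₂ : IsPruferAngle P₂ s₂ θ₂)
    (hP : ContinuousOn P₁ (Ioi 0)) (hs₁ : 0 < s₁) (hs : s₁ < s₂) {b : ℝ}
    (hle : ∀ z, 0 < z → z ≤ b → P₁ z ≤ P₂ z) {z : ℝ} (hz : 0 < z) (hzb : z ≤ b) :
    θ₂ z ≤ θ₁ z := by
  -- The initial slopes `1/s` are strictly ordered, which provides a starting point; from there the
  -- differential inequality takes over.
  have hlt : s₂⁻¹ < s₁⁻¹ := inv_strictAnti₀ hs₁ hs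
  obtain ⟨z₀, hz₀, h0, hz0z⟩ : ∃ z₀, θ₂ z₀ / z₀ < θ₁ z₀ / z₀ ∧ 0 < z₀ ∧ z₀ ≤ z := by
    have := (h₂.init.eventually_lt h₁.init hlt).and (Ioc_mem_nhdsGT hz)
    obtain ⟨z₀, h1, h2⟩ := this.exists
    exact ⟨z₀, h1, h2.1, h2.2⟩
  have h0' : 0 ≤ θ₁ z₀ - θ₂ z₀ := by
    have := (div_lt_div_iff_of_pos_right h0).1 hz₀
    linarith
  have hk : ContinuousOn (fun z => -P₁ z * (Real.sinc (θ₁ z - θ₂ z) * Real.sin (θ₁ z + θ₂ z)))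
      (Ioi 0) :=
    hP.neg.mul ((Real.continuous_sinc.comp_continuousOn
      (h₁.continuousOn.sub h₂.continuousOn)).mul
      (Real.continuous_sin.comp_continuousOn (h₁.continuousOn.add h₂.continuousOn)))
  have := nonneg_of_mul_le_deriv (b := z) h0 hk
    (fun x hx => (h₁.hasDerivAt x (h0.trans_le hx.1)).sub (h₂.hasDerivAt x (h0.trans_le hx.1)))
    (fun x hx => ?_) h0' z ⟨hz0z, le_rfl⟩
  · simpa using this
  · have h3 := hle x (h0.trans_le hx.1) (hx.2.trans hzb)
    have h4 := sinc_mul_self (θ₁ x - θ₂ x)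
    have h5 := sin_sq_sub_sin_sq (θ₁ x) (θ₂ x)
    simp only [Pi.sub_apply]
    have h6 : -P₁ x * (Real.sinc (θ₁ x - θ₂ x) * Real.sin (θ₁ x + θ₂ x)) * (θ₁ x - θ₂ x) =
        -P₁ x * (Real.sin (θ₁ x) ^ 2 - Real.sin (θ₂ x) ^ 2) := by
      rw [h5, ← h4]; ring
    rw [h6]
    nlinarith [mul_le_mul_of_nonneg_right h3 (sq_nonneg (Real.sin (θ₂ x)))]

/-- `θ - z` decreases, from its limit `0` at the origin. -/
lemma le_self (h : IsPruferAngle P s θ) (hP : ∀ z, 0 < z → 0 ≤ P z) {z : ℝ} (hz : 0 < z) :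
    θ z ≤ z := by
  have hA : AntitoneOn (fun z => θ z - z) (Ioi 0) :=
    antitoneOn_of_hasDerivAt (convex_Ioi 0)
      (fun x hx => (h.hasDerivAt x hx).sub (hasDerivAt_id x))
      (fun x hx => by have := mul_nonneg (hP x hx) (sq_nonneg (Real.sin (θ x))); linarith)
  have h1 : Tendsto (fun z : ℝ => θ z - z) (𝓝[>] 0) (𝓝 (0 - 0)) :=
    h.tendsto_zero.sub nhdsWithin_le_nhds
  rw [sub_zero] at h1
  have : θ z - z ≤ 0 := by
    refine ge_of_tendsto h1 ?_
    filter_upwards [Ioc_mem_nhdsGT hz] with x hx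
    exact hA hx.1 hz hx.2
  linarith

/-- The positive initial slope `1/s` starts `θ` above `0`. As `θ' = 1 - P sin² θ ≥ -P sinc θ sin θ *
θ`, the sign then propagates. -/
lemma nonneg (h : IsPruferAngle P s θ) (hP : ContinuousOn P (Ioi 0)) (hs : 0 < s) {z : ℝ}
    (hz : 0 < z) : 0 ≤ θ z := by
  obtain ⟨z₀, hz₀, h0, hz0z⟩ : ∃ z₀, 0 < θ z₀ / z₀ ∧ 0 < z₀ ∧ z₀ ≤ z := by
    have := (h.init.eventually (lt_mem_nhds (inv_pos.2 hs))).and (Ioc_mem_nhdsGT hz)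
    obtain ⟨z₀, h1, h2⟩ := this.exists
    exact ⟨z₀, h1, h2.1, h2.2⟩
  have h0' : 0 ≤ θ z₀ := by
    have := mul_pos hz₀ h0
    rw [div_mul_cancel₀ _ h0.ne'] at this
    exact this.le
  refine nonneg_of_mul_le_deriv (b := z)
    (k := fun z => -P z * (Real.sinc (θ z) * Real.sin (θ z))) h0 ?_
    (fun x hx => h.hasDerivAt x (h0.trans_le hx.1)) (fun x hx => ?_) h0' z ⟨hz0z, le_rfl⟩
  · exact hP.neg.mul ((Real.continuous_sinc.comp_continuousOn h.continuousOn).mul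
      (Real.continuous_sin.comp_continuousOn h.continuousOn))
  · have h4 := sinc_mul_self (θ x)
    have : -P x * (Real.sinc (θ x) * Real.sin (θ x)) * θ x = -P x * Real.sin (θ x) ^ 2 := by
      linear_combination (-P x * Real.sin (θ x)) * h4
    rw [this]; linarith

/-- The asymptotic phase exists if the perturbation `P` is `O(z ^ (-1 - ε))`. -/
lemma exists_phase (h : IsPruferAngle P s θ) {C ε a : ℝ} (ha : 0 < a) (hε : 0 < ε)
    (hP : ∀ z, a ≤ z → |P z| ≤ C * z ^ (-1 - ε)) :
    ∃ Θ : ℝ, ∀ z, a ≤ z → |θ z - z - Θ| ≤ C / ε * z ^ (-ε) := by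
  refine exists_tendsto_of_deriv_le ha hε
    (fun z hz => (h.hasDerivAt z (ha.trans_le hz)).sub (hasDerivAt_id z)) (fun z hz => ?_)
  have h1 : |Real.sin (θ z) ^ 2| ≤ 1 := by
    rw [abs_of_nonneg (sq_nonneg _)]; exact Real.sin_sq_le_one _
  calc |1 - P z * Real.sin (θ z) ^ 2 - 1| = |P z| * |Real.sin (θ z) ^ 2| := by
        rw [← abs_mul, ← abs_neg]; congr 1; ring
    _ ≤ |P z| * 1 := by gcongr
    _ ≤ _ := by simpa using hP z hz

end IsPruferAngle

/-- The amplitude converges, with rate, if the perturbation `P` is `O(z ^ (-1 - ε))`. -/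
lemma exists_amplitude {P θ ρ : ℝ → ℝ} (hρ : ∀ z, 0 < z → 0 < ρ z)
    (hρ' : ∀ z, 0 < z →
      HasDerivAt ρ (ρ z * (P z * (Real.sin (θ z) * Real.cos (θ z)))) z)
    {C ε a : ℝ} (ha : 0 < a) (hε : 0 < ε) (hP : ∀ z, a ≤ z → |P z| ≤ C * z ^ (-1 - ε)) :
    ∃ A : ℝ, 0 < A ∧ (fun z => ρ z - A) =O[atTop] fun z : ℝ => z ^ (-ε) := by
  -- The logarithmic derivative of `ρ` is bounded by `|P|`; working with `log ρ` also makes the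
  -- limit of `ρ` positive.
  obtain ⟨L, hL⟩ := exists_tendsto_of_deriv_le (f := fun z => Real.log (ρ z))
    (f' := fun z => P z * (Real.sin (θ z) * Real.cos (θ z))) (C := C) ha hε
    (fun z hz => ((hρ' z (ha.trans_le hz)).log (hρ z (ha.trans_le hz)).ne').congr_deriv
      (mul_div_cancel_left₀ _ (hρ z (ha.trans_le hz)).ne')) (fun z hz => by
        have h1 : |Real.sin (θ z) * Real.cos (θ z)| ≤ 1 := by
          rw [abs_mul]
          exact mul_le_one₀ (Real.abs_sin_le_one _) (abs_nonneg _) (Real.abs_cos_le_one _)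
        rw [abs_mul]
        exact (mul_le_of_le_one_right (abs_nonneg _) h1).trans (hP z hz))
  refine ⟨Real.exp L, Real.exp_pos L, ?_⟩
  have ht : Tendsto (fun z : ℝ => C / ε * z ^ (-ε)) atTop (𝓝 0) := by
    simpa using (tendsto_rpow_neg_atTop hε).const_mul (C / ε)
  refine IsBigO.of_bound (Real.exp L * (2 * (C / ε))) ?_
  filter_upwards [eventually_ge_atTop a, ht.eventually (gt_mem_nhds one_pos)] with z hz h1
  have hz0 := ha.trans_le hz
  have h2 := hL z hz
  have h3 := Real.abs_exp_sub_one_le (h2.trans h1.le)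
  have h4 : ρ z - Real.exp L = Real.exp L * (Real.exp (Real.log (ρ z) - L) - 1) := by
    rw [mul_sub, ← Real.exp_add, add_sub_cancel, Real.exp_log (hρ z hz0), mul_one]
  rw [h4, Real.norm_eq_abs, Real.norm_eq_abs, abs_mul, abs_of_pos (Real.exp_pos L),
    abs_of_nonneg (Real.rpow_nonneg hz0.le _)]
  have h5 := h3.trans (mul_le_mul_of_nonneg_left h2 (by norm_num : (0:ℝ) ≤ 2))
  calc _ ≤ Real.exp L * (2 * (C / ε * z ^ (-ε))) := by gcongr
    _ = _ := by ring

/-- Sturm monotonicity and local Lipschitz continuity of the asymptotic phase of the regular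
solution of `w'' = (s (s - 1) / z² - 1) w` as a function of `s`. -/
lemma bessel_phase_sub_le {θ₁ θ₂ : ℝ → ℝ} {s₁ s₂ Θ₁ Θ₂ : ℝ} (hs₁ : 1 ≤ s₁) (hs : s₁ < s₂)
    (h₁ : IsPruferAngle (fun z => s₁ * (s₁ - 1) / z ^ 2) s₁ θ₁)
    (h₂ : IsPruferAngle (fun z => s₂ * (s₂ - 1) / z ^ 2) s₂ θ₂)
    (hΘ₁ : Tendsto (fun z => θ₁ z - z) atTop (𝓝 Θ₁))
    (hΘ₂ : Tendsto (fun z => θ₂ z - z) atTop (𝓝 Θ₂)) :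
    0 ≤ Θ₁ - Θ₂ ∧ Θ₁ - Θ₂ ≤
      2 * (s₂ * (s₂ - 1) - s₁ * (s₁ - 1)) * Real.exp (s₂ * (s₂ - 1) + 1) := by
  set m₁ := s₁ * (s₁ - 1)
  set m₂ := s₂ * (s₂ - 1)
  have hm₁ : 0 ≤ m₁ := mul_nonneg (by linarith) (by linarith)
  have hm : m₁ ≤ m₂ := by simp only [m₁, m₂]; nlinarith
  have hm₂ : 0 ≤ m₂ := hm₁.trans hm
  have hc : ∀ m : ℝ, ContinuousOn (fun z : ℝ => m / z ^ 2) (Ioi 0) := fun m =>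
    continuousOn_const.div (continuousOn_id.pow 2) (fun z hz => (pow_pos (show 0 < z from hz) 2).ne')
  have hψ : ∀ z, 0 < z → 0 ≤ θ₁ z - θ₂ z := fun z hz => by
    have := h₁.sturm h₂ (hc _) (by linarith) hs (b := z)
      (fun x hx _ => div_le_div_of_nonneg_right hm (by positivity)) hz le_rfl
    linarith
  have hd : ∀ z, 0 < z → HasDerivAt (fun z => θ₁ z - θ₂ z) ((m₂ - m₁) / z ^ 2 * Real.sin (θ₁ z) ^ 2
      - m₂ / z ^ 2 * (Real.sin (θ₁ z - θ₂ z) * Real.sin (θ₁ z + θ₂ z))) z := fun z hz => by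
    refine ((h₁.hasDerivAt z hz).sub (h₂.hasDerivAt z hz)).congr_deriv ?_
    rw [← sin_sq_sub_sin_sq]; ring
  have htend : Tendsto (fun z => θ₁ z - θ₂ z) atTop (𝓝 (Θ₁ - Θ₂)) :=
    (hΘ₁.sub hΘ₂).congr fun z => by ring
  refine ⟨ge_of_tendsto htend ((eventually_gt_atTop 0).mono hψ), ?_⟩
  -- On `]0, 1]` both angles lie in `[0, 1]`, so the term in `sin (θ₁ - θ₂) sin (θ₁ + θ₂)` has a
  -- favourable sign. The bound `sin θ₁ ≤ z` cancels the singularity `1/z²` of the other one.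
  have h01 : θ₁ 1 - θ₂ 1 ≤ m₂ - m₁ := by
    have hA : AntitoneOn (fun z => θ₁ z - θ₂ z - (m₂ - m₁) * z) (Ioc 0 1) := by
      refine antitoneOn_of_hasDerivAt (convex_Ioc 0 1) (fun x hx => (hd x hx.1).sub
        ((hasDerivAt_id x).const_mul (m₂ - m₁))) (fun x hx => ?_)
      have e1 : θ₁ x ≤ x := h₁.le_self (fun z _ => div_nonneg hm₁ (sq_nonneg z)) hx.1
      have e2 : 0 ≤ θ₂ x := h₂.nonneg (hc _) (by linarith) hx.1
      have e3 := hψ x hx.1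
      have hpi := Real.pi_gt_three
      have hx1 := hx.2
      have e4 : 0 ≤ Real.sin (θ₁ x - θ₂ x) :=
        Real.sin_nonneg_of_nonneg_of_le_pi e3 (by linarith)
      have e5 : 0 ≤ Real.sin (θ₁ x + θ₂ x) :=
        Real.sin_nonneg_of_nonneg_of_le_pi (by linarith) (by linarith)
      have e6 : Real.sin (θ₁ x) ^ 2 ≤ x ^ 2 := by
        have a1 : Real.sin (θ₁ x) ≤ θ₁ x := Real.sin_le (by linarith)
        have a2 : 0 ≤ Real.sin (θ₁ x) :=
          Real.sin_nonneg_of_nonneg_of_le_pi (by linarith) (by linarith)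
        exact pow_le_pow_left₀ a2 (a1.trans e1) 2
      have e7 : (m₂ - m₁) / x ^ 2 * Real.sin (θ₁ x) ^ 2 ≤ m₂ - m₁ := by
        have hx2 : 0 < x ^ 2 := pow_pos hx.1 2
        calc _ ≤ (m₂ - m₁) / x ^ 2 * x ^ 2 :=
              mul_le_mul_of_nonneg_left e6 (div_nonneg (by linarith) hx2.le)
          _ = _ := div_mul_cancel₀ _ hx2.ne'
      have e8 := mul_nonneg (div_nonneg hm₂ (sq_nonneg x)) (mul_nonneg e4 e5)
      linarith
    have h1 : Tendsto (fun z : ℝ => θ₁ z - θ₂ z - (m₂ - m₁) * z) (𝓝[>] 0)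
        (𝓝 (0 - 0 - (m₂ - m₁) * 0)) :=
      (h₁.tendsto_zero.sub h₂.tendsto_zero).sub
        ((show Tendsto (fun z : ℝ => z) (𝓝[>] 0) (𝓝 0) from nhdsWithin_le_nhds).const_mul _)
    have : θ₁ 1 - θ₂ 1 - (m₂ - m₁) * 1 ≤ 0 - 0 - (m₂ - m₁) * 0 := by
      refine ge_of_tendsto h1 ?_
      filter_upwards [Ioc_mem_nhdsGT (zero_lt_one' ℝ)] with x hx
      exact hA hx ⟨one_pos, le_rfl⟩ hx.2
    linarith
  -- Gronwall on `[1, ∞[`: the logarithmic growth rate of `θ₁ - θ₂ + (m₂ - m₁)` is at most `(m₂ +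
  -- 1)/z²`, whose integral is `m₂ + 1`. The value at `1` is at most `2 (m₂ - m₁)`.
  have hA : AntitoneOn (fun z => (θ₁ z - θ₂ z + (m₂ - m₁)) * Real.exp ((m₂ + 1) / z)) (Ici 1) := by
    have hpos : ∀ x ∈ Ici (1 : ℝ), 0 < x := fun x hx => lt_of_lt_of_le one_pos hx
    refine antitoneOn_of_hasDerivAt (convex_Ici 1) (fun x hx => ((hd x (hpos x hx)).add_const
      (m₂ - m₁)).mul (((hasDerivAt_inv (hpos x hx).ne').const_mul (m₂ + 1)).exp)) (fun x hx => ?_)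
    have hx0 := hpos x hx
    have e3 := hψ x hx0
    have e4 : Real.sin (θ₁ x) ^ 2 ≤ 1 := Real.sin_sq_le_one _
    have e5 : -(Real.sin (θ₁ x - θ₂ x) * Real.sin (θ₁ x + θ₂ x)) ≤ θ₁ x - θ₂ x := by
      have a1 : |Real.sin (θ₁ x - θ₂ x)| ≤ |θ₁ x - θ₂ x| := Real.abs_sin_le_abs
      rw [abs_of_nonneg e3] at a1
      have a2 := Real.abs_sin_le_one (θ₁ x + θ₂ x)
      calc _ ≤ |Real.sin (θ₁ x - θ₂ x) * Real.sin (θ₁ x + θ₂ x)| := neg_le_abs _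
        _ ≤ _ := by rw [abs_mul]; exact (mul_le_of_le_one_right (abs_nonneg _) a2).trans a1
    have hexp := Real.exp_pos ((m₂ + 1) * x⁻¹)
    have hi : 0 < (x ^ 2)⁻¹ := by positivity
    have e6 : (m₂ - m₁) / x ^ 2 * Real.sin (θ₁ x) ^ 2
      - m₂ / x ^ 2 * (Real.sin (θ₁ x - θ₂ x) * Real.sin (θ₁ x + θ₂ x)) ≤
      (θ₁ x - θ₂ x + (m₂ - m₁)) * ((m₂ + 1) * (x ^ 2)⁻¹) := by
      have : (m₂ - m₁) * Real.sin (θ₁ x) ^ 2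
        - m₂ * (Real.sin (θ₁ x - θ₂ x) * Real.sin (θ₁ x + θ₂ x)) ≤
        (θ₁ x - θ₂ x + (m₂ - m₁)) * (m₂ + 1) := by
        nlinarith [mul_nonneg hm₂ (sub_nonneg.2 hm)]
      have := mul_le_mul_of_nonneg_right this hi.le
      rw [div_eq_mul_inv, div_eq_mul_inv]
      linarith
    have := mul_le_mul_of_nonneg_right e6 hexp.le
    simp only [div_eq_mul_inv] at this ⊢
    linarith
  refine le_of_tendsto htend ?_
  filter_upwards [eventually_ge_atTop 1] with z hz
  have h3 := hA (mem_Ici.2 le_rfl) hz hz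
  simp only [div_one] at h3
  have hz0 : 0 < z := lt_of_lt_of_le one_pos hz
  have h4 : 1 ≤ Real.exp ((m₂ + 1) / z) := Real.one_le_exp (by positivity)
  have h5 := hψ z hz0
  have h6 : θ₁ z - θ₂ z + (m₂ - m₁) ≤ (θ₁ z - θ₂ z + (m₂ - m₁)) * Real.exp ((m₂ + 1) / z) :=
    le_mul_of_one_le_right (by linarith) h4
  have h7 : (θ₁ 1 - θ₂ 1 + (m₂ - m₁)) * Real.exp (m₂ + 1) ≤
      2 * (m₂ - m₁) * Real.exp (m₂ + 1) :=
    mul_le_mul_of_nonneg_right (by linarith) (Real.exp_pos _).le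
  linarith


/-! ### The regular Bessel solution as an entire power series. -/

lemma summable_of_le_inv_factorial {c : ℕ → ℝ} (hc : ∀ n, |c n| ≤ 1 / (n.factorial : ℝ))
    {𝕜 : Type*} [RCLike 𝕜] (x : 𝕜) : Summable fun n => (c n : 𝕜) * x ^ n := by
  refine Summable.of_norm_bounded (Real.summable_pow_div_factorial ‖x‖) fun n => ?_
  rw [norm_mul, norm_pow, RCLike.norm_ofReal]
  calc _ ≤ 1 / (n.factorial : ℝ) * ‖x‖ ^ n := by gcongr; exact hc n
    _ = _ := by ring

/-- The bound `1/n!` is stable under termwise differentiation, so a single hypothesis serves for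
`G`, `G'` and `G''`. -/
lemma derivCoeff_le {c : ℕ → ℝ} (hc : ∀ n, |c n| ≤ 1 / (n.factorial : ℝ)) (n : ℕ) :
    |((n : ℝ) + 1) * c (n + 1)| ≤ 1 / (n.factorial : ℝ) := by
  have h := hc (n + 1)
  rw [abs_mul, abs_of_nonneg (by positivity)]
  calc _ ≤ ((n : ℝ) + 1) * (1 / ((n + 1).factorial : ℝ)) := by gcongr
    _ = _ := by
      rw [Nat.factorial_succ]; push_cast
      have : (n.factorial : ℝ) ≠ 0 := by positivity
      field_simp

/-- An entire power series may be differentiated termwise. -/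
lemma hasDerivAt_powerSeries {c : ℕ → ℝ} (hc : ∀ n, |c n| ≤ 1 / (n.factorial : ℝ))
    {𝕜 : Type*} [RCLike 𝕜] (x : 𝕜) :
    HasDerivAt (fun x : 𝕜 => ∑' n, (c n : 𝕜) * x ^ n)
      (∑' n : ℕ, ((((n : ℝ) + 1) * c (n + 1) : ℝ) : 𝕜) * x ^ n) x := by
  set R : ℝ := ‖x‖ + 1
  set u : ℕ → ℝ := fun n => |c n| * (n * R ^ (n - 1))
  have hu : Summable u := by
    rw [← summable_nat_add_iff 1]
    refine Summable.of_norm_bounded (Real.summable_pow_div_factorial R) fun n => ?_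
    have h := derivCoeff_le hc n
    rw [abs_mul, abs_of_nonneg (by positivity)] at h
    simp only [u]
    rw [Real.norm_of_nonneg (by positivity)]
    push_cast
    calc |c (n + 1)| * (((n : ℝ) + 1) * R ^ n) = (((n : ℝ) + 1) * |c (n + 1)|) * R ^ n := by ring
      _ ≤ 1 / (n.factorial : ℝ) * R ^ n := by gcongr
      _ = _ := by ring
  have hx : x ∈ Metric.ball (0 : 𝕜) R := by simp [R]
  have hx0 : (0 : 𝕜) ∈ Metric.ball (0 : 𝕜) R := by simp [R]; positivity
  have hmain := hasDerivAt_tsum_of_isPreconnected (g := fun n (y : 𝕜) => (c n : 𝕜) * y ^ n)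
    (g' := fun n (y : 𝕜) => (c n : 𝕜) * (n * y ^ (n - 1))) hu Metric.isOpen_ball
    (convex_ball (0 : 𝕜) R).isPreconnected
    (fun n y _ => (hasDerivAt_pow n y).const_mul _) (fun n y hy => ?_) hx0
    (summable_of_le_inv_factorial hc 0) hx
  · refine hmain.congr_deriv ?_
    rw [Summable.tsum_eq_zero_add]
    · simp only [Nat.cast_zero, zero_mul, mul_zero, zero_add, Nat.add_sub_cancel]
      refine tsum_congr fun n => ?_
      push_cast; ring
    · refine Summable.of_norm_bounded hu fun n => ?_
      rw [norm_mul, norm_mul, norm_pow, RCLike.norm_ofReal, RCLike.norm_natCast]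
      have : ‖x‖ ≤ R := by simp [R]
      simp only [u]
      gcongr
  · rw [norm_mul, norm_mul, norm_pow, RCLike.norm_ofReal, RCLike.norm_natCast]
    have : ‖y‖ ≤ R := by simpa using (mem_ball_zero_iff.1 hy).le
    simp only [u]
    gcongr

/-- Coefficients of the entire function `G` for which `z ^ s * G (z ^ 2)` is the regular solution
of `w'' = (s (s - 1) / z² - 1) w`. -/
noncomputable def besselCoeff (s : ℝ) : ℕ → ℝ
  | 0 => 1
  | n + 1 => -besselCoeff s n / (4 * (n + 1) * (n + 1 / 2 + s))

lemma besselCoeff_le {s : ℝ} (hs : 1 ≤ s) (n : ℕ) :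
    |besselCoeff s n| ≤ 1 / (n.factorial : ℝ) := by
  induction n with
  | zero => simp [besselCoeff]
  | succ n ih =>
    rw [besselCoeff, abs_div, abs_neg, abs_of_pos (a := 4 * ((n : ℝ) + 1) * (n + 1 / 2 + s))
      (by positivity), Nat.factorial_succ]
    push_cast
    have h1 : (n : ℝ) + 1 ≤ 4 * ((n : ℝ) + 1) * (n + 1 / 2 + s) := by
      have : (0 : ℝ) ≤ n := n.cast_nonneg
      nlinarith
    calc _ ≤ 1 / (n.factorial : ℝ) / ((n : ℝ) + 1) := by gcongr
      _ = _ := by rw [div_div, mul_comm]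

/-- Alternation of signs makes every term of `G` positive at `-R²`, that is, on the imaginary axis
of the variable `z`. -/
lemma besselCoeff_sign {s : ℝ} (hs : 1 ≤ s) (n : ℕ) : 0 < besselCoeff s n * (-1) ^ n := by
  induction n with
  | zero => simp [besselCoeff]
  | succ n ih =>
    have : besselCoeff s (n + 1) * (-1) ^ (n + 1) =
        besselCoeff s n * (-1) ^ n / (4 * (n + 1) * (n + 1 / 2 + s)) := by
      rw [besselCoeff, pow_succ]; ring
    rw [this]; positivity

/-- The coefficients of the derivative of `∑ c n x ^ n`. -/
def derivCoeff (c : ℕ → ℝ) (n : ℕ) : ℝ := ((n : ℝ) + 1) * c (n + 1)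

/-- The sum of the power series with real coefficients `c`. -/
noncomputable def seriesSum (𝕜 : Type*) [RCLike 𝕜] (c : ℕ → ℝ) (x : 𝕜) : 𝕜 :=
  ∑' n, (c n : 𝕜) * x ^ n

/-- `ζ²` is real at both ends `R` and `iR` of the quarter circle, so the complex solution is given
there by real series. -/
lemma seriesSum_ofReal (c : ℕ → ℝ) (x : ℝ) :
    seriesSum ℂ c (x : ℂ) = (seriesSum ℝ c x : ℝ) := by
  simp [seriesSum, Complex.ofReal_tsum]

/-- The differential equation `4 x G'' + (4 s + 2) G' + G = 0`. -/
lemma bessel_equation {s : ℝ} (hs : 1 ≤ s) {𝕜 : Type*} [RCLike 𝕜] (x : 𝕜) :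
    4 * x * seriesSum 𝕜 (derivCoeff (derivCoeff (besselCoeff s))) x +
      (4 * (s : 𝕜) + 2) * seriesSum 𝕜 (derivCoeff (besselCoeff s)) x +
      seriesSum 𝕜 (besselCoeff s) x = 0 := by
  have h0 := besselCoeff_le hs
  have h1 : ∀ n, |derivCoeff (besselCoeff s) n| ≤ _ := derivCoeff_le h0
  have h2 : ∀ n, |derivCoeff (derivCoeff (besselCoeff s)) n| ≤ _ := derivCoeff_le h1
  have e2 : x * seriesSum 𝕜 (derivCoeff (derivCoeff (besselCoeff s))) x =
      ∑' n : ℕ, (((n : ℝ) * derivCoeff (besselCoeff s) n : ℝ) : 𝕜) * x ^ n := by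
    have hs' : Summable fun n : ℕ => (((n : ℝ) * derivCoeff (besselCoeff s) n : ℝ) : 𝕜) * x ^ n := by
      rw [← summable_nat_add_iff 1]
      refine ((summable_of_le_inv_factorial h2 x).mul_left x).congr fun n => ?_
      rw [derivCoeff]; push_cast; ring
    rw [hs'.tsum_eq_zero_add, seriesSum, ← tsum_mul_left]
    simp only [Nat.cast_zero, zero_mul, RCLike.ofReal_zero, zero_add]
    refine tsum_congr fun n => ?_
    rw [derivCoeff]; push_cast; ring
  have hsum2 : Summable fun n : ℕ => (((n : ℝ) * derivCoeff (besselCoeff s) n : ℝ) : 𝕜) * x ^ n := by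
    rw [← summable_nat_add_iff 1]
    refine ((summable_of_le_inv_factorial h2 x).mul_left x).congr fun n => ?_
    rw [derivCoeff]; push_cast; ring
  rw [mul_assoc, e2, seriesSum, seriesSum, ← tsum_mul_left, ← tsum_mul_left,
    ← (hsum2.mul_left 4).tsum_add ((summable_of_le_inv_factorial h1 x).mul_left _),
    ← ((hsum2.mul_left 4).add ((summable_of_le_inv_factorial h1 x).mul_left _)).tsum_add
      (summable_of_le_inv_factorial h0 x)]
  refine (tsum_congr fun n => ?_).trans tsum_zero
  have h3 : 4 * (n : ℝ) * derivCoeff (besselCoeff s) n + (4 * s + 2) * derivCoeff (besselCoeff s) n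
      + besselCoeff s n = 0 := by
    rw [derivCoeff, besselCoeff]
    have : (n : ℝ) + 1 / 2 + s ≠ 0 := by positivity
    field_simp
    ring
  have h4 := congrArg (fun t : ℝ => (t : 𝕜) * x ^ n) h3
  simp only [RCLike.ofReal_zero, zero_mul] at h4
  rw [← h4]; push_cast; ring

lemma hasDerivAt_bessel₀ {s : ℝ} (hs : 1 ≤ s) {𝕜 : Type*} [RCLike 𝕜] (x : 𝕜) :
    HasDerivAt (seriesSum 𝕜 (besselCoeff s)) (seriesSum 𝕜 (derivCoeff (besselCoeff s)) x) x :=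
  hasDerivAt_powerSeries (besselCoeff_le hs) x

lemma hasDerivAt_bessel₁ {s : ℝ} (hs : 1 ≤ s) {𝕜 : Type*} [RCLike 𝕜] (x : 𝕜) :
    HasDerivAt (seriesSum 𝕜 (derivCoeff (besselCoeff s)))
      (seriesSum 𝕜 (derivCoeff (derivCoeff (besselCoeff s))) x) x :=
  hasDerivAt_powerSeries (derivCoeff_le (besselCoeff_le hs)) x

/-- Polar coordinates for the regular solution of `w'' = (s (s - 1) / z² - 1) w`. -/
lemma exists_prufer_bessel {s : ℝ} (hs : 1 ≤ s) :
    ∃ θ ρ : ℝ → ℝ, ∃ Θ A : ℝ, IsPruferAngle (fun z => s * (s - 1) / z ^ 2) s θ ∧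
      Tendsto (fun z => θ z - z) atTop (𝓝 Θ) ∧ 0 < A ∧ Tendsto ρ atTop (𝓝 A) ∧
      ∀ z, 0 < z →
        z ^ s * seriesSum ℝ (besselCoeff s) (z ^ 2) = ρ z * Real.sin (θ z) ∧
        z ^ s * (s / z * seriesSum ℝ (besselCoeff s) (z ^ 2) +
          2 * z * seriesSum ℝ (derivCoeff (besselCoeff s)) (z ^ 2)) = ρ z * Real.cos (θ z) := by
  set G := seriesSum ℝ (besselCoeff s)
  set G₁ := seriesSum ℝ (derivCoeff (besselCoeff s))
  set G₂ := seriesSum ℝ (derivCoeff (derivCoeff (besselCoeff s)))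
  have hG0 : G 0 = 1 := by
    simp only [G, seriesSum]
    rw [tsum_eq_single 0 (fun n hn => by simp [hn])]
    simp [besselCoeff]
  have hsq : ∀ z : ℝ, HasDerivAt (fun z : ℝ => z ^ 2) (2 * z) z := fun z => by
    simpa using hasDerivAt_pow 2 z
  have hG : ∀ z, HasDerivAt (fun z => G (z ^ 2)) (2 * z * G₁ (z ^ 2)) z := fun z =>
    ((show HasDerivAt G (G₁ (z ^ 2)) (z ^ 2) from hasDerivAt_bessel₀ hs _).comp_of_eq z
      (hsq z) rfl).congr_deriv (mul_comm _ _)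
  have hG₁ : ∀ z, HasDerivAt (fun z => G₁ (z ^ 2)) (2 * z * G₂ (z ^ 2)) z := fun z =>
    ((show HasDerivAt G₁ (G₂ (z ^ 2)) (z ^ 2) from hasDerivAt_bessel₁ hs _).comp_of_eq z
      (hsq z) rfl).congr_deriv (mul_comm _ _)
  have hG0' : Tendsto (fun z => G (z ^ 2)) (𝓝[>] 0) (𝓝 1) := by
    have := (hG 0).continuousAt.tendsto
    simp only [ne_eq, OfNat.ofNat_ne_zero, not_false_eq_true, zero_pow, hG0] at this
    exact this.mono_left nhdsWithin_le_nhds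
  have hpow : ∀ z : ℝ, 0 < z → HasDerivAt (fun z : ℝ => z ^ s) (s / z * z ^ s) z := fun z hz => by
    refine (Real.hasDerivAt_rpow_const (Or.inl hz.ne')).congr_deriv ?_
    rw [Real.rpow_sub_one hz.ne']; ring
  have hGpos : ∀ᶠ z in 𝓝[>] (0 : ℝ), 0 < G (z ^ 2) := hG0'.eventually (lt_mem_nhds one_pos)
  obtain ⟨θ, ρ, hθ, hρ, hρ', hrep⟩ := exists_prufer (P := fun z => s * (s - 1) / z ^ 2)
    (w := fun z => z ^ s * G (z ^ 2)) (w' := fun z => z ^ s * (s / z * G (z ^ 2) + 2 * z * G₁ (z ^ 2)))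
    (s := s) (by linarith)
    (continuousOn_const.div (continuousOn_id.pow 2)
      (fun z hz => (pow_pos (show 0 < z from hz) 2).ne'))
    (fun z hz => ((hpow z hz).mul (hG z)).congr_deriv (by ring))
    (fun z hz => by
      refine ((hpow z hz).mul ((((hasDerivAt_inv hz.ne').const_mul s).mul (hG z)).add
        (((hasDerivAt_id z).const_mul 2).mul (hG₁ z)))).congr_deriv ?_
      have h := bessel_equation hs (𝕜 := ℝ) (z ^ 2)
      simp only [RCLike.ofReal_real_eq_id, id] at h
      have h' : G (z ^ 2) = -(4 * z ^ 2 * G₂ (z ^ 2) + (4 * s + 2) * G₁ (z ^ 2)) := by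
        linear_combination h
      simp only [Pi.mul_apply, Pi.add_apply, id]
      have e : (s * (s - 1) / z ^ 2 - 1) * (z ^ s * G (z ^ 2)) =
        z ^ s * (s * (s - 1) / z ^ 2 * G (z ^ 2) - G (z ^ 2)) := by ring
      rw [e]
      nth_rewrite 4 [h']
      field_simp
      ring)
    (by
      filter_upwards [hGpos, self_mem_nhdsWithin] with z h1 h2
      exact mul_pos (Real.rpow_pos_of_pos h2 _) h1)
    (by
      have h1 : Tendsto (fun z : ℝ => z) (𝓝[>] 0) (𝓝 0) := nhdsWithin_le_nhds
      have h2 : Tendsto (fun z => G₁ (z ^ 2)) (𝓝[>] 0) (𝓝 (G₁ (0 ^ 2))) :=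
        (hG₁ 0).continuousAt.tendsto.mono_left nhdsWithin_le_nhds
      -- `z w'/w = s + 2 z² G'(z²)/G(z²)`.
      have h3 := (((h1.pow 2).mul h2).div hG0' one_ne_zero).const_mul 2 |>.const_add s
      simp only [ne_eq, OfNat.ofNat_ne_zero, not_false_eq_true, zero_pow, zero_mul, zero_div,
        mul_zero, add_zero] at h3
      refine h3.congr' ?_
      filter_upwards [hGpos, self_mem_nhdsWithin] with z h1 h2
      have hz : z ≠ 0 := ne_of_gt h2
      have hzs := (Real.rpow_pos_of_pos (show 0 < z from h2) s).ne'
      have := h1.ne'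
      simp only [Pi.div_apply]
      field_simp)
  have hb : ∀ z : ℝ, 1 ≤ z → |s * (s - 1) / z ^ 2| ≤ s * (s - 1) * z ^ (-1 - (1 : ℝ)) := by
    intro z hz
    rw [abs_of_nonneg (by positivity), show (-1 - 1 : ℝ) = -(2 : ℕ) by norm_num,
      Real.rpow_neg (by linarith), Real.rpow_natCast, div_eq_mul_inv]
  obtain ⟨Θ, hΘ⟩ := hθ.exists_phase one_pos one_pos hb
  obtain ⟨A, hA, hAρ⟩ := exists_amplitude hρ hρ' one_pos one_pos hb
  have ht : Tendsto (fun z : ℝ => z ^ (-1 : ℝ)) atTop (𝓝 0) := tendsto_rpow_neg_atTop one_pos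
  refine ⟨θ, ρ, Θ, A, hθ, ?_, hA, ?_, hrep⟩
  · rw [tendsto_iff_norm_sub_tendsto_zero]
    refine squeeze_zero' (Eventually.of_forall fun _ => norm_nonneg _)
      ((eventually_ge_atTop 1).mono hΘ) ?_
    simpa using ht.const_mul (s * (s - 1) / 1)
  · have := (hAρ.trans_tendsto ht).add_const A
    simpa using this


/-! ### The exact phase of the unperturbed equation. -/

/-- Transport of `e^{iζ} (w' - i w)` along a quarter circle of radius `R` in the upper half
plane, for a linear system of the form satisfied by `a = e^{iζ} (w' + i w)`,
`b = e^{iζ} (w' - i w)`. -/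
lemma quarter_circle_transport {a b ζ p : ℝ → ℂ} {m R : ℝ} (hR : 0 < R) (hm : 0 ≤ m)
    (ha : ∀ t, HasDerivAt a (-2 * ζ t * a t + p t * (a t - b t) / 2) t)
    (hb : ∀ t, HasDerivAt b (p t * (a t - b t) / 2) t)
    (hp : ∀ t, ‖p t‖ ≤ m / R) (hζ : ∀ t ∈ Icc 0 (Real.pi / 2), 0 ≤ (ζ t).re) :
    ‖b (Real.pi / 2) - b 0‖ ≤
      m / R * √((‖a 0‖ ^ 2 + ‖b 0‖ ^ 2) * Real.exp (2 * m / R * (Real.pi / 2))) *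
        (Real.pi / 2) := by
  set E : ℝ → ℝ := fun t => ‖a t‖ ^ 2 + ‖b t‖ ^ 2
  have hE0 : ∀ t, 0 ≤ E t := fun t => by positivity
  have hmR : 0 ≤ m / R := by positivity
  have hle : ∀ t ∈ Icc 0 (Real.pi / 2), E t ≤ E 0 * Real.exp (2 * m / R * (Real.pi / 2)) := by
    intro t ht
    have hA : AntitoneOn (fun t => E t * Real.exp (-(2 * m / R) * t)) (Icc 0 (Real.pi / 2)) := by
      refine antitoneOn_of_hasDerivAt (convex_Icc _ _)
        (fun x hx => ((ha x).norm_sq.add (hb x).norm_sq).mul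
          (((hasDerivAt_id x).const_mul (-(2 * m / R))).exp)) (fun x hx => ?_)
      have h1 : inner ℝ (a x) (-2 * ζ x * a x + p x * (a x - b x) / 2) ≤
          ‖a x‖ * (m / R * (‖a x‖ + ‖b x‖) / 2) := by
        rw [inner_add_right]
        -- The only coefficient that is large with `R` is dissipative, because `Re ζ ≥ 0` on the
        -- arc. The energy therefore grows at rate at most `2m/R`.
        have e1 : inner ℝ (a x) (-2 * ζ x * a x) ≤ 0 := by
          rw [Complex.inner]
          have : -2 * ζ x * a x * (starRingEnd ℂ) (a x) = ((-2 * ‖a x‖ ^ 2 : ℝ) : ℂ) * ζ x := by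
            rw [mul_assoc, Complex.mul_conj, Complex.normSq_eq_norm_sq]; push_cast; ring
          rw [this, Complex.re_ofReal_mul]
          nlinarith [hζ x hx, mul_nonneg (sq_nonneg ‖a x‖) (hζ x hx)]
        have e2 : inner ℝ (a x) (p x * (a x - b x) / 2) ≤ ‖a x‖ * ‖p x * (a x - b x) / 2‖ :=
          real_inner_le_norm _ _
        have e3 : ‖p x * (a x - b x) / 2‖ ≤ m / R * (‖a x‖ + ‖b x‖) / 2 := by
          rw [norm_div, norm_mul, Complex.norm_ofNat]
          gcongr
          · exact hp x
          · exact norm_sub_le _ _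
        have := mul_le_mul_of_nonneg_left e3 (norm_nonneg (a x))
        linarith
      have h2 : inner ℝ (b x) (p x * (a x - b x) / 2) ≤
          ‖b x‖ * (m / R * (‖a x‖ + ‖b x‖) / 2) := by
        have e2 : inner ℝ (b x) (p x * (a x - b x) / 2) ≤ ‖b x‖ * ‖p x * (a x - b x) / 2‖ :=
          real_inner_le_norm _ _
        have e3 : ‖p x * (a x - b x) / 2‖ ≤ m / R * (‖a x‖ + ‖b x‖) / 2 := by
          rw [norm_div, norm_mul, Complex.norm_ofNat]
          gcongr
          · exact hp x
          · exact norm_sub_le _ _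
        have := mul_le_mul_of_nonneg_left e3 (norm_nonneg (b x))
        linarith
      have h3 : 2 * inner ℝ (a x) (-2 * ζ x * a x + p x * (a x - b x) / 2) +
          2 * inner ℝ (b x) (p x * (a x - b x) / 2) ≤ 2 * m / R * E x := by
        have e4 : m / R * (‖a x‖ + ‖b x‖) ^ 2 ≤ m / R * (2 * E x) := by
          refine mul_le_mul_of_nonneg_left ?_ hmR
          simp only [E]
          nlinarith [sq_nonneg (‖a x‖ - ‖b x‖)]
        have e5 : 2 * m / R * E x = m / R * (2 * E x) := by ring
        rw [e5]
        nlinarith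
      have he := Real.exp_pos (-(2 * m / R) * x)
      simp only [Pi.add_apply, id]
      have := mul_le_mul_of_nonneg_right h3 he.le
      simp only [E] at this
      linarith
    have h0 : (0 : ℝ) ∈ Icc 0 (Real.pi / 2) := ⟨le_rfl, by positivity⟩
    have h1 := hA h0 ht ht.1
    simp only [mul_zero, Real.exp_zero, mul_one] at h1
    have h2 : E t = E t * Real.exp (-(2 * m / R) * t) * Real.exp (2 * m / R * t) := by
      rw [mul_assoc, ← Real.exp_add]; simp
    rw [h2]
    refine mul_le_mul h1 (Real.exp_le_exp.2 ?_) (Real.exp_pos _).le (hE0 0)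
    exact mul_le_mul_of_nonneg_left ht.2 (by positivity)
  -- The equation for `b` has no term in `ζ b`: its derivative is `O(m/R)` times the root of the
  -- energy, over an arc of parameter length `π/2`.
  have := norm_image_sub_le_of_norm_deriv_le_segment' (f := b) (a := 0) (b := Real.pi / 2)
    (C := m / R * √(E 0 * Real.exp (2 * m / R * (Real.pi / 2))))
    (fun x _ => (hb x).hasDerivWithinAt) (fun x hx => ?_) (Real.pi / 2)
    ⟨by positivity, le_rfl⟩
  · simpa using this
  · have hx' : x ∈ Icc 0 (Real.pi / 2) := ⟨hx.1, hx.2.le⟩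
    have h1 : ‖p x * (a x - b x) / 2‖ ≤ m / R * (‖a x‖ + ‖b x‖) / 2 := by
      rw [norm_div, norm_mul, Complex.norm_ofNat]
      gcongr
      · exact hp x
      · exact norm_sub_le _ _
    have h2 : (‖a x‖ + ‖b x‖) / 2 ≤ √(E 0 * Real.exp (2 * m / R * (Real.pi / 2))) := by
      refine Real.le_sqrt_of_sq_le (le_trans ?_ (hle x hx'))
      simp only [E]
      nlinarith [sq_nonneg (‖a x‖ - ‖b x‖), sq_nonneg ‖a x‖, sq_nonneg ‖b x‖]
    have h3 := mul_le_mul_of_nonneg_left h2 hmR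
    linarith

/-- Transport for the regular solution of `w'' = (s (s - 1) / ζ² - 1) w`. -/
lemma bessel_quarter_circle {s R : ℝ} (hs : 1 ≤ s) (hR : 0 < R) :
    ‖Complex.exp (-R) * (Complex.exp (s * (Real.pi / 2) * Complex.I) *
        (-Complex.I * (s / R * seriesSum ℝ (besselCoeff s) (-R ^ 2)
          - 2 * R * seriesSum ℝ (derivCoeff (besselCoeff s)) (-R ^ 2)
          + seriesSum ℝ (besselCoeff s) (-R ^ 2) : ℝ))) -
      Complex.exp (R * Complex.I) *
        (((s / R * seriesSum ℝ (besselCoeff s) (R ^ 2) +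
          2 * R * seriesSum ℝ (derivCoeff (besselCoeff s)) (R ^ 2) : ℝ) : ℂ) -
          Complex.I * (seriesSum ℝ (besselCoeff s) (R ^ 2) : ℝ))‖ ≤
      s * (s - 1) / R * √(2 * ((s / R * seriesSum ℝ (besselCoeff s) (R ^ 2) +
          2 * R * seriesSum ℝ (derivCoeff (besselCoeff s)) (R ^ 2)) ^ 2 +
          seriesSum ℝ (besselCoeff s) (R ^ 2) ^ 2) *
          Real.exp (2 * (s * (s - 1)) / R * (Real.pi / 2))) * (Real.pi / 2) := by
  set G := seriesSum ℂ (besselCoeff s)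
  set G₁ := seriesSum ℂ (derivCoeff (besselCoeff s))
  set G₂ := seriesSum ℂ (derivCoeff (derivCoeff (besselCoeff s)))
  have hRc : (R : ℂ) ≠ 0 := by exact_mod_cast hR.ne'
  set ζ : ℝ → ℂ := fun t => R * Complex.exp (t * Complex.I)
  have hζ0 : ∀ t, ζ t ≠ 0 := fun t => mul_ne_zero hRc (Complex.exp_ne_zero _)
  have hlin : ∀ (k : ℂ) (t : ℝ), HasDerivAt (fun t : ℝ => k * (t : ℂ) * Complex.I)
      (k * Complex.I) t := fun k t => by
    have h1 : HasDerivAt (fun t : ℝ => (t : ℂ)) 1 t := Complex.ofRealCLM.hasDerivAt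
    simpa using (h1.const_mul k).mul_const Complex.I
  have hζ : ∀ t, HasDerivAt ζ (Complex.I * ζ t) t := fun t => by
    have := ((hlin 1 t).cexp).const_mul (R : ℂ)
    simp only [one_mul] at this
    exact this.congr_deriv (by simp only [ζ]; ring)
  -- The phase of `ζ^s`. Its modulus `R^s` is constant on the arc and is left out, so `W` is
  -- `R^(-s)` times the continued solution, and `W₁` the same multiple of its derivative.
  set e : ℝ → ℂ := fun t => Complex.exp (s * t * Complex.I)
  have he : ∀ t, HasDerivAt e (s * Complex.I * e t) t := fun t =>
    ((hlin s t).cexp).congr_deriv (mul_comm _ _)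
  have hζ2 : ∀ t, HasDerivAt (fun t => ζ t ^ 2) (2 * Complex.I * ζ t ^ 2) t := fun t =>
    ((hζ t).pow 2).congr_deriv (by push_cast; ring)
  have hg : ∀ t, HasDerivAt (fun t => G (ζ t ^ 2)) (2 * Complex.I * ζ t ^ 2 * G₁ (ζ t ^ 2)) t :=
    fun t => ((show HasDerivAt G (G₁ (ζ t ^ 2)) (ζ t ^ 2) from
      hasDerivAt_bessel₀ hs _).comp_of_eq t (hζ2 t) rfl).congr_deriv (mul_comm _ _)
  have hg₁ : ∀ t, HasDerivAt (fun t => G₁ (ζ t ^ 2)) (2 * Complex.I * ζ t ^ 2 * G₂ (ζ t ^ 2)) t :=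
    fun t => ((show HasDerivAt G₁ (G₂ (ζ t ^ 2)) (ζ t ^ 2) from
      hasDerivAt_bessel₁ hs _).comp_of_eq t (hζ2 t) rfl).congr_deriv (mul_comm _ _)
  set W : ℝ → ℂ := fun t => e t * G (ζ t ^ 2)
  set W₁ : ℝ → ℂ := fun t => e t * (s * (ζ t)⁻¹ * G (ζ t ^ 2) + 2 * ζ t * G₁ (ζ t ^ 2))
  have hW : ∀ t, HasDerivAt W (Complex.I * ζ t * W₁ t) t := fun t => by
    refine ((he t).mul (hg t)).congr_deriv ?_
    have := hζ0 t
    simp only [W₁]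
    field_simp
  have hW₁ : ∀ t, HasDerivAt W₁ (Complex.I * ζ t * ((s * (s - 1) / ζ t ^ 2 - 1) * W t)) t :=
    fun t => by
    have h0 := hζ0 t
    refine ((he t).mul ((((hζ t).inv h0).const_mul (s : ℂ)).mul (hg t) |>.add
      (((hζ t).const_mul 2).mul (hg₁ t)))).congr_deriv ?_
    have h : 4 * ζ t ^ 2 * G₂ (ζ t ^ 2) + (4 * (s : ℂ) + 2) * G₁ (ζ t ^ 2) + G (ζ t ^ 2) = 0 :=
      bessel_equation hs (ζ t ^ 2)
    have h' : G (ζ t ^ 2) = -(4 * ζ t ^ 2 * G₂ (ζ t ^ 2) + (4 * s + 2) * G₁ (ζ t ^ 2)) := by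
      linear_combination h
    simp only [Pi.mul_apply, Pi.add_apply, Pi.inv_apply, W]
    have e1 : Complex.I * ζ t * ((s * (s - 1) / ζ t ^ 2 - 1) * (e t * G (ζ t ^ 2))) =
      Complex.I * ζ t * e t * (s * (s - 1) / ζ t ^ 2 * G (ζ t ^ 2) - G (ζ t ^ 2)) := by ring
    rw [e1]
    nth_rewrite 4 [h']
    field_simp
    ring
  have hζe : ∀ t, HasDerivAt (fun t => Complex.exp (Complex.I * ζ t))
      (-ζ t * Complex.exp (Complex.I * ζ t)) t := fun t =>
    ((hζ t).const_mul Complex.I).cexp.congr_deriv (by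
      linear_combination (ζ t * Complex.exp (Complex.I * ζ t)) * Complex.I_mul_I)
  have hm : 0 ≤ s * (s - 1) := mul_nonneg (by linarith) (by linarith)
  have hmain := quarter_circle_transport (R := R) (m := s * (s - 1)) (ζ := ζ)
    (p := fun t => s * (s - 1) / ζ t)
    (a := fun t => Complex.exp (Complex.I * ζ t) * (W₁ t + Complex.I * W t))
    (b := fun t => Complex.exp (Complex.I * ζ t) * (W₁ t - Complex.I * W t))
    hR hm
    (fun t => by
      have h0 := hζ0 t
      refine ((hζe t).mul ((hW₁ t).add ((hW t).const_mul Complex.I))).congr_deriv ?_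
      simp only [Pi.add_apply]
      field_simp
      ring_nf
      simp only [Complex.I_sq]
      ring)
    (fun t => by
      have h0 := hζ0 t
      refine ((hζe t).mul ((hW₁ t).sub ((hW t).const_mul Complex.I))).congr_deriv ?_
      simp only [Pi.sub_apply]
      field_simp
      ring_nf
      simp only [Complex.I_sq]
      ring)
    (fun t => by
      have : (s : ℂ) * (s - 1) = ((s * (s - 1) : ℝ) : ℂ) := by push_cast; ring
      rw [norm_div, this, Complex.norm_real, Real.norm_of_nonneg hm]
      simp only [ζ]
      rw [norm_mul, Complex.norm_exp_ofReal_mul_I, mul_one, Complex.norm_real,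
        Real.norm_of_nonneg hR.le])
    (fun t ht => by
      simp only [ζ]
      rw [Complex.re_ofReal_mul, Complex.exp_ofReal_mul_I_re]
      exact mul_nonneg hR.le (Real.cos_nonneg_of_neg_pi_div_two_le_of_le
        (by have := Real.pi_pos; linarith [ht.1]) ht.2))
  -- Endpoint values: real data at `R`; at `iR` a real number times `exp (i s π/2)` and a factor
  -- `-i`.
  have z0 : ζ 0 = R := by simp [ζ]
  have z1 : ζ (Real.pi / 2) = R * Complex.I := by
    simp only [ζ]; push_cast; rw [Complex.exp_pi_div_two_mul_I]
  have q0 : ζ 0 ^ 2 = ((R ^ 2 : ℝ) : ℂ) := by rw [z0]; push_cast; ring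
  have q1 : ζ (Real.pi / 2) ^ 2 = ((-R ^ 2 : ℝ) : ℂ) := by
    rw [z1, mul_pow, Complex.I_sq]; push_cast; ring
  have g0 : G (ζ 0 ^ 2) = (seriesSum ℝ (besselCoeff s) (R ^ 2) : ℝ) := by
    rw [q0]; exact seriesSum_ofReal _ _
  have g10 : G₁ (ζ 0 ^ 2) = (seriesSum ℝ (derivCoeff (besselCoeff s)) (R ^ 2) : ℝ) := by
    rw [q0]; exact seriesSum_ofReal _ _
  have g1 : G (ζ (Real.pi / 2) ^ 2) = (seriesSum ℝ (besselCoeff s) (-R ^ 2) : ℝ) := by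
    rw [q1]; exact seriesSum_ofReal _ _
  have g11 : G₁ (ζ (Real.pi / 2) ^ 2) =
      (seriesSum ℝ (derivCoeff (besselCoeff s)) (-R ^ 2) : ℝ) := by
    rw [q1]; exact seriesSum_ofReal _ _
  have w0 : W 0 = (seriesSum ℝ (besselCoeff s) (R ^ 2) : ℝ) := by
    simp only [W, g0]; simp [e]
  have w10 : W₁ 0 = ((s / R * seriesSum ℝ (besselCoeff s) (R ^ 2) +
      2 * R * seriesSum ℝ (derivCoeff (besselCoeff s)) (R ^ 2) : ℝ) : ℂ) := by
    simp only [W₁, g0, g10]; rw [z0, show e 0 = 1 by simp [e]]; push_cast; ring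
  set X : ℝ := s / R * seriesSum ℝ (besselCoeff s) (R ^ 2) +
      2 * R * seriesSum ℝ (derivCoeff (besselCoeff s)) (R ^ 2)
  set Y : ℝ := seriesSum ℝ (besselCoeff s) (R ^ 2)
  have b1 : Complex.exp (Complex.I * ζ (Real.pi / 2)) * (W₁ (Real.pi / 2) -
      Complex.I * W (Real.pi / 2)) =
      Complex.exp (-R) * (Complex.exp (s * (Real.pi / 2) * Complex.I) *
        (-Complex.I * (s / R * seriesSum ℝ (besselCoeff s) (-R ^ 2)
          - 2 * R * seriesSum ℝ (derivCoeff (besselCoeff s)) (-R ^ 2)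
          + seriesSum ℝ (besselCoeff s) (-R ^ 2) : ℝ))) := by
    simp only [W₁, W, g1, g11, e]
    rw [z1]
    rw [show Complex.I * (R * Complex.I) = -R by linear_combination (R : ℂ) * Complex.I_mul_I]
    rw [mul_inv, Complex.inv_I]
    push_cast
    congr 1
    rw [show ∀ E A B C : ℂ, E * (A + B) - Complex.I * (E * C) = E * (A + B - Complex.I * C) from
      fun E A B C => by ring]
    congr 1
    ring
  have na : ∀ σ : ℂ, σ = Complex.I ∨ σ = -Complex.I →
      ‖Complex.exp (Complex.I * ζ 0) * (W₁ 0 + σ * W 0)‖ ^ 2 = X ^ 2 + Y ^ 2 := by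
    intro σ hσ
    rw [z0, mul_comm Complex.I, norm_mul, Complex.norm_exp_ofReal_mul_I, one_mul, w0, w10]
    rw [← Complex.normSq_eq_norm_sq, Complex.normSq_apply]
    rcases hσ with rfl | rfl <;> simp <;> ring
  have n1 := na Complex.I (Or.inl rfl)
  have n2 := na (-Complex.I) (Or.inr rfl)
  rw [neg_mul, ← sub_eq_add_neg] at n2
  rw [n1, n2, b1, w0, w10, z0, mul_comm Complex.I (R : ℂ), ← two_mul] at hmain
  exact hmain

/-- The asymptotic phase of the regular solution of `w'' = (s (s - 1) / z² - 1) w` modulo `2π`. -/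
lemma exists_bessel_phase_mod {s : ℝ} (hs : 1 ≤ s) :
    ∃ (θ : ℝ → ℝ) (n : ℤ), IsPruferAngle (fun z => s * (s - 1) / z ^ 2) s θ ∧
      Tendsto (fun z => θ z - z) atTop (𝓝 ((1 - s) * (Real.pi / 2) + 2 * Real.pi * n)) := by
  obtain ⟨θ, ρ, Θ, A, hθ, hΘ, hA, hρ, hrep⟩ := exists_prufer_bessel hs
  suffices h : Complex.exp (-Θ * Complex.I) =
      Complex.exp (s * (Real.pi / 2) * Complex.I) * -Complex.I by
    have h1 : Complex.exp (s * (Real.pi / 2) * Complex.I) * -Complex.I =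
        Complex.exp ((s - 1) * (Real.pi / 2) * Complex.I) := by
      rw [show ((s : ℂ) - 1) * (Real.pi / 2) * Complex.I =
        s * (Real.pi / 2) * Complex.I + -(Real.pi / 2 * Complex.I) by ring, Complex.exp_add,
        Complex.exp_neg, Complex.exp_pi_div_two_mul_I, Complex.inv_I]
    rw [h1, Complex.exp_eq_exp_iff_exists_int] at h
    obtain ⟨n, hn⟩ := h
    refine ⟨θ, -n, hθ, ?_⟩
    have h2 : (-Θ : ℂ) = (s - 1) * (Real.pi / 2) + n * (2 * Real.pi) := by
      apply mul_right_cancel₀ Complex.I_ne_zero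
      rw [hn]; ring
    have h3 : -Θ = (s - 1) * (Real.pi / 2) + n * (2 * Real.pi) := by exact_mod_cast h2
    convert hΘ using 2
    push_cast
    linarith
  set m := s * (s - 1)
  -- `T R * u` is the transported quantity at `iR`. Its argument `u` does not depend on `R`, and `T
  -- ≥ 0` by the alternating signs of the coefficients. At `R` the quantity is `ρ exp (-i(θ - R))`.
  set T : ℝ → ℝ := fun R => R ^ s * Real.exp (-R) *
    (s / R * seriesSum ℝ (besselCoeff s) (-R ^ 2)
          - 2 * R * seriesSum ℝ (derivCoeff (besselCoeff s)) (-R ^ 2)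
          + seriesSum ℝ (besselCoeff s) (-R ^ 2))
  set u : ℂ := Complex.exp (s * (Real.pi / 2) * Complex.I) * -Complex.I
  have hu : ‖u‖ = 1 := by
    simp only [u]
    rw [norm_mul, norm_neg, Complex.norm_I, mul_one]
    have := Complex.norm_exp_ofReal_mul_I (s * (Real.pi / 2))
    push_cast at this
    exact this
  have hT : ∀ R, 0 < R → 0 ≤ T R := by
    intro R hR
    have h1 : 0 ≤ seriesSum ℝ (besselCoeff s) (-R ^ 2) := by
      refine tsum_nonneg fun n => ?_
      have := (besselCoeff_sign hs n).le
      rw [neg_pow]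
      simp only [RCLike.ofReal_real_eq_id, id]
      rw [← mul_assoc]
      exact mul_nonneg this (by positivity)
    have h2 : seriesSum ℝ (derivCoeff (besselCoeff s)) (-R ^ 2) ≤ 0 := by
      refine tsum_nonpos fun n => ?_
      have := (besselCoeff_sign hs (n + 1)).le
      rw [neg_pow, derivCoeff]
      simp only [RCLike.ofReal_real_eq_id, id]
      rw [show ((n : ℝ) + 1) * besselCoeff s (n + 1) * ((-1) ^ n * (R ^ 2) ^ n) =
        -((n + 1) * (R ^ 2) ^ n * (besselCoeff s (n + 1) * (-1) ^ (n + 1))) by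
          rw [pow_succ (-1 : ℝ)]; ring]
      exact neg_nonpos.2 (mul_nonneg (by positivity) this)
    have h3 : 0 ≤ s / R * seriesSum ℝ (besselCoeff s) (-R ^ 2) := by positivity
    have h4 : 0 ≤ -(2 * R * seriesSum ℝ (derivCoeff (besselCoeff s)) (-R ^ 2)) := by
      rw [neg_nonneg]; exact mul_nonpos_of_nonneg_of_nonpos (by positivity) h2
    refine mul_nonneg (by positivity) (by linarith)
  have hlim1 : Tendsto (fun R : ℝ => (ρ R : ℂ) * Complex.exp (-((θ R - R : ℝ) : ℂ) * Complex.I))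
      atTop (𝓝 (A * Complex.exp (-Θ * Complex.I))) := by
    have h1 : Tendsto (fun R => (ρ R : ℂ)) atTop (𝓝 A) :=
      (Complex.continuous_ofReal.tendsto A).comp hρ
    have h2 : Continuous fun x : ℝ => Complex.exp (-(x : ℂ) * Complex.I) := by fun_prop
    exact h1.mul ((h2.tendsto Θ).comp hΘ)
  have hdiff : ∀ᶠ R in atTop, ‖(T R : ℂ) * u -
      (ρ R : ℂ) * Complex.exp (-((θ R - R : ℝ) : ℂ) * Complex.I)‖ ≤
      m / R * (ρ R * √(2 * Real.exp (2 * m / R * (Real.pi / 2)))) * (Real.pi / 2) := by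
    filter_upwards [eventually_gt_atTop 0, hρ.eventually (lt_mem_nhds hA)] with R hR hρR
    have h := bessel_quarter_circle hs hR
    obtain ⟨r1, r2⟩ := hrep R hR
    have hRs := Real.rpow_pos_of_pos hR s
    set X : ℝ := s / R * seriesSum ℝ (besselCoeff s) (R ^ 2) +
      2 * R * seriesSum ℝ (derivCoeff (besselCoeff s)) (R ^ 2)
    set Y : ℝ := seriesSum ℝ (besselCoeff s) (R ^ 2)
    have h' := mul_le_mul_of_nonneg_left h hRs.le
    have e1 : R ^ s * (m / R * √(2 * (X ^ 2 + Y ^ 2) *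
        Real.exp (2 * m / R * (Real.pi / 2))) * (Real.pi / 2)) =
        m / R * (ρ R * √(2 * Real.exp (2 * m / R * (Real.pi / 2)))) * (Real.pi / 2) := by
      have e2 : ρ R = R ^ s * √(X ^ 2 + Y ^ 2) := by
        have : (R ^ s) ^ 2 * (X ^ 2 + Y ^ 2) = ρ R ^ 2 := by
          have := Real.sin_sq_add_cos_sq (θ R)
          linear_combination (R ^ s * X + ρ R * Real.cos (θ R)) * r2 +
            (R ^ s * Y + ρ R * Real.sin (θ R)) * r1 + ρ R ^ 2 * this
        rw [← Real.sqrt_sq hρR.le, ← this, Real.sqrt_mul (sq_nonneg _), Real.sqrt_sq hRs.le]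
      rw [e2, show 2 * (X ^ 2 + Y ^ 2) * Real.exp (2 * m / R * (Real.pi / 2)) =
        (X ^ 2 + Y ^ 2) * (2 * Real.exp (2 * m / R * (Real.pi / 2))) by ring,
        Real.sqrt_mul (by positivity)]
      ring
    rw [e1] at h'
    refine le_trans (le_of_eq ?_) h'
    rw [← Real.norm_of_nonneg hRs.le, ← Complex.norm_real, ← norm_mul, mul_sub]
    congr 2
    · simp only [T, u]; push_cast; ring
    · have r1' : (R ^ s : ℝ) * (Y : ℂ) = ρ R * Real.sin (θ R) := by exact_mod_cast r1
      have r2' : (R ^ s : ℝ) * (X : ℂ) = ρ R * Real.cos (θ R) := by exact_mod_cast r2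
      rw [show -((θ R - R : ℝ) : ℂ) * Complex.I = R * Complex.I + (-θ R : ℝ) * Complex.I by
        push_cast; ring, Complex.exp_add, Complex.exp_mul_I (-θ R : ℝ)]
      rw [Complex.ofReal_neg, Complex.cos_neg, Complex.sin_neg]
      push_cast at r1' r2' ⊢
      linear_combination (-Complex.exp (R * Complex.I)) * r2' +
        (Complex.I * Complex.exp (R * Complex.I)) * r1'
  have hzero : Tendsto (fun R => (T R : ℂ) * u -
      (ρ R : ℂ) * Complex.exp (-((θ R - R : ℝ) : ℂ) * Complex.I)) atTop (𝓝 0) := by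
    refine squeeze_zero_norm' hdiff ?_
    have h1 : Tendsto (fun R : ℝ => m / R) atTop (𝓝 0) := tendsto_const_nhds.div_atTop tendsto_id
    have h2 : Tendsto (fun R : ℝ => 2 * m / R) atTop (𝓝 0) :=
      tendsto_const_nhds.div_atTop tendsto_id
    have h3 : Continuous fun x : ℝ => √(2 * Real.exp (x * (Real.pi / 2))) := by fun_prop
    have := (h1.mul (hρ.mul ((h3.tendsto 0).comp h2))).mul_const (Real.pi / 2)
    simpa using this
  have hTu : Tendsto (fun R => (T R : ℂ) * u) atTop (𝓝 (A * Complex.exp (-Θ * Complex.I))) := by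
    have := hzero.add hlim1
    simpa using this
  -- Taking norms in `T u → A exp (-iΘ)` gives `T → A`, as `T ≥ 0` and `‖u‖ = 1`; dividing by `A`
  -- identifies `exp (-iΘ)` with `u`.
  have hTA : Tendsto T atTop (𝓝 A) := by
    have h1 := hTu.norm
    have h2 : ‖(A : ℂ) * Complex.exp (-Θ * Complex.I)‖ = A := by
      have := Complex.norm_exp_ofReal_mul_I (-Θ)
      push_cast at this
      rw [norm_mul, this, mul_one, Complex.norm_real, Real.norm_of_nonneg hA.le]
    rw [h2] at h1
    refine h1.congr' ?_
    filter_upwards [eventually_gt_atTop 0] with R hR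
    rw [norm_mul, hu, mul_one, Complex.norm_real, Real.norm_of_nonneg (hT R hR)]
  have hTu' : Tendsto (fun R => (T R : ℂ) * u) atTop (𝓝 (A * u)) :=
    ((Complex.continuous_ofReal.tendsto A).comp hTA).mul_const u
  have := tendsto_nhds_unique hTu hTu'
  exact mul_left_cancel₀ (by exact_mod_cast hA.ne') this

/-- The asymptotic phase of the regular solution of `w'' = (s (s - 1) / z² - 1) w`. -/
theorem exists_bessel_phase {s : ℝ} (hs : 1 ≤ s) :
    ∃ θ : ℝ → ℝ, IsPruferAngle (fun z => s * (s - 1) / z ^ 2) s θ ∧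
      Tendsto (fun z => θ z - z) atTop (𝓝 ((1 - s) * (Real.pi / 2))) := by
  -- It remains to show that the integer `n s` vanishes. At `s = 1` the equation is `θ' = 1`, so `θ
  -- = z`; connectedness of `[1, ∞[` then gives the rest.
  choose! θ n hθ hn using fun s (hs : (1 : ℝ) ≤ s) => exists_bessel_phase_mod hs
  have hpi := Real.pi_pos
  have h1 : n 1 = 0 := by
    have h0 : ∀ z, 0 < z → θ 1 z = z := by
      intro z hz
      have hd : ∀ x ∈ Ioi (0 : ℝ), HasDerivAt (fun z => θ 1 z - z) 0 x := fun x hx =>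
        (((hθ 1 le_rfl).hasDerivAt x hx).sub (hasDerivAt_id x)).congr_deriv (by simp)
      have hc : Tendsto (fun z => θ 1 z - z) (𝓝[>] 0) (𝓝 (0 - 0)) :=
        (hθ 1 le_rfl).tendsto_zero.sub nhdsWithin_le_nhds
      have hc' : Tendsto (fun z => θ 1 z - z) (𝓝[>] 0) (𝓝 (θ 1 z - z)) := by
        refine tendsto_const_nhds.congr' ?_
        filter_upwards [self_mem_nhdsWithin] with x hx
        exact eqOn_const_of_hasDerivAt_zero (convex_Ioi 0) hd (show z ∈ Ioi 0 from hz) hx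
      have := tendsto_nhds_unique hc' hc
      linarith
    have h2 : Tendsto (fun z => θ 1 z - z) atTop (𝓝 0) := by
      refine tendsto_const_nhds.congr' ?_
      filter_upwards [eventually_gt_atTop 0] with z hz
      rw [h0 z hz, sub_self]
    have h3 := tendsto_nhds_unique (hn 1 le_rfl) h2
    simp only [sub_self, zero_mul, zero_add, mul_eq_zero, Int.cast_eq_zero] at h3
    rcases h3 with (h3 | h3) | h3
    · norm_num at h3
    · linarith
    · exact h3
  -- By `bessel_phase_sub_le` the phase is locally Lipschitz in `s`, so near `t` the quantity `2π |n
  -- x - n t|` is below `2π` and the integers agree.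
  have hcont : ContinuousOn n (Ici 1) := by
    intro t ht
    have ht' : (1 : ℝ) ≤ t := ht
    set f : ℝ → ℝ := fun s => 2 * |s * (s - 1) - t * (t - 1)| *
      (Real.exp (s * (s - 1) + 1) + Real.exp (t * (t - 1) + 1)) + |s - t| * (Real.pi / 2)
    have hf : Continuous f := by fun_prop
    have hft : Tendsto f (𝓝[Ici 1] t) (𝓝 0) := by
      have := (hf.tendsto t).mono_left (nhdsWithin_le_nhds (s := Ici 1))
      simpa [f] using this
    have hbound : ∀ a b : ℝ, 1 ≤ a → a < b →
        |2 * Real.pi * ((n a : ℝ) - n b)| ≤ 2 * |b * (b - 1) - a * (a - 1)| *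
          (Real.exp (b * (b - 1) + 1)) + |a - b| * (Real.pi / 2) := by
      intro a b ha hab
      have hb := ha.trans hab.le
      obtain ⟨u1, u2⟩ := bessel_phase_sub_le ha hab (hθ a ha) (hθ b hb) (hn a ha) (hn b hb)
      rw [abs_of_nonneg (a := b * (b - 1) - a * (a - 1)) (by nlinarith), abs_of_neg (sub_neg.2 hab),
        abs_le]
      have : 0 ≤ (b - a) * (Real.pi / 2) := mul_nonneg (by linarith) (by positivity)
      constructor <;> linarith
    have hev : ∀ᶠ x in 𝓝[Ici 1] t, n x = n t := by
      filter_upwards [hft.eventually (gt_mem_nhds (show 0 < 2 * Real.pi by positivity)),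
        self_mem_nhdsWithin] with x hx hx1
      have key : |2 * Real.pi * ((n x : ℝ) - n t)| ≤ f x := by
        have q1 := mul_nonneg (mul_nonneg zero_le_two (abs_nonneg (x * (x - 1) - t * (t - 1))))
          (Real.exp_pos (x * (x - 1) + 1)).le
        have q2 := mul_nonneg (mul_nonneg zero_le_two (abs_nonneg (x * (x - 1) - t * (t - 1))))
          (Real.exp_pos (t * (t - 1) + 1)).le
        rcases lt_trichotomy x t with h | h | h
        · have := hbound x t hx1 h
          rw [abs_sub_comm (t * (t - 1))] at this
          simp only [f]; linarith
        · subst h; simp [f]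
        · have := hbound t x ht' h
          rw [abs_mul, abs_sub_comm (n t : ℝ), ← abs_mul, abs_sub_comm t x] at this
          simp only [f]; linarith
      have h6 := key.trans_lt hx
      rw [abs_mul, abs_of_pos (show 0 < 2 * Real.pi by positivity)] at h6
      have h7 : |(n x : ℝ) - n t| < 1 := by
        by_contra h8
        push Not at h8
        nlinarith
      have h8 : |n x - n t| < 1 := by exact_mod_cast h7
      have := Int.abs_lt_one_iff.1 h8
      omega
    exact tendsto_const_nhds.congr' (hev.mono fun x hx => hx.symm)
  have hns : n s = 0 := by
    rw [← h1]
    exact isPreconnected_Ici.constant hcont hs (mem_Ici.2 le_rfl)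
  refine ⟨θ s, hθ s hs, ?_⟩
  simpa [hns] using hn s hs


/-! ### Adiabatic comparison and large `s`. -/

/-- The angle `α` with `tan α = S tan θ` on the same branch as `θ`. -/
noncomputable def scaledAngle (S θ : ℝ) : ℝ :=
  θ + Real.arctan ((S - 1) * (Real.sin θ * Real.cos θ) / (Real.cos θ ^ 2 + S * Real.sin θ ^ 2))

lemma cos_sq_add_mul_sin_sq_pos {S : ℝ} (hS : 0 < S) (x : ℝ) :
    0 < Real.cos x ^ 2 + S * Real.sin x ^ 2 := by
  have h := Real.sin_sq_add_cos_sq x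
  rcases eq_or_ne (Real.sin x) 0 with h0 | h0
  · rw [h0] at h ⊢; nlinarith
  · have : 0 < Real.sin x ^ 2 := by positivity
    nlinarith [sq_nonneg (Real.cos x), mul_pos hS this]

/-- For `θ' = 1 - (1 - S²) sin² θ` the numerator `S θ'` is `S` times the denominator. The rescaled
angle then has speed exactly `S`, whatever the solution, apart from the term in `S'`. -/
lemma hasDerivAt_scaledAngle {θ S : ℝ → ℝ} {θ' S' z : ℝ} (hθ : HasDerivAt θ θ' z)
    (hS : HasDerivAt S S' z) (hS0 : 0 < S z) :
    HasDerivAt (fun z => scaledAngle (S z) (θ z))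
      ((S z * θ' + S' * (Real.sin (θ z) * Real.cos (θ z))) /
        (Real.cos (θ z) ^ 2 + S z ^ 2 * Real.sin (θ z) ^ 2)) z := by
  have hQ := cos_sq_add_mul_sin_sq_pos hS0 (θ z)
  have hD := cos_sq_add_mul_sin_sq_pos (pow_pos hS0 2) (θ z)
  have h1 := (hS.sub_const 1).mul (hθ.sin.mul hθ.cos)
  have h2 := (hθ.cos.pow 2).add (hS.mul (hθ.sin.pow 2))
  refine (hθ.add (h1.div h2 hQ.ne').arctan).congr_deriv ?_
  simp only [Pi.mul_apply, Pi.add_apply, Pi.div_apply, Pi.pow_apply]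
  have hsc := Real.sin_sq_add_cos_sq (θ z)
  set s := Real.sin (θ z)
  set c := Real.cos (θ z)
  have e : 1 + ((S z - 1) * (s * c) / (c ^ 2 + S z * s ^ 2)) ^ 2 =
      (c ^ 2 + S z ^ 2 * s ^ 2) / (c ^ 2 + S z * s ^ 2) ^ 2 := by
    field_simp
    linear_combination (c ^ 2 + S z ^ 2 * s ^ 2) * hsc
  rw [e]
  have e1 : S z * θ' + S' * (s * c) = θ' * (c ^ 2 + S z ^ 2 * s ^ 2) +
      (S' * (s * c) + (S z - c ^ 2 - S z ^ 2 * s ^ 2) * θ') := by ring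
  rw [e1, add_div (θ' * (c ^ 2 + S z ^ 2 * s ^ 2)), mul_div_cancel_right₀ _ hD.ne']
  congr 1
  field_simp
  have hc2 : c ^ 2 = 1 - s ^ 2 := by linarith
  have hc3 : c ^ 3 = c * (1 - s ^ 2) := by rw [← hc2]; ring
  have hc4 : c ^ 4 = (1 - s ^ 2) ^ 2 := by rw [← hc2]; ring
  push_cast
  ring_nf
  simp only [hc2, hc3, hc4]
  ring

/-- Transfers the order of two angles at `Z` to their rescalings. -/
lemma scaledAngle_mono {S : ℝ} (hS : 0 < S) : Monotone (scaledAngle S) := by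
  refine monotone_of_hasDerivAt_nonneg (fun x => hasDerivAt_scaledAngle (S := fun _ => S)
    (hasDerivAt_id x) (hasDerivAt_const x S) hS) (fun x => ?_)
  have hD := cos_sq_add_mul_sin_sq_pos (pow_pos hS 2) x
  simp only [mul_one, zero_mul, add_zero]
  exact (div_pos hS hD).le

lemma abs_arctan_le (x : ℝ) : |Real.arctan x| ≤ |x| := by
  have h : ∀ y, 0 ≤ y → Real.arctan y ≤ y := by
    intro y hy
    have hA : AntitoneOn (fun y => Real.arctan y - y) univ :=
      antitoneOn_of_hasDerivAt convex_univ
        (fun x _ => (Real.hasDerivAt_arctan x).sub (hasDerivAt_id x)) (fun x _ => by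
          have : 1 / (1 + x ^ 2) ≤ 1 := by
            rw [div_le_one (by positivity)]; nlinarith [sq_nonneg x]
          linarith)
    have := hA (mem_univ 0) (mem_univ y) hy
    simp at this; linarith
  rcases le_total 0 x with hx | hx
  · rw [abs_of_nonneg hx, abs_of_nonneg (by simpa using hx)]; exact h x hx
  · have := h (-x) (by linarith)
    rw [Real.arctan_neg] at this
    rw [abs_of_nonpos hx, abs_of_nonpos (by simpa using hx)]; exact this

/-- The rescaling fades out as `S → 1`, so it does not change asymptotic phases. -/
lemma abs_scaledAngle_sub_le {S : ℝ} (hS : 0 < S) (hS1 : S ≤ 1) (x : ℝ) :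
    |scaledAngle S x - x| ≤ (1 - S) / S := by
  have hQ : S ≤ Real.cos x ^ 2 + S * Real.sin x ^ 2 := by
    have := Real.sin_sq_add_cos_sq x
    nlinarith [sq_nonneg (Real.cos x)]
  rw [scaledAngle, add_sub_cancel_left]
  refine (abs_arctan_le _).trans ?_
  rw [abs_div, abs_mul, abs_of_pos (hS.trans_le hQ), abs_of_nonpos (by linarith)]
  have h1 : |Real.sin x * Real.cos x| ≤ 1 := by
    rw [abs_mul]
    exact mul_le_one₀ (Real.abs_sin_le_one _) (abs_nonneg _) (Real.abs_cos_le_one _)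
  have h2 : -(S - 1) * |Real.sin x * Real.cos x| ≤ 1 - S := by nlinarith
  exact div_le_div₀ (by linarith) h2 hS hQ

/-- In the adiabatic region `z ≥ Z`, `Z² ≥ 4 m`, the order of two Prüfer angles is preserved up
to an explicit error. -/
lemma phase_sub_le_of_adiabatic {θ₁ θ₂ g₁ g₂ : ℝ → ℝ} {m Z a b ε Θ₁ Θ₂ : ℝ} (hZ : 0 < Z)
    (hm : 0 ≤ m) (hmZ : 4 * m ≤ Z ^ 2) (hε : 0 < ε)
    (h₁ : ∀ z, Z ≤ z → HasDerivAt θ₁ (1 - (m / z ^ 2 + g₁ z) * Real.sin (θ₁ z) ^ 2) z)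
    (h₂ : ∀ z, Z ≤ z → HasDerivAt θ₂ (1 - (m / z ^ 2 + g₂ z) * Real.sin (θ₂ z) ^ 2) z)
    (hg : ∀ z, Z ≤ z → |g₁ z| + |g₂ z| ≤ a * z ^ (-1 - ε) + b * (z ^ 2)⁻¹)
    (hΘ₁ : Tendsto (fun z => θ₁ z - z) atTop (𝓝 Θ₁))
    (hΘ₂ : Tendsto (fun z => θ₂ z - z) atTop (𝓝 Θ₂)) (hle : θ₁ Z ≤ θ₂ Z) :
    Θ₁ - Θ₂ ≤ 2 * a / ε * Z ^ (-ε) + 2 * b / Z + m / Z ^ 2 := by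
  set S : ℝ → ℝ := fun z => √(1 - m / z ^ 2)
  have hz0 : ∀ z, Z ≤ z → 0 < z := fun z hz => hZ.trans_le hz
  have hS34 : ∀ z, Z ≤ z → 3 / 4 ≤ 1 - m / z ^ 2 := fun z hz => by
    have h1 : Z ^ 2 ≤ z ^ 2 := pow_le_pow_left₀ hZ.le hz 2
    have : m / z ^ 2 ≤ 1 / 4 := by
      rw [div_le_iff₀ (pow_pos (hz0 z hz) 2)]; linarith
    linarith
  have hS2 : ∀ z, Z ≤ z → S z ^ 2 = 1 - m / z ^ 2 := fun z hz =>
    Real.sq_sqrt (by linarith [hS34 z hz])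
  -- `(4/5)² < 3/4`, while `(4/5)³ > 1/2` is what the bound on the `S'` term needs.
  have hSpos : ∀ z, Z ≤ z → 4 / 5 ≤ S z := fun z hz =>
    Real.le_sqrt_of_sq_le (by linarith [hS34 z hz])
  have hS1 : ∀ z, Z ≤ z → S z ≤ 1 := fun z hz => by
    refine Real.sqrt_le_one.2 ?_
    have : 0 ≤ m / z ^ 2 := by positivity
    linarith
  have hSd : ∀ z, Z ≤ z → HasDerivAt S (m / (z ^ 3 * S z)) z := fun z hz => by
    have hz' := (hz0 z hz).ne'
    have h1 : HasDerivAt (fun z : ℝ => 1 - m / z ^ 2) (2 * m / z ^ 3) z := by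
      have := (((hasDerivAt_pow 2 z).inv (pow_ne_zero 2 hz')).const_mul m).const_sub 1
      refine this.congr_deriv ?_
      field_simp
      push_cast; ring
    refine (h1.sqrt (by linarith [hS34 z hz])).congr_deriv ?_
    have : S z ≠ 0 := by linarith [hSpos z hz]
    change 2 * m / z ^ 3 / (2 * S z) = _
    field_simp
  -- The speed of the rescaled angle differs from `S` only through `g` and `S' = m/(z³ S)`. Since
  -- `S` is common to both angles, it drops out of their difference.
  have key : ∀ (θ g : ℝ → ℝ), (∀ z, Z ≤ z →
      HasDerivAt θ (1 - (m / z ^ 2 + g z) * Real.sin (θ z) ^ 2) z) → ∀ z, Z ≤ z →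
      ∃ D, HasDerivAt (fun z => scaledAngle (S z) (θ z)) D z ∧ |D - S z| ≤ 2 * |g z| + m / z ^ 3 := by
    intro θ g h z hz
    have hSz := hSpos z hz
    have hS0 : 0 < S z := by linarith
    refine ⟨_, hasDerivAt_scaledAngle (h z hz) (hSd z hz) hS0, ?_⟩
    have hsc := Real.sin_sq_add_cos_sq (θ z)
    set s := Real.sin (θ z)
    set c := Real.cos (θ z)
    have hD : S z ^ 2 ≤ c ^ 2 + S z ^ 2 * s ^ 2 := by
      have : S z ^ 2 ≤ 1 := pow_le_one₀ hS0.le (hS1 z hz)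
      nlinarith [sq_nonneg c]
    have hS2pos : 0 < S z ^ 2 := by positivity
    have hD0 := hS2pos.trans_le hD
    have hz3 := pow_pos (hz0 z hz) 3
    have e : (S z * (1 - (m / z ^ 2 + g z) * s ^ 2) + m / (z ^ 3 * S z) * (s * c)) /
        (c ^ 2 + S z ^ 2 * s ^ 2) - S z =
        (-(S z * g z * s ^ 2) + m / (z ^ 3 * S z) * (s * c)) / (c ^ 2 + S z ^ 2 * s ^ 2) := by
      rw [eq_div_iff hD0.ne', sub_mul, div_mul_cancel₀ _ hD0.ne']
      have := hS2 z hz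
      linear_combination (-S z * s ^ 2) * this - S z * hsc
    have b1 : |S z * g z * s ^ 2| ≤ S z * |g z| := by
      rw [abs_mul, abs_mul, abs_of_pos hS0, abs_of_nonneg (sq_nonneg s)]
      exact mul_le_of_le_one_right (by positivity) (by nlinarith [sq_nonneg c])
    have b2 : |m / (z ^ 3 * S z) * (s * c)| ≤ m / (z ^ 3 * S z) * (1 / 2) := by
      rw [abs_mul, abs_of_nonneg (a := m / (z ^ 3 * S z)) (by positivity)]
      refine mul_le_mul_of_nonneg_left ?_ (by positivity)
      rw [abs_le]; constructor <;> nlinarith [sq_nonneg (s + c), sq_nonneg (s - c)]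
    rw [e, abs_div, abs_of_pos hD0, div_le_iff₀ hD0]
    have b3 : S z * |g z| ≤ 2 * |g z| * S z ^ 2 := by
      have : 0 ≤ |g z| * S z * (2 * S z - 1) :=
        mul_nonneg (by positivity) (by linarith)
      linarith
    have b4 : m / (z ^ 3 * S z) * (1 / 2) ≤ m / z ^ 3 * S z ^ 2 := by
      rw [show m / (z ^ 3 * S z) * (1 / 2) = m / z ^ 3 * (1 / (2 * S z)) by field_simp]
      refine mul_le_mul_of_nonneg_left ?_ (by positivity)
      rw [div_le_iff₀ (by positivity)]
      have : (4 / 5 : ℝ) ^ 3 ≤ S z ^ 3 := pow_le_pow_left₀ (by norm_num) hSz 3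
      nlinarith
    calc _ ≤ |-(S z * g z * s ^ 2)| + |m / (z ^ 3 * S z) * (s * c)| := abs_add_le _ _
      _ ≤ 2 * |g z| * S z ^ 2 + m / z ^ 3 * S z ^ 2 := by rw [abs_neg]; linarith
      _ = (2 * |g z| + m / z ^ 3) * S z ^ 2 := by ring
      _ ≤ _ := mul_le_mul_of_nonneg_left hD (by positivity)
  set ψ : ℝ → ℝ := fun z => scaledAngle (S z) (θ₁ z) - scaledAngle (S z) (θ₂ z)
  -- `-p'` is the total bound on the derivative of `ψ` and `p → 0`, so `ψ + p` decreases and `lim ψ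
  -- ≤ ψ Z + p Z ≤ p Z`.
  set p : ℝ → ℝ := fun z => 2 * a / ε * z ^ (-ε) + 2 * b / z + m / z ^ 2
  have hp : ∀ z, Z ≤ z → HasDerivAt p
      (-(2 * (a * z ^ (-1 - ε) + b * (z ^ 2)⁻¹) + 2 * m / z ^ 3)) z := fun z hz => by
    have hz' := (hz0 z hz).ne'
    have h1 := (Real.hasDerivAt_rpow_const (x := z) (p := -ε) (Or.inl hz')).const_mul (2 * a / ε)
    have h2 := (hasDerivAt_inv hz').const_mul (2 * b)
    have h3 := ((hasDerivAt_pow 2 z).inv (pow_ne_zero 2 hz')).const_mul m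
    refine ((h1.add h2).add h3).congr_deriv ?_
    rw [show -ε - 1 = -1 - ε by ring]
    field_simp
    push_cast; ring
  have hψd : ∀ z, Z ≤ z → ∃ D, HasDerivAt ψ D z ∧
      D ≤ 2 * (a * z ^ (-1 - ε) + b * (z ^ 2)⁻¹) + 2 * m / z ^ 3 := fun z hz => by
    obtain ⟨D₁, k1, k2⟩ := key θ₁ g₁ h₁ z hz
    obtain ⟨D₂, k3, k4⟩ := key θ₂ g₂ h₂ z hz
    refine ⟨D₁ - D₂, k1.sub k3, ?_⟩
    have := hg z hz
    have e1 := (abs_le.1 k2).2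
    have e2 := (abs_le.1 k4).1
    have e3 : 2 * m / z ^ 3 = m / z ^ 3 + m / z ^ 3 := by ring
    linarith
  choose! D hD using hψd
  have hA : AntitoneOn (fun z => ψ z + p z) (Ici Z) :=
    antitoneOn_of_hasDerivAt (convex_Ici Z) (fun x hx => (hD x hx).1.add (hp x hx))
      (fun x hx => by have := (hD x hx).2; linarith)
  have hψZ : ψ Z ≤ 0 := by
    have := scaledAngle_mono (S := S Z) (by linarith [hSpos Z le_rfl]) hle
    simp only [ψ]; linarith
  have hSlim : Tendsto S atTop (𝓝 1) := by
    have h1 : Tendsto (fun z : ℝ => m / z ^ 2) atTop (𝓝 0) :=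
      tendsto_const_nhds.div_atTop (tendsto_pow_atTop two_ne_zero)
    have := (Real.continuous_sqrt.tendsto _).comp (h1.const_sub 1)
    rw [sub_zero, Real.sqrt_one] at this
    exact this
  have hsc : ∀ (θ : ℝ → ℝ), Tendsto (fun z => scaledAngle (S z) (θ z) - θ z) atTop (𝓝 0) := by
    intro θ
    have h1 : Tendsto (fun z => (1 - S z) / S z) atTop (𝓝 ((1 - 1) / 1)) :=
      (hSlim.const_sub 1).div hSlim one_ne_zero
    rw [sub_self, zero_div] at h1
    refine squeeze_zero_norm' ?_ h1
    filter_upwards [eventually_ge_atTop Z] with z hz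
    exact abs_scaledAngle_sub_le (by linarith [hSpos z hz]) (hS1 z hz) _
  have hψlim : Tendsto ψ atTop (𝓝 (Θ₁ - Θ₂)) := by
    have := ((hsc θ₁).sub (hsc θ₂)).add (hΘ₁.sub hΘ₂)
    rw [sub_zero, zero_add] at this
    exact this.congr fun z => by simp only [ψ]; ring
  have hplim : Tendsto p atTop (𝓝 0) := by
    have h1 := (tendsto_rpow_neg_atTop hε).const_mul (2 * a / ε)
    have h2 : Tendsto (fun z : ℝ => 2 * b / z) atTop (𝓝 0) :=
      tendsto_const_nhds.div_atTop tendsto_id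
    have h3 : Tendsto (fun z : ℝ => m / z ^ 2) atTop (𝓝 0) :=
      tendsto_const_nhds.div_atTop (tendsto_pow_atTop two_ne_zero)
    simpa using (h1.add h2).add h3
  have hlim := hψlim.add hplim
  rw [add_zero] at hlim
  refine le_of_tendsto hlim ?_
  filter_upwards [eventually_ge_atTop Z] with z hz
  have := hA (mem_Ici.2 le_rfl) hz hz
  simp only [p] at this ⊢
  linarith

/-- The asymptotic phase of the regular solution of `w'' = (s (s - 1) / z² + g - 1) w` is
`(1 - s) π / 2 + o(1)` as `s → ∞`. -/
theorem phase_asymptotics {g : ℝ → ℝ} (hg : ContinuousOn g (Ioi 0)) {C ε : ℝ} (hε : 0 < ε)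
    (hg0 : ∀ z, 0 < z → z ≤ 1 → |g z| ≤ C / z ^ 2)
    (hg1 : ∀ z, 1 ≤ z → |g z| ≤ C * z ^ (-1 - ε)) {η : ℝ} (hη : 0 < η) :
    ∃ N : ℝ, ∀ s, N ≤ s → ∀ (θ : ℝ → ℝ) (Θ : ℝ),
      IsPruferAngle (fun z => s * (s - 1) / z ^ 2 + g z) s θ →
      Tendsto (fun z => θ z - z) atTop (𝓝 Θ) → |Θ - (1 - s) * (Real.pi / 2)| ≤ η := by
  -- With `ε ≤ 1` the power `z^(1-ε)` is monotone, so `z² |g|` is controlled on `]0, Z]` by its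
  -- bound at `Z`.
  wlog hε1 : ε ≤ 1 generalizing ε
  · refine this one_pos (fun z hz => (hg1 z hz).trans ?_) le_rfl
    have hC : 0 ≤ C := by
      have h := (abs_nonneg _).trans (hg1 1 le_rfl)
      simpa using h
    exact mul_le_mul_of_nonneg_left
      (Real.rpow_le_rpow_of_exponent_le hz (by linarith [not_le.1 hε1])) hC
  have hC : 0 ≤ C := by
    have h := (abs_nonneg _).trans (hg1 1 le_rfl)
    simpa using h
  have hpi := Real.pi_pos
  have hpi4 := Real.pi_le_four
  -- Moving `s` by `δ` changes `s(s-1)` by at least `δ s`, which absorbs `g` on `]0, Z]`, and by at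
  -- most `3 δ s`, which is harmless beyond `Z`. The cost in the phase is `δ π/2`.
  obtain ⟨δ, hδ0, hδ1, hδη⟩ : ∃ δ : ℝ, 0 < δ ∧ δ ≤ 1 ∧ 16 * δ ≤ η :=
    ⟨min 1 (η / 16), by positivity, min_le_left _ _, by linarith [min_le_right 1 (η / 16)]⟩
  -- `K ≥ 2` puts `Z = K s` in the adiabatic region, and `1/K²` bounds the error `s(s-1)/Z²`.
  obtain ⟨K, hK2, hKη⟩ : ∃ K : ℝ, 2 ≤ K ∧ 1 / K ^ 2 ≤ η / 8 := by
    have h1 : Tendsto (fun K : ℝ => 1 / K ^ 2) atTop (𝓝 0) :=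
      tendsto_const_nhds.div_atTop (tendsto_pow_atTop two_ne_zero)
    exact ((eventually_ge_atTop 2).and
      (h1.eventually (ge_mem_nhds (show 0 < η / 8 by positivity)))).exists
  have hKpos : 0 < K := by linarith
  -- This is where `s` must be large: the sublinear bound `C Z^(1-ε)` of `z² |g|` falls below `δ s`.
  have hlim1 : ∀ᶠ s : ℝ in atTop, C * (K * s) ^ (1 - ε) ≤ δ * s := by
    have h1 : Tendsto (fun s : ℝ => C * K ^ (1 - ε) * s ^ (-ε)) atTop (𝓝 0) := by
      simpa using (tendsto_rpow_neg_atTop hε).const_mul (C * K ^ (1 - ε))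
    filter_upwards [h1.eventually (ge_mem_nhds hδ0), eventually_gt_atTop 0] with s hs hs0
    rw [Real.mul_rpow hKpos.le hs0.le, sub_eq_add_neg, Real.rpow_add hs0, Real.rpow_one,
      ← sub_eq_add_neg]
    nlinarith
  have hlim2 : ∀ᶠ s : ℝ in atTop, 2 * C / ε * (K * s) ^ (-ε) ≤ η / 8 := by
    have h1 : Tendsto (fun s : ℝ => K * s) atTop atTop := tendsto_id.const_mul_atTop hKpos
    have h2 := ((tendsto_rpow_neg_atTop hε).comp h1).const_mul (2 * C / ε)
    rw [mul_zero] at h2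
    exact h2.eventually (ge_mem_nhds (by positivity))
  obtain ⟨N, hN⟩ := eventually_atTop.1 (hlim1.and (hlim2.and (eventually_ge_atTop 3)))
  refine ⟨N, fun s hs θ Θ hθ hΘ => ?_⟩
  obtain ⟨hs1, hs2, hs3⟩ := hN s hs
  set Z := K * s
  have hZ : 0 < Z := by positivity
  have hZ1 : 1 ≤ Z := by simp only [Z]; nlinarith
  have hm : 0 ≤ s * (s - 1) := mul_nonneg (by linarith) (by linarith)
  have hmZ : 4 * (s * (s - 1)) ≤ Z ^ 2 := by
    have : (2 * s) ^ 2 ≤ Z ^ 2 := pow_le_pow_left₀ (by linarith) (by simp only [Z]; nlinarith) 2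
    nlinarith
  have hgZ : ∀ z, 0 < z → z ≤ Z → |g z| ≤ δ * s / z ^ 2 := by
    intro z hz hzZ
    have hz2 : 0 < z ^ 2 := by positivity
    have h1 : |g z| ≤ C * Z ^ (1 - ε) / z ^ 2 := by
      rcases le_total z 1 with h | h
      · refine (hg0 z hz h).trans (div_le_div_of_nonneg_right ?_ hz2.le)
        exact le_mul_of_one_le_right hC (Real.one_le_rpow hZ1 (by linarith))
      · refine (hg1 z h).trans ?_
        rw [le_div_iff₀ hz2, mul_assoc, ← Real.rpow_natCast, ← Real.rpow_add hz]
        refine mul_le_mul_of_nonneg_left ?_ hC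
        rw [show -1 - ε + ((2 : ℕ) : ℝ) = 1 - ε by push_cast; ring]
        exact Real.rpow_le_rpow hz.le hzZ (by linarith)
    exact h1.trans (div_le_div_of_nonneg_right hs1 hz2.le)
  have hcomp : ∀ t : ℝ, ContinuousOn (fun z : ℝ => t * (t - 1) / z ^ 2) (Ioi 0) := fun t =>
    continuousOn_const.div (continuousOn_id.pow 2) (fun z hz => (pow_pos (show 0 < z from hz) 2).ne')
  have herr : 2 * C / ε * Z ^ (-ε) + 2 * (3 * δ * s) / Z + s * (s - 1) / Z ^ 2 ≤ η * (5 / 8) := by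
    have h1 : 2 * (3 * δ * s) / Z ≤ η * (3 / 8) := by
      rw [div_le_iff₀ hZ]
      simp only [Z]
      nlinarith [mul_nonneg hη.le (show 0 ≤ (K - 2) * s by nlinarith)]
    have h2 : s * (s - 1) / Z ^ 2 ≤ 1 / K ^ 2 := by
      rw [div_le_div_iff₀ (by positivity) (by positivity)]
      simp only [Z]
      nlinarith [sq_nonneg K, mul_nonneg (sq_nonneg K) (by linarith : 0 ≤ s)]
    linarith
  have hbnd : ∀ (q : ℝ), |q| ≤ 3 * δ * s → ∀ z, Z ≤ z →
      |g z| + |q / z ^ 2| ≤ C * z ^ (-1 - ε) + 3 * δ * s * (z ^ 2)⁻¹ := by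
    intro q hq z hz
    have h1 := hg1 z (hZ1.trans hz)
    have hz0 := hZ.trans_le hz
    have h2 : |q / z ^ 2| ≤ 3 * δ * s * (z ^ 2)⁻¹ := by
      rw [abs_div, abs_of_pos (pow_pos hz0 2), div_eq_mul_inv]
      exact mul_le_mul_of_nonneg_right hq (by positivity)
    linarith
  have hP : ContinuousOn (fun z => s * (s - 1) / z ^ 2 + g z) (Ioi 0) := (hcomp s).add hg
  obtain ⟨θp, hp1, hp2⟩ := exists_bessel_phase (s := s + δ) (by linarith)
  obtain ⟨θm, hm1, hm2⟩ := exists_bessel_phase (s := s - δ) (by linarith)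
  -- Larger `s` means a smaller angle, so `s + δ` bounds `θ` from below and `s - δ` from above.
  have hlow : θp Z ≤ θ Z := hθ.sturm hp1 hP (by linarith) (by linarith) (b := Z)
    (fun z hz hzZ => by
      have h1 := (abs_le.1 (hgZ z hz hzZ)).2
      have h2 : s * (s - 1) / z ^ 2 + δ * s / z ^ 2 ≤ (s + δ) * (s + δ - 1) / z ^ 2 := by
        rw [← add_div]
        exact div_le_div_of_nonneg_right (by nlinarith) (by positivity)
      linarith) hZ le_rfl
  have hupp : θ Z ≤ θm Z := hm1.sturm hθ (hcomp _) (by linarith) (by linarith) (b := Z)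
    (fun z hz hzZ => by
      have h1 := (abs_le.1 (hgZ z hz hzZ)).1
      have h2 : (s - δ) * (s - δ - 1) / z ^ 2 ≤ s * (s - 1) / z ^ 2 - δ * s / z ^ 2 := by
        rw [← sub_div]
        exact div_le_div_of_nonneg_right (by nlinarith) (by positivity)
      linarith) hZ le_rfl
  have r1 := phase_sub_le_of_adiabatic (θ₁ := θ) (θ₂ := θm) (g₁ := g)
    (g₂ := fun z => ((s - δ) * (s - δ - 1) - s * (s - 1)) / z ^ 2) hZ hm hmZ hε
    (fun z hz => hθ.hasDerivAt z (hZ.trans_le hz))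
    (fun z hz => (hm1.hasDerivAt z (hZ.trans_le hz)).congr_deriv (by ring))
    (hbnd _ (by rw [abs_le]; constructor <;> nlinarith)) hΘ hm2 hupp
  have r2 := phase_sub_le_of_adiabatic (θ₁ := θp) (θ₂ := θ) (g₂ := g)
    (g₁ := fun z => ((s + δ) * (s + δ - 1) - s * (s - 1)) / z ^ 2) hZ hm hmZ hε
    (fun z hz => (hp1.hasDerivAt z (hZ.trans_le hz)).congr_deriv (by ring))
    (fun z hz => hθ.hasDerivAt z (hZ.trans_le hz))
    (fun z hz => by
      rw [add_comm]
      exact hbnd _ (by rw [abs_le]; constructor <;> nlinarith) z hz) hp2 hΘ hlow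
  have hδpi : δ * (Real.pi / 2) ≤ η * (1 / 8) := by nlinarith
  have e1 : (1 - (s - δ)) * (Real.pi / 2) = (1 - s) * (Real.pi / 2) + δ * (Real.pi / 2) := by ring
  have e2 : (1 - (s + δ)) * (Real.pi / 2) = (1 - s) * (Real.pi / 2) - δ * (Real.pi / 2) := by ring
  rw [e1] at r1
  rw [e2] at r2
  rw [abs_le]
  constructor <;> linarith


/-! ### Existence of the regular solution by Volterra iteration. -/

/-- `β > 0` makes the integrand integrable at the origin, so the integrals from `0` are genuine and
not default values. -/
lemma integral_of_le_rpow {F : ℝ → ℝ} (hF : ContinuousOn F (Ioi 0)) {B β r : ℝ} (hβ : 0 < β)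
    (hr : 0 < r) (hb : ∀ t, 0 < t → t ≤ r → |F t| ≤ B * t ^ (β - 1)) :
    |∫ t in (0 : ℝ)..r, F t| ≤ B * r ^ β / β ∧
      HasDerivAt (fun r => ∫ t in (0 : ℝ)..r, F t) (F r) r := by
  have hpow : IntervalIntegrable (fun t : ℝ => B * t ^ (β - 1)) volume 0 r :=
    (intervalIntegral.intervalIntegrable_rpow' (by linarith)).const_mul B
  have hint : IntervalIntegrable F volume 0 r := by
    refine hpow.mono_fun' ?_ ?_
    · rw [uIoc_of_le hr.le]
      exact (hF.mono Ioc_subset_Ioi_self).aestronglyMeasurable measurableSet_Ioc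
    · rw [uIoc_of_le hr.le]
      filter_upwards [ae_restrict_mem measurableSet_Ioc] with t ht
      exact hb t ht.1 ht.2
  refine ⟨?_, intervalIntegral.integral_hasDerivAt_right hint
    (hF.stronglyMeasurableAtFilter isOpen_Ioi r hr) (hF.continuousAt (Ioi_mem_nhds hr))⟩
  have h1 := intervalIntegral.norm_integral_le_of_norm_le (f := F) hr.le
    (Eventually.of_forall fun t (ht : t ∈ Ioc 0 r) => hb t ht.1 ht.2) hpow
  rw [Real.norm_eq_abs] at h1
  refine h1.trans (le_of_eq ?_)
  rw [intervalIntegral.integral_const_mul, integral_rpow (Or.inl (by linarith)), sub_add_cancel,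
    Real.zero_rpow hβ.ne', sub_zero, mul_div_assoc]

/-- The Volterra iterates of the regular solution of `(r ^ a φ')' = r ^ a q φ`. -/
noncomputable def volterraIter (a : ℝ) (q : ℝ → ℝ) : ℕ → ℝ → ℝ
  | 0 => fun _ => 1
  | n + 1 => fun r => ∫ t in (0 : ℝ)..r, t ^ (-a) *
      ∫ τ in (0 : ℝ)..t, τ ^ a * (q τ * volterraIter a q n τ)

/-- The derivatives of the Volterra iterates. -/
noncomputable def volterraDeriv (a : ℝ) (q : ℝ → ℝ) : ℕ → ℝ → ℝ
  | 0 => fun _ => 0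
  | n + 1 => fun t => t ^ (-a) * ∫ τ in (0 : ℝ)..t, τ ^ a * (q τ * volterraIter a q n τ)

/-- The second derivatives of the Volterra iterates. -/
noncomputable def volterraDeriv₂ (a : ℝ) (q : ℝ → ℝ) : ℕ → ℝ → ℝ
  | 0 => fun _ => 0
  | n + 1 => fun t => q t * volterraIter a q n t - a / t * volterraDeriv a q (n + 1) t

section Volterra

variable {a κ : ℝ} {q : ℝ → ℝ}

/-- One application of the Volterra kernel gains a factor `r^κ`. The inner integral has denominator
`β + κ + a - 1`, and `a ≥ 1` allows it to be replaced by `β + κ`. -/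
lemma volterra_step (ha : 1 ≤ a) (hκ : 0 < κ) (hq : ContinuousOn q (Ioi 0)) {f : ℝ → ℝ}
    (hf : ContinuousOn f (Ioi 0)) {M B β R : ℝ} (hβ : 0 ≤ β)
    (hM : 0 ≤ M) (hB : 0 ≤ B)
    (hqb : ∀ r, 0 < r → r ≤ R → |q r| ≤ M * r ^ (κ - 2))
    (hfb : ∀ r, 0 < r → r ≤ R → |f r| ≤ B * r ^ β) {r : ℝ} (hr : 0 < r) (hrR : r ≤ R) :
    |r ^ (-a) * ∫ τ in (0 : ℝ)..r, τ ^ a * (q τ * f τ)| ≤ M * B / (β + κ) * r ^ (β + κ - 1) ∧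
    HasDerivAt (fun r => ∫ τ in (0 : ℝ)..r, τ ^ a * (q τ * f τ)) (r ^ a * (q r * f r)) r := by
  have hF : ContinuousOn (fun τ => τ ^ a * (q τ * f τ)) (Ioi 0) :=
    (continuousOn_id.rpow_const (fun x hx => Or.inl (ne_of_gt hx))).mul (hq.mul hf)
  have hβ' : 0 < β + κ + (a - 1) := by linarith
  obtain ⟨h1, h2⟩ := integral_of_le_rpow hF (B := M * B) (β := β + κ + (a - 1)) hβ' hr
    (fun t ht htr => by
      have k1 := hqb t ht (htr.trans hrR)
      have k2 := hfb t ht (htr.trans hrR)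
      have hta := Real.rpow_pos_of_pos ht a
      rw [abs_mul, abs_mul, abs_of_pos hta]
      calc t ^ a * (|q t| * |f t|) ≤ t ^ a * ((M * t ^ (κ - 2)) * (B * t ^ β)) := by gcongr
        _ = M * B * (t ^ a * t ^ (κ - 2) * t ^ β) := by ring
        _ = _ := by
          rw [← Real.rpow_add ht, ← Real.rpow_add ht]
          congr 2; ring)
  refine ⟨?_, h2⟩
  rw [abs_mul, abs_of_pos (Real.rpow_pos_of_pos hr _)]
  calc _ ≤ r ^ (-a) * (M * B * r ^ (β + κ + (a - 1)) / (β + κ + (a - 1))) := by gcongr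
    _ = M * B * (r ^ (-a) * r ^ (β + κ + (a - 1))) / (β + κ + (a - 1)) := by ring
    _ = M * B * r ^ (β + κ - 1) / (β + κ + (a - 1)) := by
      rw [← Real.rpow_add hr]; congr 3; ring
    _ ≤ M * B * r ^ (β + κ - 1) / (β + κ) := by
      refine div_le_div_of_nonneg_left ?_ (by linarith) (by linarith)
      exact mul_nonneg (mul_nonneg hM hB) (Real.rpow_nonneg hr.le _)
    _ = _ := by ring

/-- The potential `q` is `O(r ^ (κ - 2))` at the origin, and continuous. -/
structure IsSubcritical (κ : ℝ) (q : ℝ → ℝ) : Prop where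
  pos : 0 < κ
  continuousOn : ContinuousOn q (Ioi 0)
  bound : ∀ R : ℝ, 0 < R → ∃ M : ℝ, 0 ≤ M ∧ ∀ r, 0 < r → r ≤ R → |q r| ≤ M * r ^ (κ - 2)

/-- With `β = nκ`, each of the two integrations contributes a denominator `(n+1)κ`, hence
`κ^(-2n)/(n!)²`. The derivative undergoes only one of them, hence its extra factor `nκ`. -/
lemma volterra_bound (hq : IsSubcritical κ q) (ha : 1 ≤ a) (n : ℕ) :
    ContinuousOn (volterraIter a q n) (Ioi 0) ∧
    ∀ R, 0 < R → ∀ M, 0 ≤ M → (∀ r, 0 < r → r ≤ R → |q r| ≤ M * r ^ (κ - 2)) →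
      ∀ r, 0 < r → r ≤ R →
        |volterraIter a q n r| ≤ (M / κ ^ 2) ^ n / (n.factorial : ℝ) ^ 2 * r ^ (n * κ) ∧
        |r * volterraDeriv a q n r| ≤
          n * κ * ((M / κ ^ 2) ^ n / (n.factorial : ℝ) ^ 2) * r ^ (n * κ) ∧
        HasDerivAt (volterraIter a q n) (volterraDeriv a q n r) r ∧
        HasDerivAt (volterraDeriv a q n) (volterraDeriv₂ a q n r) r := by
  have hκ := hq.pos
  induction n with
  | zero =>
    refine ⟨continuousOn_const, fun R hR M hM hb r hr hrR => ⟨?_, ?_, ?_, ?_⟩⟩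
    · simp [volterraIter]
    · simp [volterraDeriv]
    · exact hasDerivAt_const r 1
    · exact hasDerivAt_const r 0
  | succ n ih =>
    obtain ⟨hc, ihb⟩ := ih
    have main : ∀ R, 0 < R → ∀ M, 0 ≤ M → (∀ r, 0 < r → r ≤ R → |q r| ≤ M * r ^ (κ - 2)) →
      ∀ r, 0 < r → r ≤ R →
        |volterraIter a q (n + 1) r| ≤
          (M / κ ^ 2) ^ (n + 1) / ((n + 1).factorial : ℝ) ^ 2 * r ^ ((n + 1 : ℕ) * κ) ∧
        |r * volterraDeriv a q (n + 1) r| ≤ (n + 1 : ℕ) * κ *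
          ((M / κ ^ 2) ^ (n + 1) / ((n + 1).factorial : ℝ) ^ 2) * r ^ ((n + 1 : ℕ) * κ) ∧
        HasDerivAt (volterraIter a q (n + 1)) (volterraDeriv a q (n + 1) r) r ∧
        HasDerivAt (volterraDeriv a q (n + 1)) (volterraDeriv₂ a q (n + 1) r) r := by
      intro R hR M hM hb r hr hrR
      set b := (M / κ ^ 2) ^ n / (n.factorial : ℝ) ^ 2
      have hb0 : 0 ≤ b := by positivity
      have hstep := fun r (hr : 0 < r) (hrR : r ≤ R) =>
        volterra_step ha hκ hq.continuousOn hc (β := n * κ) (by positivity) hM hb0 hb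
          (fun r hr hrR => (ihb R hR M hM hb r hr hrR).1) hr hrR
      have hcoef : M * b / (n * κ + κ) = (n + 1 : ℕ) * κ *
          ((M / κ ^ 2) ^ (n + 1) / ((n + 1).factorial : ℝ) ^ 2) := by
        simp only [b]
        rw [Nat.factorial_succ, pow_succ (M / κ ^ 2)]
        generalize (M / κ ^ 2) ^ n = X
        push_cast
        have h1 : (n.factorial : ℝ) ≠ 0 := by positivity
        field_simp
      set c := (M / κ ^ 2) ^ (n + 1) / ((n + 1).factorial : ℝ) ^ 2
      have hexp : (n : ℝ) * κ + κ = (n + 1 : ℕ) * κ := by push_cast; ring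
      -- Derivatives are needed at every `r`, not only up to the given `R`, so the bounds are taken
      -- anew with `R = r`.
      have hkd : ∀ r, 0 < r → HasDerivAt (fun r => ∫ τ in (0 : ℝ)..r,
          τ ^ a * (q τ * volterraIter a q n τ)) (r ^ a * (q r * volterraIter a q n r)) r := by
        intro r hr
        obtain ⟨M', hM', hb'⟩ := hq.bound r hr
        exact (volterra_step ha hκ hq.continuousOn hc (β := n * κ) (R := r) (by positivity) hM'
          (B := (M' / κ ^ 2) ^ n / (n.factorial : ℝ) ^ 2) (by positivity) hb'
          (fun t ht htr => (ihb r hr M' hM' hb' t ht htr).1) hr le_rfl).2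
      have hd : ∀ r, 0 < r → HasDerivAt (volterraDeriv a q (n + 1))
          (volterraDeriv₂ a q (n + 1) r) r := by
        intro r hr
        have h1 := (Real.hasDerivAt_rpow_const (x := r) (p := -a) (Or.inl hr.ne')).mul (hkd r hr)
        refine h1.congr_deriv ?_
        simp only [volterraDeriv₂, volterraDeriv]
        have e1 : r ^ (-a) * r ^ a = 1 := by
          rw [← Real.rpow_add hr]; simp
        rw [Real.rpow_sub_one hr.ne']
        linear_combination (q r * volterraIter a q n r) * e1
      have hdc : ContinuousOn (volterraDeriv a q (n + 1)) (Ioi 0) := fun x hx =>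
        (hd x hx).continuousAt.continuousWithinAt
      obtain ⟨g1, g2⟩ := integral_of_le_rpow hdc (B := M * b / (n * κ + κ)) (β := n * κ + κ)
        (by positivity) hr (fun t ht htr => (hstep t ht (htr.trans hrR)).1)
      refine ⟨?_, ?_, g2, hd r hr⟩
      · change |∫ t in (0 : ℝ)..r, volterraDeriv a q (n + 1) t| ≤ _
        refine g1.trans (le_of_eq ?_)
        rw [hcoef, hexp]
        have : ((n + 1 : ℕ) : ℝ) * κ ≠ 0 := by positivity
        field_simp
      · have h1 := (hstep r hr hrR).1
        rw [abs_mul, abs_of_pos hr]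
        calc r * |volterraDeriv a q (n + 1) r| ≤ r * (M * b / (n * κ + κ) *
              r ^ (n * κ + κ - 1)) := mul_le_mul_of_nonneg_left h1 hr.le
          _ = _ := by
            rw [hcoef, hexp, Real.rpow_sub_one hr.ne']
            field_simp
    refine ⟨fun r hr => ?_, main⟩
    obtain ⟨M, hM, hb⟩ := hq.bound r hr
    exact (main r hr M hM hb r hr le_rfl).2.2.1.continuousAt.continuousWithinAt

/-- One of the two factorials is spent on the factor `n` in the derivative bound. Writing powers of
`r/R` gives a majorant uniform on `]0, R]` that still shows the decay at `0`. -/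
lemma volterra_bound' (hq : IsSubcritical κ q) (ha : 1 ≤ a) {R : ℝ} (hR : 0 < R) :
    ∃ Y : ℝ, 0 ≤ Y ∧ ∀ n r, 0 < r → r ≤ R →
      |volterraIter a q n r| ≤ Y ^ n / n.factorial * (r / R) ^ (n * κ) ∧
      |r * volterraDeriv a q n r| ≤ κ * (Y ^ n / n.factorial) * (r / R) ^ (n * κ) := by
  obtain ⟨M, hM, hb⟩ := hq.bound R hR
  have hκ := hq.pos
  refine ⟨M / κ ^ 2 * R ^ κ, by positivity, fun n r hr hrR => ?_⟩
  obtain ⟨h1, h2, -⟩ := (volterra_bound hq ha n).2 R hR M hM hb r hr hrR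
  have hf : (1 : ℝ) ≤ n.factorial := by exact_mod_cast n.factorial_pos
  have hnf : (n : ℝ) ≤ n.factorial := by exact_mod_cast n.self_le_factorial
  have e : (M / κ ^ 2 * R ^ κ) ^ n / n.factorial * (r / R) ^ (n * κ) =
      (M / κ ^ 2) ^ n * r ^ (n * κ) / n.factorial := by
    rw [Real.div_rpow hr.le hR.le, mul_pow, ← Real.rpow_natCast (R ^ κ), ← Real.rpow_mul hR.le,
      mul_comm κ]
    have := (Real.rpow_pos_of_pos hR (n * κ)).ne'
    field_simp
  have hX : 0 ≤ (M / κ ^ 2) ^ n * r ^ (n * κ) := by positivity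
  constructor
  · rw [e]
    refine h1.trans ?_
    rw [div_mul_eq_mul_div]
    exact div_le_div_of_nonneg_left hX (by positivity) (by nlinarith)
  · rw [mul_assoc, e]
    refine h2.trans ?_
    rw [show n * κ * ((M / κ ^ 2) ^ n / (n.factorial : ℝ) ^ 2) * r ^ (n * κ) =
      κ * ((M / κ ^ 2) ^ n * r ^ (n * κ) * (n / (n.factorial : ℝ) ^ 2)) by ring]
    refine mul_le_mul_of_nonneg_left ?_ hκ.le
    rw [div_eq_mul_inv]
    refine mul_le_mul_of_nonneg_left ?_ hX
    rw [div_le_iff₀ (by positivity)]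
    have : (n.factorial : ℝ)⁻¹ * (n.factorial : ℝ) ^ 2 = n.factorial := by field_simp
    rw [this]; exact hnf

/-- Existence of the regular solution of `u'' = (s (s - 1) / r² + q) u`, `s ≥ 1 / 2`. -/
theorem exists_regular_solution {s : ℝ} (hs : 1 / 2 ≤ s) (hq : IsSubcritical κ q) :
    ∃ u u' : ℝ → ℝ, (∀ r, 0 < r → HasDerivAt u (u' r) r) ∧
      (∀ r, 0 < r → HasDerivAt u' ((s * (s - 1) / r ^ 2 + q r) * u r) r) ∧
      Tendsto (fun r => r ^ (-s) * u r) (𝓝[>] 0) (𝓝 1) ∧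
      Tendsto (fun r => r * u' r / u r) (𝓝[>] 0) (𝓝 s) := by
  have hκ := hq.pos
  have ha : 1 ≤ 2 * s := by linarith
  -- Substituting `u = r^s Φ` removes the centrifugal term and leaves `(r^(2s) Φ')' = r^(2s) q Φ`,
  -- whence the weight `2s ≥ 1`. The solution is the sum of the iterates.
  set φ := volterraIter (2 * s) q
  set ψ := volterraDeriv (2 * s) q
  set χ := volterraDeriv₂ (2 * s) q
  have hder : ∀ n r, 0 < r → HasDerivAt (φ n) (ψ n r) r ∧ HasDerivAt (ψ n) (χ n r) r := by
    intro n r hr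
    obtain ⟨M, hM, hb⟩ := hq.bound r hr
    exact ((volterra_bound hq ha n).2 r hr M hM hb r hr le_rfl).2.2
  have hle1 : ∀ {R r : ℝ} (n : ℕ), 0 < r → r ≤ R → (r / R) ^ (n * κ) ≤ 1 := fun n hr hrR =>
    Real.rpow_le_one (div_nonneg hr.le (hr.le.trans hrR))
      ((div_le_one (hr.trans_le hrR)).2 hrR) (by positivity)
  have hbd : ∀ R, 0 < R → ∃ Y : ℝ, 0 ≤ Y ∧ ∀ n r, 0 < r → r ≤ R →
      |φ n r| ≤ Y ^ n / n.factorial ∧ |r * ψ n r| ≤ κ * (Y ^ n / n.factorial) := by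
    intro R hR
    obtain ⟨Y, hY, h⟩ := volterra_bound' hq ha hR
    refine ⟨Y, hY, fun n r hr hrR => ?_⟩
    obtain ⟨h1, h2⟩ := h n r hr hrR
    exact ⟨h1.trans (mul_le_of_le_one_right (by positivity) (hle1 n hr hrR)),
      h2.trans (mul_le_of_le_one_right (by positivity) (hle1 n hr hrR))⟩
  have hsφ : ∀ r, 0 < r → Summable fun n => φ n r := by
    intro r hr
    obtain ⟨Y, hY, h⟩ := hbd r hr
    exact Summable.of_norm_bounded (Real.summable_pow_div_factorial Y)
      fun n => (h n r hr le_rfl).1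
  have hψ' : ∀ {n : ℕ} {r₁ r B : ℝ}, 0 < r₁ → r₁ ≤ r → |r * ψ n r| ≤ B → |ψ n r| ≤ B / r₁ := by
    intro n r₁ r B h1 h2 h3
    rw [abs_mul, abs_of_pos (h1.trans_le h2)] at h3
    rw [le_div_iff₀ h1]
    nlinarith [abs_nonneg (ψ n r)]
  have hsψ : ∀ r, 0 < r → Summable fun n => ψ n r := by
    intro r hr
    obtain ⟨Y, hY, h⟩ := hbd r hr
    exact Summable.of_norm_bounded (((Real.summable_pow_div_factorial Y).mul_left κ).div_const r)
      fun n => hψ' hr le_rfl (h n r hr le_rfl).2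
  have hdφ : ∀ r, 0 < r → HasDerivAt (fun r => ∑' n, φ n r) (∑' n, ψ n r) r := by
    intro r hr
    obtain ⟨Y, hY, h⟩ := hbd (2 * r) (by positivity)
    have hmem : r ∈ Ioo (r / 2) (2 * r) := ⟨by linarith, by linarith⟩
    have hpos : ∀ y ∈ Ioo (r / 2) (2 * r), 0 < y := fun y hy => by
      have := hy.1; linarith
    exact hasDerivAt_tsum_of_isPreconnected
      (((Real.summable_pow_div_factorial Y).mul_left κ).div_const (r / 2)) isOpen_Ioo
      isPreconnected_Ioo (fun n y hy => (hder n y (hpos y hy)).1)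
      (fun n y hy => hψ' (by positivity) hy.1.le (h n y (hpos y hy) hy.2.le).2) hmem (hsφ r hr) hmem
  have hsφ' : ∀ r, 0 < r → (∑' n, χ n r) = q r * (∑' n, φ n r) - 2 * s / r * ∑' n, ψ n r := by
    intro r hr
    have e1 : Summable fun n => χ n r := by
      rw [← summable_nat_add_iff 1]
      exact ((hsφ r hr).mul_left (q r)).sub
        (((summable_nat_add_iff 1).2 (hsψ r hr)).mul_left (2 * s / r))
    rw [e1.tsum_eq_zero_add, (hsψ r hr).tsum_eq_zero_add, ← tsum_mul_left]
    have e0 : χ 0 r = 0 := rfl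
    have e0' : ψ 0 r = 0 := rfl
    rw [e0, e0', zero_add, zero_add, ← tsum_mul_left, ← Summable.tsum_sub
      ((hsφ r hr).mul_left (q r)) (((summable_nat_add_iff 1).2 (hsψ r hr)).mul_left (2 * s / r))]
    rfl
  have hdψ : ∀ r, 0 < r → HasDerivAt (fun r => ∑' n, ψ n r)
      (q r * (∑' n, φ n r) - 2 * s / r * ∑' n, ψ n r) r := by
    intro r hr
    rw [← hsφ' r hr]
    obtain ⟨Y, hY, h⟩ := hbd (2 * r) (by positivity)
    have hmem : r ∈ Ioo (r / 2) (2 * r) := ⟨by linarith, by linarith⟩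
    have hpos : ∀ y ∈ Icc (r / 2) (2 * r), 0 < y := fun y hy => by
      have := hy.1; linarith
    obtain ⟨Q, hQ⟩ := isCompact_Icc.exists_bound_of_continuousOn
      (hq.continuousOn.mono hpos : ContinuousOn q (Icc (r / 2) (2 * r)))
    set v : ℕ → ℝ := fun n => κ * (Y ^ n / n.factorial) / (r / 2)
    have hv : Summable v := ((Real.summable_pow_div_factorial Y).mul_left κ).div_const (r / 2)
    -- The second derivative of iterate `n + 1` involves iterate `n` and first derivative `n + 1`;
    -- the majorant follows this shift.
    set U : ℕ → ℝ := fun n => match n with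
      | 0 => 0
      | n + 1 => Q * (Y ^ n / n.factorial) + 2 * s / (r / 2) * v (n + 1)
    have hU : Summable U := by
      rw [← summable_nat_add_iff 1]
      exact ((Real.summable_pow_div_factorial Y).mul_left Q).add
        (((summable_nat_add_iff 1).2 hv).mul_left _)
    refine hasDerivAt_tsum_of_isPreconnected hU isOpen_Ioo
      isPreconnected_Ioo (fun n y hy => (hder n y (hpos y ⟨hy.1.le, hy.2.le⟩)).2)
      (fun n y hy => ?_) hmem (hsψ r hr) hmem
    have hy0 := hpos y ⟨hy.1.le, hy.2.le⟩
    cases n with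
    | zero => simp [χ, volterraDeriv₂, U]
    | succ n =>
      have k1 := hQ y ⟨hy.1.le, hy.2.le⟩
      have k2 := (h n y hy0 hy.2.le).1
      have k3 : |ψ (n + 1) y| ≤ v (n + 1) :=
        hψ' (by positivity) hy.1.le (h (n + 1) y hy0 hy.2.le).2
      have k4 : |2 * s / y| ≤ 2 * s / (r / 2) := by
        rw [abs_of_nonneg (by positivity)]
        exact div_le_div_of_nonneg_left (by positivity) (by positivity) hy.1.le
      change |q y * φ n y - 2 * s / y * ψ (n + 1) y| ≤
        Q * (Y ^ n / n.factorial) + 2 * s / (r / 2) * v (n + 1)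
      refine (abs_sub _ _).trans (add_le_add ?_ ?_)
      · rw [abs_mul]
        exact mul_le_mul k1 k2 (abs_nonneg _) ((norm_nonneg _).trans k1)
      · rw [abs_mul]
        exact mul_le_mul k4 k3 (abs_nonneg _) (by positivity)
  set Φ : ℝ → ℝ := fun r => ∑' n, φ n r
  set Ψ : ℝ → ℝ := fun r => ∑' n, ψ n r
  obtain ⟨Y, hY, hYb⟩ := volterra_bound' hq ha one_pos
  have hz : ∀ n : ℕ, n ≠ 0 → Tendsto (fun r : ℝ => (r / 1) ^ (n * κ)) (𝓝[>] 0) (𝓝 0) := by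
    intro n hn
    have hp : 0 < n * κ := by positivity
    have : Tendsto (fun r : ℝ => r ^ (n * κ)) (𝓝 0) (𝓝 (0 ^ (n * κ))) :=
      (Real.continuousAt_rpow_const 0 _ (Or.inr hp.le)).tendsto
    rw [Real.zero_rpow hp.ne'] at this
    simpa using this.mono_left (nhdsWithin_le_nhds (s := Ioi 0))
  have hΦ0 : Tendsto Φ (𝓝[>] 0) (𝓝 1) := by
    have h := tendsto_tsum_of_dominated_convergence (f := fun r n => φ n r) (𝓕 := 𝓝[>] (0 : ℝ))
      (g := fun n => if n = 0 then 1 else 0) (Real.summable_pow_div_factorial Y) (fun n => ?_) ?_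
    · rwa [tsum_ite_eq 0 (fun _ => (1 : ℝ))] at h
    · rcases eq_or_ne n 0 with rfl | hn
      · simp [φ, volterraIter]
      · rw [if_neg hn]
        refine squeeze_zero_norm' ?_ (by simpa using (hz n hn).const_mul (Y ^ n / n.factorial))
        filter_upwards [Ioc_mem_nhdsGT (zero_lt_one' ℝ)] with r hr
        exact by simpa using (hYb n r hr.1 hr.2).1
    · filter_upwards [Ioc_mem_nhdsGT (zero_lt_one' ℝ)] with r hr n
      exact (hYb n r hr.1 hr.2).1.trans
        (mul_le_of_le_one_right (by positivity) (hle1 n hr.1 hr.2))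
  have hΨ0 : Tendsto (fun r => r * Ψ r) (𝓝[>] 0) (𝓝 0) := by
    have h := tendsto_tsum_of_dominated_convergence (f := fun r n => r * ψ n r)
      (𝓕 := 𝓝[>] (0 : ℝ)) (g := fun n => 0)
      ((Real.summable_pow_div_factorial Y).mul_left κ) (fun n => ?_) ?_
    · rw [tsum_zero] at h
      exact h.congr fun r => tsum_mul_left
    · rcases eq_or_ne n 0 with rfl | hn
      · simp [ψ, volterraDeriv]
      · refine squeeze_zero_norm' ?_ (by simpa using (hz n hn).const_mul (κ * (Y ^ n / n.factorial)))
        filter_upwards [Ioc_mem_nhdsGT (zero_lt_one' ℝ)] with r hr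
        exact by simpa using (hYb n r hr.1 hr.2).2
    · filter_upwards [Ioc_mem_nhdsGT (zero_lt_one' ℝ)] with r hr n
      exact (hYb n r hr.1 hr.2).2.trans
        (mul_le_of_le_one_right (by positivity) (hle1 n hr.1 hr.2))
  have hpow : ∀ r : ℝ, 0 < r → HasDerivAt (fun r : ℝ => r ^ s) (s / r * r ^ s) r := fun r hr => by
    refine (Real.hasDerivAt_rpow_const (Or.inl hr.ne')).congr_deriv ?_
    rw [Real.rpow_sub_one hr.ne']; ring
  refine ⟨fun r => r ^ s * Φ r, fun r => r ^ s * (Ψ r + s * r⁻¹ * Φ r), fun r hr => ?_,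
    fun r hr => ?_, ?_, ?_⟩
  · exact ((hpow r hr).mul (hdφ r hr)).congr_deriv (by ring)
  · refine ((hpow r hr).mul ((hdψ r hr).add (((hasDerivAt_inv hr.ne').const_mul s).mul
      (hdφ r hr)))).congr_deriv ?_
    simp only [Pi.add_apply, Pi.mul_apply]
    field_simp
    ring
  · refine hΦ0.congr' ?_
    filter_upwards [self_mem_nhdsWithin] with r hr
    rw [← mul_assoc, ← Real.rpow_add hr]; simp
  · have h1 := (hΨ0.div hΦ0 one_ne_zero).const_add s
    rw [zero_div, add_zero] at h1
    refine h1.congr' ?_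
    filter_upwards [self_mem_nhdsWithin, hΦ0.eventually (lt_mem_nhds one_pos)] with r hr h2
    have := (Real.rpow_pos_of_pos hr s).ne'
    have hr0 : r ≠ 0 := ne_of_gt hr
    have := h2.ne'
    simp only [Pi.div_apply]
    field_simp
    ring

end Volterra

/-! ### Uniqueness of the regular solution. -/

/-- Uniqueness of the regular solution of `u'' = Q u`, `s ≥ 1 / 2`. -/
theorem regular_solution_unique {s : ℝ} (hs : 1 / 2 ≤ s) {Q u u' v v' : ℝ → ℝ}
    (hQ : ContinuousOn Q (Ioi 0))
    (hu : ∀ r, 0 < r → HasDerivAt u (u' r) r) (hu' : ∀ r, 0 < r → HasDerivAt u' (Q r * u r) r)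
    (hv : ∀ r, 0 < r → HasDerivAt v (v' r) r) (hv' : ∀ r, 0 < r → HasDerivAt v' (Q r * v r) r)
    (hun : Tendsto (fun r => r ^ (-s) * u r) (𝓝[>] 0) (𝓝 1))
    (hvn : Tendsto (fun r => r ^ (-s) * v r) (𝓝[>] 0) (𝓝 1)) {r : ℝ} (hr : 0 < r) :
    u r = v r ∧ u' r = v' r := by
  -- From `u ≤ 2 r^s` and `2s ≥ 1`. It makes `1/u²` non-integrable at `0`, including the borderline
  -- `s = 1/2`.
  have hev : ∀ᶠ r in 𝓝[>] (0 : ℝ), 0 < u r ∧ u r ^ 2 ≤ 4 * r := by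
    filter_upwards [hun.eventually (lt_mem_nhds one_pos),
      hun.eventually (gt_mem_nhds (show (1 : ℝ) < 2 by norm_num)),
      Ioc_mem_nhdsGT (zero_lt_one' ℝ)] with r h1 h2 h3
    have hrs := Real.rpow_pos_of_pos h3.1 (-s)
    have hpos : 0 < u r := pos_of_mul_pos_right h1 hrs.le
    refine ⟨hpos, ?_⟩
    have h4 : u r ≤ 2 * r ^ s := by
      rw [Real.rpow_neg h3.1.le, inv_mul_lt_iff₀ (Real.rpow_pos_of_pos h3.1 s)] at h2
      linarith
    have h5 : (r ^ s) ^ 2 ≤ r := by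
      rw [← Real.rpow_natCast, ← Real.rpow_mul h3.1.le]
      nth_rewrite 2 [← Real.rpow_one r]
      refine Real.rpow_le_rpow_of_exponent_ge h3.1 h3.2 ?_
      push_cast; linarith
    nlinarith
  obtain ⟨b, hb, hsub⟩ := mem_nhdsGT_iff_exists_Ioo_subset.1 hev
  replace hb : 0 < b := hb
  have key : ∀ (w w' : ℝ → ℝ), (∀ r, 0 < r → HasDerivAt w (w' r) r) →
      (∀ r, 0 < r → HasDerivAt w' (Q r * w r) r) →
      Tendsto (fun r => r ^ (-s) * w r) (𝓝[>] 0) (𝓝 0) →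
      ∀ x, 0 < x → w x * u' x - w' x * u x ≤ 0 := by
    intro w w' hw hw' hwn x hx
    by_contra! hW
    set c := w x * u' x - w' x * u x
    have hconst : ∀ y, 0 < y → w y * u' y - w' y * u y = c := by
      intro y hy
      have hd : ∀ z ∈ Ioi (0 : ℝ), HasDerivAt (fun y => w y * u' y - w' y * u y) 0 z :=
        fun z hz => (((hw z hz).mul (hu' z hz)).sub ((hw' z hz).mul (hu z hz))).congr_deriv
          (by ring)
      exact eqOn_const_of_hasDerivAt_zero (convex_Ioi 0) hd (show y ∈ Ioi 0 from hy) hx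
    have hh : Tendsto (fun y => w y / u y) (𝓝[>] 0) (𝓝 0) := by
      have := hwn.div hun one_ne_zero
      rw [zero_div] at this
      refine this.congr' ?_
      filter_upwards [self_mem_nhdsWithin] with y hy
      exact mul_div_mul_left _ _ (Real.rpow_pos_of_pos hy (-s)).ne'
    -- If the constant Wronskian `c` were positive, then `(w/u)' = -c/u² ≤ -c/(4y)`. A decreasing
    -- function would thus tend to `-∞` at the left end, since `w/u → 0`.
    have hA : AntitoneOn (fun y => w y / u y + c / 4 * Real.log y) (Ioo 0 b) := by
      refine antitoneOn_of_hasDerivAt (convex_Ioo 0 b) (fun y hy =>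
        ((hw y hy.1).div (hu y hy.1) (hsub hy).1.ne').add
          ((Real.hasDerivAt_log hy.1.ne').const_mul (c / 4))) (fun y hy => ?_)
      obtain ⟨h1, h2⟩ := hsub hy
      have h3 := hconst y hy.1
      rw [show w' y * u y - w y * u' y = -c by rw [← h3]; ring]
      have h4 : c / 4 * y⁻¹ ≤ c / u y ^ 2 := by
        rw [div_mul_eq_mul_div, div_le_div_iff₀ (by norm_num) (by positivity)]
        have : y⁻¹ * u y ^ 2 ≤ 4 := by
          rw [inv_mul_le_iff₀ hy.1]; linarith
        nlinarith
      rw [neg_div]; linarith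
    have hbot : Tendsto (fun y => w y / u y + c / 4 * Real.log y) (𝓝[>] 0) atBot :=
      hh.add_atBot (Real.tendsto_log_nhdsGT_zero.const_mul_atBot (by positivity))
    have hm : b / 2 ∈ Ioo 0 b := ⟨by positivity, by linarith⟩
    obtain ⟨y, hy1, hy2⟩ := ((hbot.eventually_lt_atBot
      (w (b / 2) / u (b / 2) + c / 4 * Real.log (b / 2))).and (Ioc_mem_nhdsGT hm.1)).exists
    have := hA ⟨hy2.1, hy2.2.trans_lt hm.2⟩ hm hy2.2
    simp only at this
    linarith
  have hw0 : Tendsto (fun r => r ^ (-s) * (u r - v r)) (𝓝[>] 0) (𝓝 0) := by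
    have := hun.sub hvn
    rw [sub_self] at this
    exact this.congr fun r => by ring
  have hw0' : Tendsto (fun r => r ^ (-s) * (v r - u r)) (𝓝[>] 0) (𝓝 0) := by
    have := hvn.sub hun
    rw [sub_self] at this
    exact this.congr fun r => by ring
  -- The one-sided bound for `u - v` and for `v - u` gives a vanishing Wronskian.
  have hW : ∀ x, 0 < x → (u x - v x) * u' x - (u' x - v' x) * u x = 0 := by
    intro x hx
    have h1 := key (fun r => u r - v r) (fun r => u' r - v' r)
      (fun r hr => (hu r hr).sub (hv r hr))
      (fun r hr => ((hu' r hr).sub (hv' r hr)).congr_deriv (by ring)) hw0 x hx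
    have h2 := key (fun r => v r - u r) (fun r => v' r - u' r)
      (fun r hr => (hv r hr).sub (hu r hr))
      (fun r hr => ((hv' r hr).sub (hu' r hr)).congr_deriv (by ring)) hw0' x hx
    linarith
  have hzero : ∀ x ∈ Ioo 0 b, u x - v x = 0 := by
    intro x hx
    -- A zero Wronskian makes the quotient constant near `0`, where it tends to `0`; Cauchy
    -- uniqueness extends this to the half-line.
    have hd : ∀ z ∈ Ioo 0 b, HasDerivAt (fun y => (u y - v y) / u y) 0 z := fun z hz => by
      refine (((hu z hz.1).sub (hv z hz.1)).div (hu z hz.1) (hsub hz).1.ne').congr_deriv ?_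
      have := hW z hz.1
      simp only [Pi.sub_apply]
      rw [show (u' z - v' z) * u z - (u z - v z) * u' z = 0 by linarith, zero_div]
    have hh : Tendsto (fun y => (u y - v y) / u y) (𝓝[>] 0) (𝓝 0) := by
      have := hw0.div hun one_ne_zero
      rw [zero_div] at this
      refine this.congr' ?_
      filter_upwards [self_mem_nhdsWithin] with y hy
      exact mul_div_mul_left _ _ (Real.rpow_pos_of_pos hy (-s)).ne'
    have hh' : Tendsto (fun y => (u y - v y) / u y) (𝓝[>] 0) (𝓝 ((u x - v x) / u x)) := by
      refine tendsto_const_nhds.congr' ?_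
      filter_upwards [Ioo_mem_nhdsGT hb] with y hy
      exact eqOn_const_of_hasDerivAt_zero (convex_Ioo 0 b) hd hx hy
    have := tendsto_nhds_unique hh' hh
    rwa [div_eq_zero_iff, or_iff_left (hsub hx).1.ne'] at this
  have hm : b / 2 ∈ Ioo 0 b := ⟨by positivity, by linarith⟩
  have hz' : u' (b / 2) - v' (b / 2) = 0 := by
    have h1 := hW _ hm.1
    rw [hzero _ hm, zero_mul, zero_sub, neg_eq_zero, mul_eq_zero,
      or_iff_left (hsub hm).1.ne'] at h1
    exact h1
  have := eq_zero_of_cauchy_data_zero hQ (f := fun r => u r - v r) (f' := fun r => u' r - v' r)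
    (fun r hr => (hu r hr).sub (hv r hr))
    (fun r hr => ((hu' r hr).sub (hv' r hr)).congr_deriv (by ring)) hm.1 (hzero _ hm) hz' hr
  exact ⟨sub_eq_zero.1 this.1, sub_eq_zero.1 this.2⟩


/-! ### The Liouville transformation. -/

/-- The Liouville variable `z = ∫_0^r √(2 γ t ^ (-μ)) dt`. -/
noncomputable def liouvilleVar (μ γ r : ℝ) : ℝ := √(2 * γ) / (1 - μ / 2) * r ^ (1 - μ / 2)

/-- The inverse of the Liouville variable. -/
noncomputable def liouvilleInv (μ γ z : ℝ) : ℝ :=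
  ((1 - μ / 2) / √(2 * γ) * z) ^ (1 - μ / 2)⁻¹

section Liouville

variable {μ γ : ℝ}

lemma sqrt_two_mul_pos (hγ : 0 < γ) : 0 < √(2 * γ) := Real.sqrt_pos.2 (by positivity)

lemma liouvilleVar_pos (hμ : μ < 2) (hγ : 0 < γ) {r : ℝ} (hr : 0 < r) :
    0 < liouvilleVar μ γ r :=
  mul_pos (div_pos (sqrt_two_mul_pos hγ) (by linarith)) (Real.rpow_pos_of_pos hr _)

lemma liouvilleInv_pos (hμ : μ < 2) (hγ : 0 < γ) {z : ℝ} (hz : 0 < z) :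
    0 < liouvilleInv μ γ z :=
  Real.rpow_pos_of_pos (mul_pos (div_pos (by linarith) (sqrt_two_mul_pos hγ)) hz) _

lemma liouvilleInv_rpow (hμ : μ < 2) (hγ : 0 < γ) {z : ℝ} (hz : 0 < z) (e : ℝ) :
    liouvilleInv μ γ z ^ e =
      ((1 - μ / 2) / √(2 * γ)) ^ (e / (1 - μ / 2)) * z ^ (e / (1 - μ / 2)) := by
  have h1 : 0 < (1 - μ / 2) / √(2 * γ) := div_pos (by linarith) (sqrt_two_mul_pos hγ)
  rw [liouvilleInv, ← Real.rpow_mul (mul_pos h1 hz).le, Real.mul_rpow h1.le hz.le]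
  congr 2 <;> ring

lemma liouvilleVar_inv (hμ : μ < 2) (hγ : 0 < γ) {z : ℝ} (hz : 0 < z) :
    liouvilleVar μ γ (liouvilleInv μ γ z) = z := by
  have hp : 1 - μ / 2 ≠ 0 := by linarith
  have hp2 : 2 - μ ≠ 0 := by linarith
  have := (sqrt_two_mul_pos hγ).ne'
  rw [liouvilleVar, liouvilleInv_rpow hμ hγ hz, div_self hp, Real.rpow_one, Real.rpow_one]
  field_simp

lemma liouvilleInv_var (hμ : μ < 2) (hγ : 0 < γ) {r : ℝ} (hr : 0 < r) :
    liouvilleInv μ γ (liouvilleVar μ γ r) = r := by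
  have hp : 1 - μ / 2 ≠ 0 := by linarith
  have hp2 : 2 - μ ≠ 0 := by linarith
  have := (sqrt_two_mul_pos hγ).ne'
  rw [liouvilleInv, liouvilleVar, ← mul_assoc,
    show (1 - μ / 2) / √(2 * γ) * (√(2 * γ) / (1 - μ / 2)) = 1 by field_simp, one_mul,
    ← Real.rpow_mul hr.le, mul_inv_cancel₀ hp, Real.rpow_one]

lemma hasDerivAt_liouvilleInv (hμ : μ < 2) (hγ : 0 < γ) {z : ℝ} (hz : 0 < z) :
    HasDerivAt (liouvilleInv μ γ) (liouvilleInv μ γ z ^ (μ / 2) / √(2 * γ)) z := by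
  have hp2 : 2 - μ ≠ 0 := by linarith
  have hk : 0 < (1 - μ / 2) / √(2 * γ) * z :=
    mul_pos (div_pos (by linarith) (sqrt_two_mul_pos hγ)) hz
  have h := ((hasDerivAt_id z).const_mul ((1 - μ / 2) / √(2 * γ))).rpow_const
    (p := (1 - μ / 2)⁻¹) (Or.inl hk.ne')
  refine h.congr_deriv ?_
  simp only [id, mul_one]
  rw [liouvilleInv, ← Real.rpow_mul hk.le,
    show (1 - μ / 2)⁻¹ * (μ / 2) = (1 - μ / 2)⁻¹ - 1 by field_simp; ring]
  have := (sqrt_two_mul_pos hγ).ne'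
  field_simp

lemma tendsto_liouvilleVar_atTop (hμ : μ < 2) (hγ : 0 < γ) :
    Tendsto (liouvilleVar μ γ) atTop atTop :=
  (tendsto_rpow_atTop (by linarith)).const_mul_atTop
    (div_pos (sqrt_two_mul_pos hγ) (by linarith))

lemma tendsto_liouvilleInv_atTop (hμ : μ < 2) (hγ : 0 < γ) :
    Tendsto (liouvilleInv μ γ) atTop atTop :=
  (tendsto_rpow_atTop (inv_pos.2 (by linarith))).comp
    (tendsto_id.const_mul_atTop (div_pos (by linarith) (sqrt_two_mul_pos hγ)))

lemma tendsto_liouvilleInv_zero (hμ : μ < 2) (hγ : 0 < γ) :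
    Tendsto (liouvilleInv μ γ) (𝓝[>] 0) (𝓝[>] 0) := by
  refine tendsto_nhdsWithin_iff.2 ⟨?_, ?_⟩
  · have hp : 0 < (1 - μ / 2)⁻¹ := inv_pos.2 (by linarith)
    have h1 : Tendsto (fun z : ℝ => (1 - μ / 2) / √(2 * γ) * z) (𝓝[>] 0)
        (𝓝 ((1 - μ / 2) / √(2 * γ) * 0)) :=
      (show Tendsto (fun z : ℝ => z) (𝓝[>] 0) (𝓝 0) from nhdsWithin_le_nhds).const_mul _
    have h2 := h1.rpow_const (p := (1 - μ / 2)⁻¹) (Or.inr hp.le)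
    rw [mul_zero, Real.zero_rpow hp.ne'] at h2
    exact h2
  · filter_upwards [self_mem_nhdsWithin] with z hz
    exact liouvilleInv_pos hμ hγ hz

/-- The Liouville transformation: `w(z) = r ^ (-μ/4) u(r)` solves
`w'' = (s (s - 1) / z² + g - 1) w` with `s = ν / (1 - μ/2) + 1/2` and `g = 1 + r ^ μ V / γ`. -/
lemma liouville_transform (hμ : μ < 2) (hγ : 0 < γ) {ν : ℝ} {V u u' : ℝ → ℝ}
    (hu : ∀ r, 0 < r → HasDerivAt u (u' r) r)
    (hu' : ∀ r, 0 < r → HasDerivAt u' (((ν ^ 2 - 1 / 4) / r ^ 2 + 2 * V r) * u r) r)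
    {s : ℝ} (hs : s = ν / (1 - μ / 2) + 1 / 2)
    (hpos : ∀ᶠ r in 𝓝[>] (0 : ℝ), 0 < u r)
    (hlim : Tendsto (fun r => r * u' r / u r) (𝓝[>] 0) (𝓝 (ν + 1 / 2))) :
    ∃ w w' : ℝ → ℝ, (∀ r, 0 < r → w (liouvilleVar μ γ r) = r ^ (-(μ / 4)) * u r) ∧
      (∀ z, 0 < z → HasDerivAt w (w' z) z) ∧
      (∀ z, 0 < z → HasDerivAt w' ((s * (s - 1) / z ^ 2 +
        (1 + liouvilleInv μ γ z ^ μ * V (liouvilleInv μ γ z) / γ) - 1) * w z) z) ∧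
      (∀ᶠ z in 𝓝[>] (0 : ℝ), 0 < w z) ∧
      Tendsto (fun z => z * w' z / w z) (𝓝[>] 0) (𝓝 s) := by
  set R := liouvilleInv μ γ
  set c := √(2 * γ)
  have hc : 0 < c := sqrt_two_mul_pos hγ
  have hc2 : c ^ 2 = 2 * γ := Real.sq_sqrt (by positivity)
  have hp : 0 < 1 - μ / 2 := by linarith
  have hp2 : 2 - μ ≠ 0 := by linarith
  have hR : ∀ z, 0 < z → 0 < R z := fun z hz => liouvilleInv_pos hμ hγ hz
  have hRd : ∀ z, 0 < z → HasDerivAt R (R z ^ (μ / 2) / c) z := fun z hz =>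
    hasDerivAt_liouvilleInv hμ hγ hz
  -- All real powers are rewritten through `X = R^(μ/4)`, so that the transformed equation becomes a
  -- rational identity in `X`, `R` and `c`.
  have hX : ∀ r : ℝ, 0 < r → 0 < r ^ (μ / 4) := fun r hr => Real.rpow_pos_of_pos hr _
  have x1 : ∀ r : ℝ, 0 < r → r ^ (-(μ / 4)) = (r ^ (μ / 4))⁻¹ := fun r hr => Real.rpow_neg hr.le _
  have x2 : ∀ r : ℝ, 0 < r → r ^ (μ / 2) = (r ^ (μ / 4)) ^ 2 := fun r hr => by
    rw [← Real.rpow_natCast, ← Real.rpow_mul hr.le]; congr 1; push_cast; ring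
  have x4 : ∀ r : ℝ, 0 < r → r ^ μ = (r ^ (μ / 4)) ^ 4 := fun r hr => by
    rw [← Real.rpow_natCast, ← Real.rpow_mul hr.le]; congr 1; push_cast; ring
  have hz2 : ∀ z, 0 < z → z ^ 2 = c ^ 2 * R z ^ 2 / ((1 - μ / 2) ^ 2 * (R z ^ (μ / 4)) ^ 4) := by
    intro z hz
    have h1 : z = c / (1 - μ / 2) * R z ^ (1 - μ / 2) := (liouvilleVar_inv hμ hγ hz).symm
    have h2 : R z ^ (1 - μ / 2) = R z / (R z ^ (μ / 4)) ^ 2 := by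
      rw [Real.rpow_sub (hR z hz), Real.rpow_one, x2 _ (hR z hz)]
    nth_rewrite 1 [h1]
    rw [h2]
    have := (hX _ (hR z hz)).ne'
    field_simp
  set w : ℝ → ℝ := fun z => R z ^ (-(μ / 4)) * u (R z)
  set w' : ℝ → ℝ := fun z => (1 / c) * (R z ^ (μ / 4) * (u' (R z) - μ / 4 * (R z)⁻¹ * u (R z)))
  have hR0 := tendsto_liouvilleInv_zero hμ hγ
  have hwpos : ∀ᶠ z in 𝓝[>] (0 : ℝ), 0 < w z := by
    filter_upwards [hR0.eventually hpos, self_mem_nhdsWithin] with z h1 h2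
    exact mul_pos (Real.rpow_pos_of_pos (hR z h2) _) h1
  refine ⟨w, w', fun r hr => ?_, fun z hz => ?_, fun z hz => ?_, hwpos, ?_⟩
  · simp only [w, R]
    rw [liouvilleInv_var hμ hγ hr]
  · have hRz := hR z hz
    have hXz := (hX _ hRz).ne'
    have h1 := (hRd z hz).rpow_const (p := -(μ / 4)) (Or.inl hRz.ne')
    have h2 := (hu _ hRz).comp z (hRd z hz)
    refine (h1.mul h2).congr_deriv ?_
    simp only [w', Function.comp]
    rw [Real.rpow_sub_one hRz.ne', x1 _ hRz, x2 _ hRz]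
    field_simp
    ring
  · have hRz := hR z hz
    have hXz := (hX _ hRz).ne'
    have h1 := (hRd z hz).rpow_const (p := μ / 4) (Or.inl hRz.ne')
    have h2 := (hu _ hRz).comp z (hRd z hz)
    have h3 := (hu' _ hRz).comp z (hRd z hz)
    have h4 := (hRd z hz).inv hRz.ne'
    refine ((h1.mul (h3.sub ((h4.const_mul (μ / 4)).mul h2))).const_mul (1 / c)).congr_deriv ?_
    simp only [w, Function.comp, Pi.sub_apply, Pi.mul_apply, Pi.inv_apply]
    rw [Real.rpow_sub_one hRz.ne', x1 _ hRz, x2 _ hRz, x4 _ hRz, hz2 z hz, hs, hc2]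
    generalize R z ^ (μ / 4) = X at hXz
    have hp' := hp.ne'
    have e : 1 / c * (1 / c) = 1 / (2 * γ) := by rw [← hc2]; field_simp
    have hRz' := hRz.ne'
    generalize R z = r at hRz'
    rw [show ∀ A B D E F : ℝ, 1 / c * (X ^ 2 / c * A * B * D + X * (E * (X ^ 2 / c) - F)) =
      1 / c * (1 / c) * (X ^ 2 * A * B * D + X * (E * X ^ 2 - F * c)) from fun A B D E F => by
        field_simp]
    rw [e]
    field_simp
    ring
  · have h1 := (hlim.comp hR0).sub_const (μ / 4) |>.div_const (1 - μ / 2)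
    rw [show (ν + 1 / 2 - μ / 4) / (1 - μ / 2) = s by rw [hs]; field_simp; ring] at h1
    refine h1.congr' ?_
    filter_upwards [hR0.eventually hpos, self_mem_nhdsWithin] with z h2 h3
    have hRz := hR z h3
    have h4 : z = c / (1 - μ / 2) * R z ^ (1 - μ / 2) := (liouvilleVar_inv hμ hγ h3).symm
    have h5 : R z ^ (1 - μ / 2) = R z / (R z ^ (μ / 4)) ^ 2 := by
      rw [Real.rpow_sub hRz, Real.rpow_one, x2 _ hRz]
    rw [h5] at h4
    simp only [w, w', Function.comp]
    rw [x1 _ hRz]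
    rw [show z * (1 / c * (R z ^ (μ / 4) * (u' (R z) - μ / 4 * (R z)⁻¹ * u (R z)))) /
      ((R z ^ (μ / 4))⁻¹ * u (R z)) = (c / (1 - μ / 2) * (R z / (R z ^ (μ / 4)) ^ 2)) *
      (1 / c * (R z ^ (μ / 4) * (u' (R z) - μ / 4 * (R z)⁻¹ * u (R z)))) /
      ((R z ^ (μ / 4))⁻¹ * u (R z)) by rw [← h4]]
    have := (show 0 < u (R z) from h2).ne'
    change (R z * u' (R z) / u (R z) - μ / 4) / (1 - μ / 2) = _
    field_simp

end Liouville


/-! ### The perturbation and the phases of a radial potential. -/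

/-- The continuous quotient `h/f` is bounded on compacts, which turns a bound near one end of the
half-line into an explicit one on a whole interval. -/
lemma exists_bound_Icc {h f : ℝ → ℝ} (hh : ContinuousOn h (Ioi 0)) (hf : ContinuousOn f (Ioi 0))
    (hpos : ∀ r, 0 < r → 0 < f r) {a : ℝ} (ha : 0 < a) (b : ℝ) :
    ∃ M : ℝ, 0 ≤ M ∧ ∀ r, a ≤ r → r ≤ b → |h r| ≤ M * f r := by
  have hsub : Icc a b ⊆ Ioi 0 := fun x hx => ha.trans_le hx.1
  obtain ⟨M, hM⟩ := isCompact_Icc.exists_bound_of_continuousOn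
    ((hh.mono hsub).div (hf.mono hsub) (fun x hx => (hpos x (hsub hx)).ne'))
  refine ⟨|M|, abs_nonneg M, fun r h1 h2 => ?_⟩
  have h3 := (hM r ⟨h1, h2⟩).trans (le_abs_self M)
  have h4 := hpos r (ha.trans_le h1)
  rw [Pi.div_apply, Real.norm_eq_abs, abs_div, abs_of_pos h4, div_le_iff₀ h4] at h3
  exact h3

lemma exists_bound_Ioc {h f : ℝ → ℝ} (hh : ContinuousOn h (Ioi 0)) (hf : ContinuousOn f (Ioi 0))
    (hpos : ∀ r, 0 < r → 0 < f r) (hO : h =O[𝓝[>] 0] f) (b : ℝ) :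
    ∃ M : ℝ, 0 ≤ M ∧ ∀ r, 0 < r → r ≤ b → |h r| ≤ M * f r := by
  obtain ⟨c, hc0, hc⟩ := hO.exists_nonneg
  obtain ⟨a, ha, hsub⟩ := mem_nhdsGT_iff_exists_Ioo_subset.1 hc.bound
  replace ha : 0 < a := ha
  obtain ⟨M, hM0, hM⟩ := exists_bound_Icc hh hf hpos (half_pos ha) b
  refine ⟨c + M, by positivity, fun r hr hrb => ?_⟩
  have hfr := hpos r hr
  rcases lt_or_ge r a with h1 | h1
  · have h2 : ‖h r‖ ≤ c * ‖f r‖ := hsub ⟨hr, h1⟩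
    rw [Real.norm_eq_abs, Real.norm_of_nonneg hfr.le] at h2
    nlinarith
  · have h2 := hM r (by linarith) hrb
    nlinarith

lemma exists_bound_Ici {h f : ℝ → ℝ} (hh : ContinuousOn h (Ioi 0)) (hf : ContinuousOn f (Ioi 0))
    (hpos : ∀ r, 0 < r → 0 < f r) (hO : h =O[atTop] f) {a : ℝ} (ha : 0 < a) :
    ∃ M : ℝ, 0 ≤ M ∧ ∀ r, a ≤ r → |h r| ≤ M * f r := by
  obtain ⟨c, hc0, hc⟩ := hO.exists_nonneg
  obtain ⟨b, hb⟩ := eventually_atTop.1 hc.bound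
  obtain ⟨M, hM0, hM⟩ := exists_bound_Icc hh hf hpos ha b
  refine ⟨c + M, by positivity, fun r hr => ?_⟩
  have hfr := hpos r (ha.trans_le hr)
  rcases le_total b r with h1 | h1
  · have h2 := hb r h1
    rw [Real.norm_eq_abs, Real.norm_of_nonneg hfr.le] at h2
    nlinarith
  · have h2 := hM r hr h1
    nlinarith

lemma continuousOn_rpow_Ioi (e : ℝ) : ContinuousOn (fun r : ℝ => r ^ e) (Ioi 0) :=
  continuousOn_id.rpow_const fun _ hx => Or.inl (ne_of_gt hx)

/-- The phase `π / 4 - (π / 2) ν / (1 - μ / 2)`, `ν = l + d / 2 - 1`, of the regular solution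
in the unperturbed problem. -/
noncomputable def modelPhase (d : ℕ) (μ : ℝ) (l : ℕ) : ℝ :=
  Real.pi / 4 - ((l : ℝ) + (d : ℝ) / 2 - 1) / (1 - μ / 2) * (Real.pi / 2)

lemma isBigO_sin_sub {ρ θ : ℝ → ℝ} {A Θ ε : ℝ}
    (hρ : (fun z => ρ z - A) =O[atTop] fun z : ℝ => z ^ (-ε))
    (hθ : (fun z => θ z - z - Θ) =O[atTop] fun z : ℝ => z ^ (-ε)) :
    (fun z => ρ z * Real.sin (θ z) - A * Real.sin (z + Θ)) =O[atTop] fun z : ℝ => z ^ (-ε) := by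
  have h1 : (fun z => (ρ z - A) * Real.sin (θ z)) =O[atTop] fun z : ℝ => z ^ (-ε) := by
    refine (IsBigO.of_bound 1 (Eventually.of_forall fun z => ?_)).trans hρ
    rw [norm_mul, one_mul]
    exact mul_le_of_le_one_right (norm_nonneg _) (Real.abs_sin_le_one _)
  have h2 : (fun z => A * (Real.sin (θ z) - Real.sin (z + Θ))) =O[atTop]
      fun z : ℝ => z ^ (-ε) := by
    refine ((IsBigO.of_bound 1 (Eventually.of_forall fun z => ?_)).trans hθ).const_mul_left A
    rw [one_mul, Real.norm_eq_abs, Real.norm_eq_abs, sub_sub]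
    exact Real.abs_sin_sub_sin_le _ _
  exact (h1.add h2).congr_left fun z => by ring

section Radial

variable {μ γ : ℝ} {V₁ V₂ V₃ V : ℝ → ℝ}

lemma RadialCondition.continuousOn_sum (hcond : RadialCondition μ γ V₁ V₂ V₃)
    (hV : ∀ r : ℝ, 0 < r → V r = V₁ r + V₂ r + V₃ r) : ContinuousOn V (Ioi 0) :=
  ((hcond.continuousOn_one.add hcond.continuousOn_two).add hcond.continuousOn_three).congr
    fun r hr => hV r hr

lemma RadialCondition.isBigO_zero (hcond : RadialCondition μ γ V₁ V₂ V₃)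
    (hV : ∀ r : ℝ, 0 < r → V r = V₁ r + V₂ r + V₃ r) :
    ∃ κ : ℝ, 0 < κ ∧ V =O[𝓝[>] 0] fun r : ℝ => r ^ (κ - 2) := by
  obtain ⟨C, κ, hC, hκ, hb⟩ := hcond.three_bound
  refine ⟨κ, hκ, IsBigO.of_bound C ?_⟩
  filter_upwards [hcond.one_vanish, hcond.two_vanish, self_mem_nhdsWithin] with r h1 h2 h3
  rw [hV r h3, h1, h2, zero_add, zero_add, Real.norm_of_nonneg (Real.rpow_nonneg (le_of_lt h3) _),
    sub_eq_neg_add]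
  exact hb r h3

lemma RadialCondition.isSubcritical (hcond : RadialCondition μ γ V₁ V₂ V₃)
    (hV : ∀ r : ℝ, 0 < r → V r = V₁ r + V₂ r + V₃ r) :
    ∃ κ : ℝ, IsSubcritical κ fun r => 2 * V r := by
  obtain ⟨κ, hκ, hO⟩ := hcond.isBigO_zero hV
  have hc : ContinuousOn (fun r => 2 * V r) (Ioi 0) :=
    continuousOn_const.mul (hcond.continuousOn_sum hV)
  exact ⟨κ, hκ, hc, fun R _ => exists_bound_Ioc hc (continuousOn_rpow_Ioi _)
    (fun r hr => Real.rpow_pos_of_pos hr _) (hO.const_mul_left 2) R⟩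

lemma RadialCondition.eventually_eq (hcond : RadialCondition μ γ V₁ V₂ V₃)
    (hV : ∀ r : ℝ, 0 < r → V r = V₁ r + V₂ r + V₃ r) :
    ∀ᶠ r in atTop, V₁ r = -γ * r ^ (-μ) ∧ V r = V₁ r + V₂ r := by
  obtain ⟨R, hR⟩ := hcond.three_support
  filter_upwards [eventually_ge_atTop 1, eventually_gt_atTop R] with r h1 h2
  refine ⟨hcond.one_eq r h1, ?_⟩
  rw [hV r (by linarith), hR r h2, add_zero]

/-- The perturbation in the Liouville normal form. -/
noncomputable def liouvillePert (μ γ : ℝ) (V : ℝ → ℝ) (z : ℝ) : ℝ :=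
  1 + liouvilleInv μ γ z ^ μ * V (liouvilleInv μ γ z) / γ

lemma RadialCondition.pert_continuousOn (hcond : RadialCondition μ γ V₁ V₂ V₃)
    (hV : ∀ r : ℝ, 0 < r → V r = V₁ r + V₂ r + V₃ r) :
    ContinuousOn (liouvillePert μ γ V) (Ioi 0) := by
  have hR : ContinuousOn (liouvilleInv μ γ) (Ioi 0) := fun z hz =>
    (hasDerivAt_liouvilleInv hcond.mu_lt_two hcond.gamma_pos hz).continuousAt.continuousWithinAt
  have hm : MapsTo (liouvilleInv μ γ) (Ioi 0) (Ioi 0) := fun z hz =>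
    liouvilleInv_pos hcond.mu_lt_two hcond.gamma_pos hz
  exact continuousOn_const.add ((((continuousOn_rpow_Ioi μ).comp hR hm).mul
    ((hcond.continuousOn_sum hV).comp hR hm)).div_const γ)

/-- At `0` the terms `1` and `r^μ V = O(r^(μ+κ-2))` are both `O(r^(μ-2))`, a multiple of `z^(-2)`.
At infinity the leading part of `V` cancels the `1`, and `r^μ V₂ = O(r^(μ/2-1-ε))` is a power of `z`
below `-1`. -/
lemma RadialCondition.pert_bound (hcond : RadialCondition μ γ V₁ V₂ V₃)
    (hV : ∀ r : ℝ, 0 < r → V r = V₁ r + V₂ r + V₃ r) :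
    ∃ C ε : ℝ, 0 < ε ∧ ε ≤ 1 ∧ (∀ z, 0 < z → z ≤ 1 → |liouvillePert μ γ V z| ≤ C / z ^ 2) ∧
      ∀ z, 1 ≤ z → |liouvillePert μ γ V z| ≤ C * z ^ (-1 - ε) := by
  have hμ := hcond.mu_lt_two
  have hγ := hcond.gamma_pos
  have hp : 0 < 1 - μ / 2 := by linarith
  have hk : 0 < (1 - μ / 2) / √(2 * γ) := div_pos hp (sqrt_two_mul_pos hγ)
  have hc := hcond.pert_continuousOn hV
  obtain ⟨κ, hκ, hO⟩ := hcond.isBigO_zero hV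
  have h0 : (fun r => 1 + r ^ μ * V r / γ) =O[𝓝[>] 0] fun r : ℝ => r ^ (μ - 2) := by
    have hle : ∀ a b : ℝ, b ≤ a → (fun r : ℝ => r ^ a) =O[𝓝[>] 0] fun r : ℝ => r ^ b := by
      intro a b hab
      refine IsBigO.of_bound 1 ?_
      filter_upwards [Ioc_mem_nhdsGT (zero_lt_one' ℝ)] with r hr
      rw [Real.norm_of_nonneg (Real.rpow_nonneg hr.1.le _),
        Real.norm_of_nonneg (Real.rpow_nonneg hr.1.le _), one_mul]
      exact Real.rpow_le_rpow_of_exponent_ge hr.1 hr.2 hab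
    refine IsBigO.add ((hle 0 (μ - 2) (by linarith)).congr_left fun r => Real.rpow_zero r) ?_
    have h1 : (fun r => r ^ μ * V r / γ) =O[𝓝[>] 0] fun r : ℝ => r ^ μ * r ^ (κ - 2) := by
      refine (((isBigO_refl (fun r : ℝ => r ^ μ) _).mul hO).const_mul_left γ⁻¹).congr_left
        fun r => by ring
    refine (h1.congr' (EventuallyEq.refl _ _) ?_).trans (hle (μ + (κ - 2)) _ (by linarith))
    filter_upwards [self_mem_nhdsWithin] with r hr
    rw [Real.rpow_add hr]
  have hg0 : liouvillePert μ γ V =O[𝓝[>] 0] fun z : ℝ => (z ^ 2)⁻¹ := by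
    refine (h0.comp_tendsto (tendsto_liouvilleInv_zero hμ hγ)).trans ?_
    refine (isBigO_const_mul_self (((1 - μ / 2) / √(2 * γ)) ^ ((μ - 2) / (1 - μ / 2)))
      (fun z : ℝ => (z ^ 2)⁻¹) _).congr' ?_ (EventuallyEq.refl _ _)
    filter_upwards [self_mem_nhdsWithin] with z hz
    simp only [Function.comp]
    have h2 : 2 - μ ≠ 0 := by linarith
    rw [liouvilleInv_rpow hμ hγ hz, show (μ - 2) / (1 - μ / 2) = -(2 : ℕ) by
      rw [div_eq_iff hp.ne']; push_cast; ring]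
    rw [Real.rpow_neg (le_of_lt hz), Real.rpow_natCast]
  obtain ⟨ε, hε, hε2⟩ := hcond.two_decay
  -- The cap at `1` lets `z^(-1-ε')` also dominate the centrifugal term `1/z²`.
  set ε' := min 1 (ε / (1 - μ / 2))
  have hε' : 0 < ε' := by positivity
  have h1 : (fun r => 1 + r ^ μ * V r / γ) =O[atTop] fun r : ℝ => r ^ (μ / 2 - 1 - ε) := by
    have h2 : (fun r => r ^ μ * V₂ r / γ) =O[atTop]
        fun r : ℝ => r ^ μ * r ^ (-1 - μ / 2 - ε) :=
      (((isBigO_refl (fun r : ℝ => r ^ μ) _).mul hε2).const_mul_left γ⁻¹).congr_left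
        fun r => by ring
    refine h2.congr' ?_ ?_
    · filter_upwards [hcond.eventually_eq hV, eventually_gt_atTop 0] with r hr hr0
      rw [hr.2, hr.1]
      have h3 : r ^ μ * r ^ (-μ) = 1 := by rw [← Real.rpow_add hr0]; simp
      field_simp
      linear_combination γ * h3
    · filter_upwards [eventually_gt_atTop 0] with r hr0
      rw [← Real.rpow_add hr0]; congr 1; ring
  have hg1 : liouvillePert μ γ V =O[atTop] fun z : ℝ => z ^ (-1 - ε') := by
    refine (h1.comp_tendsto (tendsto_liouvilleInv_atTop hμ hγ)).trans ?_
    refine IsBigO.of_bound (((1 - μ / 2) / √(2 * γ)) ^ ((μ / 2 - 1 - ε) / (1 - μ / 2))) ?_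
    filter_upwards [eventually_ge_atTop 1] with z hz
    have hz0 : 0 < z := by linarith
    simp only [Function.comp]
    rw [liouvilleInv_rpow hμ hγ hz0, norm_mul, Real.norm_of_nonneg (Real.rpow_nonneg hk.le _),
      Real.norm_of_nonneg (Real.rpow_nonneg hz0.le _),
      Real.norm_of_nonneg (Real.rpow_nonneg hz0.le _)]
    refine mul_le_mul_of_nonneg_left (Real.rpow_le_rpow_of_exponent_le hz ?_)
      (Real.rpow_nonneg hk.le _)
    have : (μ / 2 - 1 - ε) / (1 - μ / 2) = -1 - ε / (1 - μ / 2) := by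
      rw [div_eq_iff hp.ne', sub_mul, div_mul_cancel₀ _ hp.ne']; ring
    rw [this]
    linarith [min_le_right 1 (ε / (1 - μ / 2))]
  obtain ⟨M₀, hM₀, hb₀⟩ := exists_bound_Ioc hc
    ((continuousOn_id.pow 2).inv₀ fun z hz => (pow_pos (show 0 < z from hz) 2).ne')
    (fun z hz => inv_pos.2 (pow_pos hz 2)) hg0 1
  obtain ⟨M₁, hM₁, hb₁⟩ := exists_bound_Ici hc (continuousOn_rpow_Ioi (-1 - ε'))
    (fun z hz => Real.rpow_pos_of_pos hz _) hg1 one_pos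
  refine ⟨M₀ + M₁, ε', hε', min_le_left _ _, fun z hz hz1 => ?_, fun z hz => ?_⟩
  · refine (hb₀ z hz hz1).trans ?_
    rw [div_eq_mul_inv]
    exact mul_le_mul_of_nonneg_right (by linarith) (inv_nonneg.2 (sq_nonneg _))
  · exact (hb₁ z hz).trans (mul_le_mul_of_nonneg_right (by linarith)
      (Real.rpow_nonneg (by linarith) _))

/-- Regular solutions exist, and they oscillate with an asymptotic phase which approaches the
one of the unperturbed problem as `l → ∞`. -/
theorem RadialCondition.exists_phase (hcond : RadialCondition μ γ V₁ V₂ V₃)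
    (hV : ∀ r : ℝ, 0 < r → V r = V₁ r + V₂ r + V₃ r) {d : ℕ} (hd : 2 ≤ d) :
    ∃ Θ : ℕ → ℝ, Tendsto (fun l => Θ l - modelPhase d μ l) atTop (𝓝 0) ∧
      ∀ l, ∃ u, IsRegularSolution d V l u ∧ ∃ A ε : ℝ, 0 < A ∧ 0 < ε ∧
        (fun r => r ^ (-(μ / 4)) * u r - A * Real.sin (liouvilleVar μ γ r + Θ l)) =O[atTop]
          fun r : ℝ => r ^ (-ε) := by
  have hμ := hcond.mu_lt_two
  have hγ := hcond.gamma_pos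
  have hp : 0 < 1 - μ / 2 := by linarith
  have hd' : (2 : ℝ) ≤ d := by exact_mod_cast hd
  obtain ⟨C, ε, hε, hε1, hg0, hg1⟩ := hcond.pert_bound hV
  have hgc := hcond.pert_continuousOn hV
  set g := liouvillePert μ γ V
  set ν : ℕ → ℝ := fun l => (l : ℝ) + (d : ℝ) / 2 - 1
  have hν : ∀ l, 0 ≤ ν l := fun l => by
    have : (0 : ℝ) ≤ l := l.cast_nonneg
    simp only [ν]; linarith
  set s : ℕ → ℝ := fun l => ν l / (1 - μ / 2) + 1 / 2
  have hs : ∀ l, 1 / 2 ≤ s l := fun l => by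
    have := div_nonneg (hν l) hp.le
    simp only [s]; linarith
  have main : ∀ l, ∃ θ : ℝ → ℝ, ∃ Θ : ℝ,
      IsPruferAngle (fun z => s l * (s l - 1) / z ^ 2 + g z) (s l) θ ∧
      Tendsto (fun z => θ z - z) atTop (𝓝 Θ) ∧ ∃ u, IsRegularSolution d V l u ∧
      ∃ A ε : ℝ, 0 < A ∧ 0 < ε ∧
        (fun r => r ^ (-(μ / 4)) * u r - A * Real.sin (liouvilleVar μ γ r + Θ)) =O[atTop]
          fun r : ℝ => r ^ (-ε) := by
    intro l
    obtain ⟨κ, hq⟩ := hcond.isSubcritical hV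
    obtain ⟨u, u', hu, hu', hn, hl⟩ := exists_regular_solution (s := ν l + 1 / 2)
      (by linarith [hν l]) hq
    have hu'' : ∀ r, 0 < r → HasDerivAt u' (((ν l ^ 2 - 1 / 4) / r ^ 2 + 2 * V r) * u r) r :=
      fun r hr => (hu' r hr).congr_deriv (by ring)
    have hreg : IsRegularSolution d V l u := by
      refine ⟨fun r hr => (hu r hr).differentiableAt, fun r hr => ?_, ?_⟩
      · refine ((hu'' r hr).congr_of_eventuallyEq ?_).congr_deriv ?_
        · filter_upwards [Ioi_mem_nhds hr] with x hx
          exact (hu x hx).deriv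
        · simp only [effPotential, ν]; ring
      · refine hn.congr fun r => ?_
        congr 2; simp only [ν]; ring
    have hpos : ∀ᶠ r in 𝓝[>] (0 : ℝ), 0 < u r := by
      filter_upwards [hn.eventually (lt_mem_nhds one_pos), self_mem_nhdsWithin] with r h1 h2
      exact pos_of_mul_pos_right h1 (Real.rpow_pos_of_pos h2 _).le
    obtain ⟨w, w', hw0, hw, hw', hwpos, hwlim⟩ := liouville_transform hμ hγ hu hu'' (s := s l) rfl
      hpos hl
    have hP' : ContinuousOn (fun z : ℝ => s l * (s l - 1) / z ^ 2) (Ioi 0) :=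
      continuousOn_const.div (continuousOn_id.pow 2)
        (fun z hz => (pow_pos (show 0 < z from hz) 2).ne')
    have hP : ContinuousOn (fun z => s l * (s l - 1) / z ^ 2 + g z) (Ioi 0) := hP'.add hgc
    obtain ⟨θ, ρ, hθ, hρ, hρ', hrep⟩ := exists_prufer (by linarith [hs l]) hP hw hw' hwpos hwlim
    have hPb : ∀ z, 1 ≤ z → |s l * (s l - 1) / z ^ 2 + g z| ≤
        (|s l * (s l - 1)| + C) * z ^ (-1 - ε) := by
      intro z hz
      have hz0 : 0 < z := by linarith
      have h1 : |s l * (s l - 1) / z ^ 2| ≤ |s l * (s l - 1)| * z ^ (-1 - ε) := by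
        rw [abs_div, abs_of_pos (pow_pos hz0 2), div_eq_mul_inv]
        refine mul_le_mul_of_nonneg_left ?_ (abs_nonneg _)
        rw [← Real.rpow_natCast, ← Real.rpow_neg hz0.le]
        exact Real.rpow_le_rpow_of_exponent_le hz (by push_cast; linarith)
      have := hg1 z hz
      rw [add_mul |s l * (s l - 1)|]
      exact (abs_add_le _ _).trans (add_le_add h1 this)
    obtain ⟨Θ, hΘ⟩ := hθ.exists_phase one_pos hε hPb
    obtain ⟨A, hA, hAρ⟩ := exists_amplitude hρ hρ' one_pos hε hPb
    have hΘO : (fun z => θ z - z - Θ) =O[atTop] fun z : ℝ => z ^ (-ε) := by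
      refine IsBigO.of_bound ((|s l * (s l - 1)| + C) / ε) ?_
      filter_upwards [eventually_ge_atTop 1] with z hz
      rw [Real.norm_eq_abs, Real.norm_of_nonneg (Real.rpow_nonneg (by linarith) _)]
      exact hΘ z hz
    refine ⟨θ, Θ, hθ, ?_, u, hreg, A, (1 - μ / 2) * ε, hA, by positivity, ?_⟩
    · have := (hΘO.trans_tendsto (tendsto_rpow_neg_atTop hε)).add_const Θ
      simpa using this
    · have h1 := (isBigO_sin_sub hAρ hΘO).comp_tendsto (tendsto_liouvilleVar_atTop hμ hγ)
      have h2 : ((fun z : ℝ => z ^ (-ε)) ∘ liouvilleVar μ γ) =O[atTop]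
          fun r : ℝ => r ^ (-((1 - μ / 2) * ε)) := by
        refine (isBigO_const_mul_self ((√(2 * γ) / (1 - μ / 2)) ^ (-ε)) _ _).congr' ?_
          (EventuallyEq.refl _ _)
        filter_upwards [eventually_gt_atTop 0] with r hr
        simp only [Function.comp, liouvilleVar]
        rw [Real.mul_rpow (div_nonneg (Real.sqrt_nonneg _) hp.le) (Real.rpow_nonneg hr.le _),
          ← Real.rpow_mul hr.le, mul_neg]
      refine (h1.trans h2).congr' ?_ (EventuallyEq.refl _ _)
      filter_upwards [eventually_gt_atTop 0] with r hr
      simp only [Function.comp]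
      rw [← hw0 r hr, (hrep _ (liouvilleVar_pos hμ hγ hr)).1]
  choose θ Θ hθ hΘ hu using main
  refine ⟨Θ, ?_, hu⟩
  rw [Metric.tendsto_atTop]
  intro η hη
  obtain ⟨N, hN⟩ := phase_asymptotics hgc hε hg0 hg1 (half_pos hη)
  have hslim : Tendsto s atTop atTop := by
    have h1 : Tendsto ν atTop atTop := by
      refine tendsto_atTop_add_const_right _ (-1 : ℝ) (tendsto_atTop_add_const_right _ ((d : ℝ) / 2)
        tendsto_natCast_atTop_atTop) |>.congr fun l => by simp only [ν]; ring
    exact tendsto_atTop_add_const_right _ _ (h1.atTop_div_const hp)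
  obtain ⟨L, hL⟩ := eventually_atTop.1 (hslim.eventually (eventually_ge_atTop N))
  refine ⟨L, fun l hl => ?_⟩
  have := hN (s l) (hL l hl) (θ l) (Θ l) (hθ l) (hΘ l)
  rw [Real.dist_eq, sub_zero]
  have e : (1 - s l) * (Real.pi / 2) = modelPhase d μ l := by
    simp only [s, modelPhase, ν]; ring
  rw [e] at this
  linarith

/-- Regular solutions are unique on `]0, ∞[`. -/
lemma RadialCondition.regular_unique (hcond : RadialCondition μ γ V₁ V₂ V₃)
    (hV : ∀ r : ℝ, 0 < r → V r = V₁ r + V₂ r + V₃ r) {d : ℕ} (hd : 2 ≤ d) {l : ℕ} {u v : ℝ → ℝ}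
    (hu : IsRegularSolution d V l u) (hv : IsRegularSolution d V l v) {r : ℝ} (hr : 0 < r) :
    u r = v r := by
  have hd' : (2 : ℝ) ≤ d := by exact_mod_cast hd
  have hQ : ContinuousOn (effPotential d V l) (Ioi 0) :=
    (continuousOn_const.mul (hcond.continuousOn_sum hV)).add
      (continuousOn_const.div (continuousOn_id.pow 2)
        (fun z hz => (pow_pos (show 0 < z from hz) 2).ne'))
  have hn : ∀ {w : ℝ → ℝ}, IsRegularSolution d V l w →
      Tendsto (fun r => r ^ (-((l : ℝ) + ((d : ℝ) - 1) / 2)) * w r) (𝓝[>] 0) (𝓝 1) := by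
    intro w hw
    refine hw.normalization.congr fun r => ?_
    rw [neg_add, ← sub_eq_add_neg]
  exact (regular_solution_unique (s := (l : ℝ) + ((d : ℝ) - 1) / 2) (by linarith) hQ
    (fun r hr => (hu.differentiableAt r hr).hasDerivAt) hu.equation
    (fun r hr => (hv.differentiableAt r hr).hasDerivAt) hv.equation (hn hu) (hn hv) hr).1

end Radial


/-! ### Radial functions in the Besov space and quadratic means. -/

/-- Integration of `h(|x|)² / |x| ^ (d - 1)` over balls in polar coordinates. -/
lemma integral_ball_radial (d : ℕ) (hd : 2 ≤ d) :
    ∃ c : ℝ, 0 < c ∧ ∀ (h : ℝ → ℝ) (R : ℝ),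
      ∫ x in Metric.ball (0 : EuclideanSpace ℝ (Fin d)) R, (h ‖x‖ / ‖x‖ ^ (((d : ℝ) - 1) / 2)) ^ 2 =
        c * ∫ r in Ioo 0 R, h r ^ 2 := by
  have : Nonempty (Fin d) := ⟨⟨0, by omega⟩⟩
  have : Nontrivial (EuclideanSpace ℝ (Fin d)) := by
    refine Module.nontrivial_of_finrank_pos (R := ℝ) ?_
    rw [finrank_euclideanSpace_fin]; omega
  refine ⟨d * (volume : Measure (EuclideanSpace ℝ (Fin d))).real (Metric.ball 0 1), ?_, ?_⟩
  · refine mul_pos (by exact_mod_cast (by omega : 0 < d)) ?_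
    exact ENNReal.toReal_pos (Metric.measure_ball_pos _ _ one_pos).ne' measure_ball_lt_top.ne
  · intro h R
    have h1 := integral_fun_norm_addHaar (volume : Measure (EuclideanSpace ℝ (Fin d)))
      ((Iio R).indicator fun r => (h r / r ^ (((d : ℝ) - 1) / 2)) ^ 2)
    have h2 : (fun x : EuclideanSpace ℝ (Fin d) =>
        (Iio R).indicator (fun r => (h r / r ^ (((d : ℝ) - 1) / 2)) ^ 2) ‖x‖) =
        (Metric.ball 0 R).indicator fun x => (h ‖x‖ / ‖x‖ ^ (((d : ℝ) - 1) / 2)) ^ 2 := by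
      funext x
      simp [indicator]
    rw [h2, integral_indicator measurableSet_ball] at h1
    rw [h1, finrank_euclideanSpace_fin, nsmul_eq_mul, smul_eq_mul, ← mul_assoc]
    congr 1
    rw [← Ioi_inter_Iio, ← setIntegral_indicator measurableSet_Iio]
    refine setIntegral_congr_fun measurableSet_Ioi fun r hr => ?_
    have hr : 0 < r := hr
    by_cases hrR : r ∈ Iio R
    · simp only [indicator_of_mem hrR, smul_eq_mul, div_pow]
      -- The squared weight is exactly the Jacobian `r^(d-1)` of polar coordinates.
      rw [← Real.rpow_natCast (r ^ (((d : ℝ) - 1) / 2)), ← Real.rpow_mul hr.le,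
        ← Real.rpow_natCast r (d - 1), Nat.cast_sub (by omega)]
      push_cast
      rw [div_mul_cancel₀ _ two_ne_zero]
      have := (Real.rpow_pos_of_pos hr ((d : ℝ) - 1)).ne'
      field_simp
    · simp only [indicator_of_notMem hrR, smul_zero]

lemma setIntegral_ball_mono {d : ℕ} {f : EuclideanSpace ℝ (Fin d) → ℝ}
    (hf : ∀ R : ℝ, MemLp f 2 (volume.restrict (Metric.ball 0 R))) {R R' : ℝ} (h : R ≤ R') :
    ∫ x in Metric.ball 0 R, f x ^ 2 ≤ ∫ x in Metric.ball 0 R', f x ^ 2 :=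
  setIntegral_mono_set (hf R').integrable_sq (ae_of_all _ fun _ => sq_nonneg _)
    (Metric.ball_subset_ball h).eventuallyLE

/-- The supremum is finite for free: beyond some `T` the limit bounds it, and for `1 < R ≤ T` the
weight is at most `1` and the integral is monotone. -/
lemma memDualBesovZero_of_tendsto {d : ℕ} {s : ℝ} (hs : 0 ≤ s) {f : EuclideanSpace ℝ (Fin d) → ℝ}
    (hf : ∀ R : ℝ, MemLp f 2 (volume.restrict (Metric.ball 0 R)))
    (hlim : Tendsto (fun R : ℝ => R ^ (-2 * s) * ∫ x in Metric.ball 0 R, f x ^ 2) atTop (𝓝 0)) :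
    MemDualBesovZero s f := by
  refine ⟨⟨hf, ?_⟩, hlim⟩
  obtain ⟨T, hT⟩ := eventually_atTop.1 (hlim.eventually (gt_mem_nhds one_pos))
  have h0 : ∀ R, 0 ≤ ∫ x in Metric.ball (0 : EuclideanSpace ℝ (Fin d)) R, f x ^ 2 :=
    fun R => integral_nonneg fun _ => sq_nonneg _
  refine ⟨1 + ∫ x in Metric.ball (0 : EuclideanSpace ℝ (Fin d)) T, f x ^ 2, fun R hR => ?_⟩
  rcases le_total T R with h | h
  · linarith [hT R h, h0 T]
  · have h1 : R ^ (-2 * s) ≤ 1 := Real.rpow_le_one_of_one_le_of_nonpos hR.le (by linarith)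
    have h2 := setIntegral_ball_mono hf h
    have h3 := mul_le_mul h1 h2 (h0 R) zero_le_one
    linarith

/-- A radial criterion for membership in `B*_{s,0}`. -/
lemma memDualBesovZero_radial {d : ℕ} (hd : 2 ≤ d) {e ε : ℝ} (he : 0 < e) (hε : 0 < ε)
    {h : ℝ → ℝ} (hm : Measurable ((Ioi 0).indicator h))
    (hb : ∀ R : ℝ, ∃ M : ℝ, ∀ r, 0 < r → r ≤ R → |h r| ≤ M * r ^ (((d : ℝ) - 1) / 2))
    (hO : h =O[atTop] fun r : ℝ => r ^ (e - ε)) :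
    MemDualBesovZero ((1 + 2 * e) / 2)
      fun x : EuclideanSpace ℝ (Fin d) => h ‖x‖ / ‖x‖ ^ (((d : ℝ) - 1) / 2) := by
  have hd' : (2 : ℝ) ≤ d := by exact_mod_cast hd
  have : Nontrivial (EuclideanSpace ℝ (Fin d)) := by
    refine Module.nontrivial_of_finrank_pos (R := ℝ) ?_
    rw [finrank_euclideanSpace_fin]; omega
  obtain ⟨c, hc, hpol⟩ := integral_ball_radial d hd
  refine memDualBesovZero_of_tendsto (by linarith) (fun R => ?_) ?_
  · obtain ⟨M, hM⟩ := hb R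
    have hae : ∀ᵐ x : EuclideanSpace ℝ (Fin d), x ≠ 0 := by
      simp [ae_iff]
    have : IsFiniteMeasure (volume.restrict (Metric.ball (0 : EuclideanSpace ℝ (Fin d)) R)) :=
      ⟨by rw [Measure.restrict_apply_univ]; exact measure_ball_lt_top⟩
    refine MemLp.of_bound (AEStronglyMeasurable.restrict ?_) M ?_
    · refine ⟨fun x => (Ioi 0).indicator h ‖x‖ / ‖x‖ ^ (((d : ℝ) - 1) / 2), ?_, ?_⟩
      · exact ((hm.comp measurable_norm).div (measurable_norm.pow_const _)).stronglyMeasurable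
      · filter_upwards [hae] with x hx
        have hx' : ‖x‖ ∈ Ioi (0 : ℝ) := norm_pos_iff.2 hx
        rw [indicator_of_mem hx']
    · filter_upwards [ae_restrict_mem measurableSet_ball, ae_restrict_of_ae hae] with x hx hx0
      have hx1 := norm_pos_iff.2 hx0
      have hx2 := Real.rpow_pos_of_pos hx1 (((d : ℝ) - 1) / 2)
      rw [Real.norm_eq_abs, abs_div, abs_of_pos hx2, div_le_iff₀ hx2]
      exact hM _ hx1 (mem_ball_zero_iff.1 hx).le
  · simp only [hpol]
    -- Keeps `e - ε' ≥ 0`, so that `R^(e-ε') ≥ 1` absorbs the bounded part of `h` near the origin.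
    set ε' := min ε e
    obtain ⟨K, hK⟩ := hO.bound
    obtain ⟨T, hT⟩ := eventually_atTop.1 hK
    obtain ⟨M, hM⟩ := hb (max T 1)
    have hT1 : (0 : ℝ) < max T 1 := lt_max_of_lt_right one_pos
    set N := |M| * max T 1 ^ (((d : ℝ) - 1) / 2) + |K|
    have hεe : 0 ≤ e - ε' := sub_nonneg.2 (min_le_right _ _)
    have hε'0 : 0 < ε' := lt_min hε he
    have hbound : ∀ R, 1 ≤ R → ∀ r ∈ Ioo 0 R, |h r| ≤ N * R ^ (e - ε') := by
      intro R hR r hr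
      have hR1 : 1 ≤ R ^ (e - ε') := Real.one_le_rpow hR hεe
      rw [add_mul]
      have hB : 0 ≤ |M| * max T 1 ^ (((d : ℝ) - 1) / 2) :=
        mul_nonneg (abs_nonneg _) (Real.rpow_nonneg hT1.le _)
      rcases le_total r (max T 1) with h1 | h1
      · have h2 : |h r| ≤ |M| * max T 1 ^ (((d : ℝ) - 1) / 2) :=
          (hM r hr.1 h1).trans (mul_le_mul (le_abs_self M)
            (Real.rpow_le_rpow hr.1.le h1 (by linarith)) (Real.rpow_nonneg hr.1.le _)
            (abs_nonneg _))
        have h3 := le_mul_of_one_le_right hB hR1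
        have h4 := mul_nonneg (abs_nonneg K) (zero_le_one.trans hR1)
        linarith
      · have h2 := hT r ((le_max_left _ _).trans h1)
        have hr1 : 1 ≤ r := (le_max_right _ _).trans h1
        rw [Real.norm_eq_abs, Real.norm_of_nonneg (Real.rpow_nonneg hr.1.le _)] at h2
        have h3 : r ^ (e - ε) ≤ R ^ (e - ε') :=
          (Real.rpow_le_rpow_of_exponent_le hr1 (by linarith [min_le_left ε e])).trans
            (Real.rpow_le_rpow hr.1.le hr.2.le hεe)
        have h4 : K * r ^ (e - ε) ≤ |K| * R ^ (e - ε') :=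
          mul_le_mul (le_abs_self K) h3 (Real.rpow_nonneg hr.1.le _) (abs_nonneg _)
        have h5 := mul_nonneg hB (zero_le_one.trans hR1)
        linarith
    have hz : Tendsto (fun R : ℝ => c * N ^ 2 * R ^ (-(2 * ε'))) atTop (𝓝 0) := by
      simpa using (tendsto_rpow_neg_atTop (by linarith : 0 < 2 * ε')).const_mul (c * N ^ 2)
    refine squeeze_zero' ?_ ?_ hz
    · filter_upwards [eventually_ge_atTop 0] with R hR
      exact mul_nonneg (Real.rpow_nonneg hR _)
        (mul_nonneg hc.le (integral_nonneg fun _ => sq_nonneg _))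
    · filter_upwards [eventually_ge_atTop 1] with R hR
      have hR0 : 0 < R := by linarith
      have h1 : ‖∫ r in Ioo 0 R, h r ^ 2‖ ≤ (N * R ^ (e - ε')) ^ 2 * volume.real (Ioo 0 R) := by
        refine norm_setIntegral_le_of_norm_le_const measure_Ioo_lt_top fun r hr => ?_
        rw [Real.norm_eq_abs, abs_pow]
        exact pow_le_pow_left₀ (abs_nonneg _) (hbound R hR r hr) 2
      rw [Real.volume_real_Ioo_of_le hR0.le, sub_zero] at h1
      have h2 := mul_le_mul_of_nonneg_left ((le_abs_self _).trans h1)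
        (mul_nonneg (Real.rpow_nonneg hR0.le (-2 * ((1 + 2 * e) / 2))) hc.le)
      rw [mul_assoc] at h2
      refine h2.trans_eq ?_
      have h3 : R ^ (-(2 * ε')) = R ^ (-2 * ((1 + 2 * e) / 2)) * R ^ (e - ε') * R ^ (e - ε') * R := by
        rw [← Real.rpow_add hR0, ← Real.rpow_add hR0, ← Real.rpow_add_one hR0.ne']
        congr 1; ring
      rw [h3]; ring

lemma hasDerivAt_liouvilleVar {μ γ : ℝ} (hμ : μ < 2) {r : ℝ} (hr : 0 < r) :
    HasDerivAt (liouvilleVar μ γ) (√(2 * γ) * r ^ (-(μ / 2))) r := by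
  refine ((Real.hasDerivAt_rpow_const (Or.inl hr.ne')).const_mul _).congr_deriv ?_
  have hp : 1 - μ / 2 ≠ 0 := by linarith
  rw [show 1 - μ / 2 - 1 = -(μ / 2) by ring, ← mul_assoc, div_mul_cancel₀ _ hp]

/-- An oscillating function with nonvanishing amplitude has a nonvanishing quadratic mean. -/
lemma eq_zero_of_tendsto_mean {μ γ R₀ X Y : ℝ} (hμ0 : 0 < μ) (hμ : μ < 2) (hγ : 0 < γ)
    (hR₀ : 0 < R₀)
    (hlim : Tendsto (fun R => R ^ (-(1 + μ / 2)) * ∫ r in R₀..R, r ^ (μ / 2) *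
      (X * Real.sin (liouvilleVar μ γ r) + Y * Real.cos (liouvilleVar μ γ r)) ^ 2) atTop (𝓝 0)) :
    X = 0 ∧ Y = 0 := by
  set k := √(2 * γ)
  -- Since `z' = k r^(-μ/2)`, the derivative of `r^μ (a sin 2z + b cos 2z)` has the oscillating part
  -- of the integrand as its main term. The leading term `m r^(1+μ/2)` of `H` is the integral of the
  -- mean part.
  set a := (Y ^ 2 - X ^ 2) / (4 * k)
  set b := -(X * Y) / (2 * k)
  set S := |a| + |b|
  set z := liouvilleVar μ γ
  set φ : ℝ → ℝ := fun r => r ^ (μ / 2) * (X * Real.sin (z r) + Y * Real.cos (z r)) ^ 2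
  set m := (X ^ 2 + Y ^ 2) / 2 / (1 + μ / 2)
  -- Subtracting `S r^μ` gives the remaining term `μ r^(μ-1) (a sin 2z + b cos 2z - S)` of `H'` a
  -- negative sign, so `H' ≤ φ`. All corrections are `O(r^μ)`, of lower order as `μ < 1 + μ/2`.
  set H : ℝ → ℝ := fun r => m * r ^ (1 + μ / 2) +
    r ^ μ * (a * Real.sin (2 * z r) + b * Real.cos (2 * z r)) - S * r ^ μ
  have hS : ∀ x, a * Real.sin x + b * Real.cos x ≤ S ∧ -S ≤ a * Real.sin x + b * Real.cos x := by
    intro x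
    have h1 : |a * Real.sin x| ≤ |a| := by
      rw [abs_mul]; exact mul_le_of_le_one_right (abs_nonneg _) (Real.abs_sin_le_one _)
    have h2 : |b * Real.cos x| ≤ |b| := by
      rw [abs_mul]; exact mul_le_of_le_one_right (abs_nonneg _) (Real.abs_cos_le_one _)
    have h3 := abs_le.1 h1
    have h4 := abs_le.1 h2
    constructor <;> simp only [S] <;> linarith
  have hz : ∀ r, 0 < r → HasDerivAt z (k * r ^ (-(μ / 2))) r :=
    fun r hr => hasDerivAt_liouvilleVar hμ hr
  have hzc : ContinuousOn z (Ioi 0) := fun r hr => (hz r hr).continuousAt.continuousWithinAt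
  have hφc : ContinuousOn φ (Ioi 0) :=
    (continuousOn_rpow_Ioi _).mul (((continuousOn_const.mul (Real.continuous_sin.comp_continuousOn
      hzc)).add (continuousOn_const.mul (Real.continuous_cos.comp_continuousOn hzc))).pow 2)
  have hH : ∀ r, 0 < r → HasDerivAt H (φ r +
      μ * r ^ (μ - 1) * (a * Real.sin (2 * z r) + b * Real.cos (2 * z r) - S)) r := by
    intro r hr
    have h2z := (hz r hr).const_mul 2
    have h1 := (((Real.hasDerivAt_rpow_const (p := 1 + μ / 2) (Or.inl hr.ne')).const_mul m).add
      ((Real.hasDerivAt_rpow_const (p := μ) (Or.inl hr.ne')).mul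
        ((h2z.sin.const_mul a).add (h2z.cos.const_mul b)))).sub
      ((Real.hasDerivAt_rpow_const (p := μ) (Or.inl hr.ne')).const_mul S)
    refine h1.congr_deriv ?_
    have e1 : r ^ μ * r ^ (-(μ / 2)) = r ^ (μ / 2) := by
      rw [← Real.rpow_add hr]; congr 1; ring
    have e2 : 1 + μ / 2 - 1 = μ / 2 := by ring
    have e3 : m * (1 + μ / 2) = (X ^ 2 + Y ^ 2) / 2 :=
      div_mul_cancel₀ _ (by linarith)
    have e4 : a * (4 * k) = Y ^ 2 - X ^ 2 := div_mul_cancel₀ _ (by positivity)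
    have e5 : b * (2 * k) = -(X * Y) := div_mul_cancel₀ _ (by positivity)
    simp only [φ, e2, Pi.add_apply]
    rw [← e1, Real.sin_two_mul, Real.cos_two_mul]
    have e6 := Real.sin_sq_add_cos_sq (z r)
    linear_combination (r ^ μ * r ^ (-(μ / 2))) * (e3 + (2 * Real.cos (z r) ^ 2 - 1) / 2 * e4 -
      2 * Real.sin (z r) * Real.cos (z r) * e5 - X ^ 2 * e6)
  have hHlim : Tendsto (fun R => R ^ (-(1 + μ / 2)) * (H R - H R₀)) atTop (𝓝 m) := by
    have h1 : Tendsto (fun R : ℝ => R ^ (-(1 - μ / 2)) *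
        (a * Real.sin (2 * z R) + b * Real.cos (2 * z R) - S)) atTop (𝓝 0) := by
      have h2 : Tendsto (fun R : ℝ => R ^ (-(1 - μ / 2)) * (2 * S)) atTop (𝓝 0) := by
        simpa using (tendsto_rpow_neg_atTop (by linarith : 0 < 1 - μ / 2)).mul_const (2 * S)
      refine squeeze_zero_norm' ?_ h2
      filter_upwards [eventually_ge_atTop 0] with R hR
      rw [norm_mul, Real.norm_of_nonneg (Real.rpow_nonneg hR _), Real.norm_eq_abs]
      refine mul_le_mul_of_nonneg_left ?_ (Real.rpow_nonneg hR _)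
      have := hS (2 * z R)
      rw [abs_le]
      constructor <;> linarith
    have h2 := (tendsto_rpow_neg_atTop (by linarith : 0 < 1 + μ / 2)).mul_const (H R₀)
    have h3 := (h1.const_add m).sub h2
    rw [add_zero, zero_mul, sub_zero] at h3
    refine h3.congr' ?_
    filter_upwards [eventually_gt_atTop 0] with R hR
    have e1 : R ^ (-(1 + μ / 2)) * R ^ (1 + μ / 2) = 1 := by rw [← Real.rpow_add hR]; simp
    have e2 : R ^ (-(1 - μ / 2)) = R ^ (-(1 + μ / 2)) * R ^ μ := by
      rw [← Real.rpow_add hR]; congr 1; ring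
    rw [e2]
    simp only [H]
    linear_combination -m * e1
  have hle : ∀ᶠ R in atTop, R ^ (-(1 + μ / 2)) * (H R - H R₀) ≤
      R ^ (-(1 + μ / 2)) * ∫ r in R₀..R, φ r := by
    filter_upwards [eventually_ge_atTop R₀] with R hR
    have hsub : Icc R₀ R ⊆ Ioi 0 := fun x hx => hR₀.trans_le hx.1
    refine mul_le_mul_of_nonneg_left ?_ (Real.rpow_nonneg (hR₀.le.trans hR) _)
    refine intervalIntegral.sub_le_integral_of_hasDeriv_right_of_le hR
      (fun r hr => (hH r (hsub hr)).continuousAt.continuousWithinAt)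
      (fun r hr => (hH r (hR₀.trans hr.1)).hasDerivWithinAt)
      ((hφc.mono hsub).integrableOn_Icc) fun r hr => ?_
    have h1 := mul_nonneg hμ0.le (Real.rpow_nonneg (hR₀.trans hr.1).le (μ - 1))
    have h2 := (hS (2 * z r)).1
    nlinarith
  have hm : m ≤ 0 := le_of_tendsto_of_tendsto hHlim hlim hle
  have : X ^ 2 + Y ^ 2 ≤ 0 := by
    have h1 : (X ^ 2 + Y ^ 2) / 2 = m * (1 + μ / 2) := (div_mul_cancel₀ _ (by linarith)).symm
    nlinarith
  constructor <;> nlinarith [sq_nonneg X, sq_nonneg Y]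


/-! ### Existence and uniqueness of the phase constant. -/

section Phase

variable {μ γ R₀ : ℝ} {V₁ V₂ V₃ V : ℝ → ℝ}

/-- `V₁` vanishes near the origin, whereas `-γ r^(-μ)` never does. -/
lemma RadialCondition.radius_pos (hcond : RadialCondition μ γ V₁ V₂ V₃)
    (hone : ∀ r : ℝ, R₀ < r → V₁ r = -γ * r ^ (-μ)) : 0 < R₀ := by
  by_contra hR
  obtain ⟨r, h1, h2⟩ := (hcond.one_vanish.and self_mem_nhdsWithin).exists
  have hr : 0 < r := h2
  have h3 := hone r (by linarith)
  have h4 := mul_pos hcond.gamma_pos (Real.rpow_pos_of_pos hr (-μ))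
  linarith

lemma sqrt_model (hγ : 0 < γ) {r : ℝ} (hr : 0 < r) :
    √(2 * γ * r ^ (-μ)) = √(2 * γ) * r ^ (-(μ / 2)) := by
  rw [Real.sqrt_mul (by positivity), Real.sqrt_eq_rpow (r ^ (-μ)), ← Real.rpow_mul hr.le]
  congr 2; ring

lemma RadialCondition.sqrt_one (hcond : RadialCondition μ γ V₁ V₂ V₃)
    (hone : ∀ r : ℝ, R₀ < r → V₁ r = -γ * r ^ (-μ)) {r : ℝ} (hr : R₀ < r) :
    √(-2 * V₁ r) = √(2 * γ) * r ^ (-(μ / 2)) := by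
  rw [hone r hr, show -2 * (-γ * r ^ (-μ)) = 2 * γ * r ^ (-μ) by ring]
  exact sqrt_model hcond.gamma_pos ((hcond.radius_pos hone).trans hr)

lemma RadialCondition.integral_sqrt (hcond : RadialCondition μ γ V₁ V₂ V₃)
    (hone : ∀ r : ℝ, R₀ < r → V₁ r = -γ * r ^ (-μ)) {r : ℝ} (hr : R₀ ≤ r) :
    ∫ t in R₀..r, √(-2 * V₁ t) = liouvilleVar μ γ r - liouvilleVar μ γ R₀ := by
  have hsub : Icc R₀ r ⊆ Ioi 0 := fun x hx => (hcond.radius_pos hone).trans_le hx.1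
  have hd : ∀ x, 0 < x → HasDerivAt (liouvilleVar μ γ) (√(2 * γ) * x ^ (-(μ / 2))) x :=
    fun x hx => hasDerivAt_liouvilleVar hcond.mu_lt_two hx
  refine intervalIntegral.integral_eq_sub_of_hasDerivAt_of_le hr
    (fun x hx => (hd x (hsub hx)).continuousAt.continuousWithinAt) (fun x hx => ?_) ?_
  · rw [hcond.sqrt_one hone hx.1]
    exact hd x (hsub ⟨hx.1.le, hx.2.le⟩)
  · refine ContinuousOn.intervalIntegrable ?_
    rw [uIcc_of_le hr]
    exact Real.continuous_sqrt.comp_continuousOn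
      (continuousOn_const.mul (hcond.continuousOn_one.mono hsub))

lemma RadialCondition.wkbWave_eq (hcond : RadialCondition μ γ V₁ V₂ V₃)
    (hone : ∀ r : ℝ, R₀ < r → V₁ r = -γ * r ^ (-μ)) (D : ℝ) :
    wkbWave V₁ R₀ D = (Ioi R₀).indicator fun r =>
      Real.sin (liouvilleVar μ γ r + (D - liouvilleVar μ γ R₀)) *
        (((2 * γ) ^ (1 / 4 : ℝ))⁻¹ * r ^ (μ / 4)) := by
  have hγ := hcond.gamma_pos
  unfold wkbWave
  refine indicator_congr fun r hr => ?_
  have hr0 : 0 < r := (hcond.radius_pos hone).trans hr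
  rw [hcond.integral_sqrt hone (le_of_lt hr), hone r hr,
    show -2 * (-γ * r ^ (-μ)) = 2 * γ * r ^ (-μ) by ring,
    Real.mul_rpow (by positivity) (Real.rpow_nonneg hr0.le _), ← Real.rpow_mul hr0.le,
    show -μ * (1 / 4) = -(μ / 4) by ring, Real.rpow_neg hr0.le, div_eq_mul_inv, mul_inv, inv_inv]
  congr 2; ring

/-- With `a = √(-2V₁)` and `b = √(-2V)`, far out `a - b = 2V₂/(a + b)` is at most `2|V₂|/a`, of size
`r^(μ/2) |V₂| = O(r^(-1-ε))`. -/
lemma RadialCondition.integrableOn_sub_sqrt (hcond : RadialCondition μ γ V₁ V₂ V₃)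
    (hV : ∀ r : ℝ, 0 < r → V r = V₁ r + V₂ r + V₃ r)
    (hneg : ∀ r : ℝ, R₀ < r → V r < 0)
    (hone : ∀ r : ℝ, R₀ < r → V₁ r = -γ * r ^ (-μ)) :
    IntegrableOn (fun r : ℝ => √(-2 * V₁ r) - √(-2 * V r)) (Ioi R₀) := by
  have hR := hcond.radius_pos hone
  have hk := sqrt_two_mul_pos hcond.gamma_pos
  obtain ⟨ε, hε, hε2⟩ := hcond.two_decay
  have hc : ContinuousOn (fun r : ℝ => √(-2 * V₁ r) - √(-2 * V r)) (Ici R₀) := by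
    have hsub : Ici R₀ ⊆ Ioi 0 := fun x hx => hR.trans_le hx
    exact (Real.continuous_sqrt.comp_continuousOn
      (continuousOn_const.mul (hcond.continuousOn_one.mono hsub))).sub
      (Real.continuous_sqrt.comp_continuousOn
      (continuousOn_const.mul ((hcond.continuousOn_sum hV).mono hsub)))
  refine IntegrableOn.mono_set ?_ Ioi_subset_Ici_self
  refine (hc.locallyIntegrableOn measurableSet_Ici).integrableOn_of_isBigO_atTop
    (g := fun r : ℝ => r ^ (-1 - ε)) ?_ (integrableAtFilter_rpow_atTop_iff.2 (by linarith))
  have h1 : (fun r => 2 / √(2 * γ) * r ^ (μ / 2) * V₂ r) =O[atTop]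
      fun r : ℝ => r ^ (μ / 2) * r ^ (-1 - μ / 2 - ε) :=
    (((isBigO_refl (fun r : ℝ => r ^ (μ / 2)) _).mul hε2).const_mul_left
      (2 / √(2 * γ))).congr_left fun r => by ring
  refine (IsBigO.of_bound 1 ?_).trans (h1.congr' (EventuallyEq.refl _ _) ?_)
  · filter_upwards [hcond.eventually_eq hV, eventually_gt_atTop R₀] with r hr hrR
    have hr0 := hR.trans hrR
    have e1 := hcond.sqrt_one hone hrR
    have hpos : 0 < √(-2 * V₁ r) := by
      rw [e1]; exact mul_pos hk (Real.rpow_pos_of_pos hr0 _)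
    have hVr := hneg r hrR
    have hV1 : -2 * V₁ r ≥ 0 := by
      by_contra h
      rw [Real.sqrt_eq_zero'.2 (by linarith)] at hpos
      exact lt_irrefl _ hpos
    have s1 := Real.mul_self_sqrt hV1
    have s2 := Real.mul_self_sqrt (by linarith : 0 ≤ -2 * V r)
    have hb := Real.sqrt_nonneg (-2 * V r)
    set a := √(-2 * V₁ r)
    set b := √(-2 * V r)
    have e2 : 2 / √(2 * γ) * r ^ (μ / 2) * V₂ r = (a - b) * ((a + b) / a) := by
      have e3 : 2 * V₂ r = (a - b) * (a + b) := by
        rw [hr.2] at s2; linarith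
      have e4 : r ^ (μ / 2) * r ^ (-(μ / 2)) = 1 := by rw [← Real.rpow_add hr0]; simp
      rw [mul_div_assoc', ← e3, eq_div_iff hpos.ne', e1]
      field_simp
      linear_combination V₂ r * e4
    rw [e2, norm_mul, one_mul]
    refine le_mul_of_one_le_right (norm_nonneg _) ?_
    rw [Real.norm_of_nonneg (by positivity), one_le_div hpos]
    linarith
  · filter_upwards [eventually_gt_atTop 0] with r hr
    rw [← Real.rpow_add hr]; congr 1; ring

lemma measurable_indicator_of_continuousOn {f : ℝ → ℝ} {s : Set ℝ} (hs : MeasurableSet s)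
    (hf : ContinuousOn f s) : Measurable (s.indicator f) := by
  classical
  rw [← piecewise_eq_indicator]
  exact hf.measurable_piecewise continuousOn_const hs

/-- The asymptotics of a regular solution determines a phase constant. -/
lemma RadialCondition.hasPhase (hcond : RadialCondition μ γ V₁ V₂ V₃)
    (hone : ∀ r : ℝ, R₀ < r → V₁ r = -γ * r ^ (-μ)) {d : ℕ} (hd : 2 ≤ d) {l : ℕ} {u : ℝ → ℝ}
    (hu : IsRegularSolution d V l u) {A ε Θ : ℝ} (hA : 0 < A) (hε : 0 < ε)
    (hO : (fun r => r ^ (-(μ / 4)) * u r - A * Real.sin (liouvilleVar μ γ r + Θ)) =O[atTop]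
      fun r : ℝ => r ^ (-ε)) :
    HasPhase d μ V₁ R₀ u (Θ + liouvilleVar μ γ R₀) := by
  have hγ := hcond.gamma_pos
  have hR := hcond.radius_pos hone
  have hG : (0 : ℝ) < (2 * γ) ^ (1 / 4 : ℝ) := Real.rpow_pos_of_pos (by positivity) _
  -- Compensates the constant in `(-2V₁)^(-1/4) = (2γ)^(-1/4) r^(μ/4)`.
  set C := A * (2 * γ) ^ (1 / 4 : ℝ)
  have hw : (fun r => C * wkbWave V₁ R₀ (Θ + liouvilleVar μ γ R₀) r) =
      (Ioi R₀).indicator fun r => A * Real.sin (liouvilleVar μ γ r + Θ) * r ^ (μ / 4) := by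
    rw [hcond.wkbWave_eq hone]
    funext r
    by_cases hr : r ∈ Ioi R₀
    · simp only [indicator_of_mem hr, add_sub_cancel_right, C]
      field_simp
    · simp only [indicator_of_notMem hr, mul_zero]
  have huc : ContinuousOn u (Ioi 0) :=
    fun r hr => (hu.differentiableAt r hr).continuousAt.continuousWithinAt
  have hzc : ContinuousOn (liouvilleVar μ γ) (Ioi 0) := fun r hr =>
    (hasDerivAt_liouvilleVar hcond.mu_lt_two hr).continuousAt.continuousWithinAt
  have hqc : ContinuousOn (fun r => A * Real.sin (liouvilleVar μ γ r + Θ) * r ^ (μ / 4))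
      (Ioi 0) :=
    (continuousOn_const.mul (Real.continuous_sin.comp_continuousOn
      (hzc.add continuousOn_const))).mul (continuousOn_rpow_Ioi _)
  have key := memDualBesovZero_radial hd (e := μ / 4) (by linarith [hcond.mu_pos]) hε
    (h := fun r => u r - C * wkbWave V₁ R₀ (Θ + liouvilleVar μ γ R₀) r) ?_ ?_ ?_
  · refine ⟨C, mul_pos hA hG, ?_⟩
    rw [show 2 * (μ / 4) = μ / 2 by ring] at key
    convert key using 2 with x
    ring
  · have h1 := (measurable_indicator_of_continuousOn measurableSet_Ioi huc).sub
      (measurable_indicator_of_continuousOn measurableSet_Ioi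
        (hqc.mono (Ioi_subset_Ioi hR.le)))
    rw [← hw] at h1
    convert h1 using 1
    funext r
    by_cases hr : r ∈ Ioi (0 : ℝ)
    · simp [indicator_of_mem hr]
    · have hr' : r ∉ Ioi R₀ := fun h => hr (hR.trans h)
      simp [indicator_of_notMem hr, wkbWave, indicator_of_notMem hr']
  · intro R
    have hfpos : ∀ r : ℝ, 0 < r → 0 < r ^ (((d : ℝ) - 1) / 2) :=
      fun r hr => Real.rpow_pos_of_pos hr _
    -- The normalization gives `u ~ r^(l+(d-1)/2)`, so `u(|x|)/|x|^((d-1)/2)` is bounded at the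
    -- origin.
    have hu0 : u =O[𝓝[>] 0] fun r : ℝ => r ^ (((d : ℝ) - 1) / 2) := by
      refine IsBigO.of_bound 2 ?_
      filter_upwards [hu.normalization.abs.eventually (gt_mem_nhds (by norm_num : |(1 : ℝ)| < 2)),
        Ioo_mem_nhdsGT one_pos] with r hr h01
      have hr0 : 0 < r := h01.1
      have e1 : u r = r ^ (-(l : ℝ) - ((d : ℝ) - 1) / 2) * u r * r ^ (l : ℝ) *
          r ^ (((d : ℝ) - 1) / 2) := by
        have : r ^ (-(l : ℝ) - ((d : ℝ) - 1) / 2) * r ^ (l : ℝ) * r ^ (((d : ℝ) - 1) / 2) = 1 := by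
          rw [← Real.rpow_add hr0, ← Real.rpow_add hr0,
            show -(l : ℝ) - ((d : ℝ) - 1) / 2 + l + ((d : ℝ) - 1) / 2 = 0 by ring, Real.rpow_zero]
        linear_combination -u r * this
      rw [e1, norm_mul]
      refine mul_le_mul_of_nonneg_right ?_ (norm_nonneg _)
      rw [norm_mul, Real.norm_of_nonneg (Real.rpow_nonneg hr0.le (l : ℝ)), Real.norm_eq_abs]
      have h3 : r ^ (l : ℝ) ≤ 1 := Real.rpow_le_one hr0.le h01.2.le l.cast_nonneg
      have h4 := mul_le_of_le_one_right
        (abs_nonneg (r ^ (-(l : ℝ) - ((d : ℝ) - 1) / 2) * u r)) h3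
      linarith
    obtain ⟨M, hM, hM'⟩ := exists_bound_Ioc huc (continuousOn_rpow_Ioi _) hfpos hu0 R
    obtain ⟨N, hN, hN'⟩ := exists_bound_Icc hqc (continuousOn_rpow_Ioi _) hfpos hR R
    refine ⟨M + N, fun r hr hrR => ?_⟩
    have h1 := hM' r hr hrR
    have h2 := congrFun hw r
    rw [h2, add_mul]
    refine (abs_sub _ _).trans (add_le_add h1 ?_)
    by_cases hr' : r ∈ Ioi R₀
    · rw [indicator_of_mem hr']
      exact hN' r (le_of_lt hr') hrR
    · rw [indicator_of_notMem hr', abs_zero]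
      exact mul_nonneg hN (hfpos r hr).le
  · have h1 := (isBigO_refl (fun r : ℝ => r ^ (μ / 4)) atTop).mul hO
    refine h1.congr' ?_ ?_
    · filter_upwards [eventually_gt_atTop R₀] with r hr
      have hr0 := hR.trans hr
      have h2 := congrFun hw r
      rw [h2, indicator_of_mem (show r ∈ Ioi R₀ from hr)]
      have e4 : r ^ (μ / 4) * r ^ (-(μ / 4)) = 1 := by rw [← Real.rpow_add hr0]; simp
      linear_combination u r * e4
    · filter_upwards [eventually_gt_atTop 0] with r hr
      rw [← Real.rpow_add hr, sub_eq_add_neg]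

lemma HasPhase.add_int_mul_two_pi {d : ℕ} {u : ℝ → ℝ} {D : ℝ} (h : HasPhase d μ V₁ R₀ u D)
    (n : ℤ) : HasPhase d μ V₁ R₀ u (D + 2 * Real.pi * n) := by
  have : wkbWave V₁ R₀ (D + 2 * Real.pi * n) = wkbWave V₁ R₀ D := by
    unfold wkbWave
    congr 1
    funext r
    rw [← add_assoc, mul_comm (2 * Real.pi), Real.sin_add_int_mul_two_pi]
  unfold HasPhase
  rw [this]
  exact h

lemma sub_sq_le_two_mul (a b : ℝ) : (a - b) ^ 2 ≤ 2 * a ^ 2 + 2 * b ^ 2 := by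
  nlinarith [sq_nonneg (a + b)]

/-- Polar amplitudes and phases are determined by the Cartesian components. -/
lemma exists_int_of_polar_eq {C C' β β' : ℝ} (hC : 0 < C) (hC' : 0 < C')
    (hcos : C' * Real.cos β' = C * Real.cos β) (hsin : C' * Real.sin β' = C * Real.sin β) :
    ∃ n : ℤ, β' - β = 2 * Real.pi * n := by
  have h1 : C' ^ 2 = C ^ 2 := by
    have e1 := Real.sin_sq_add_cos_sq β
    have e2 := Real.sin_sq_add_cos_sq β'
    linear_combination -C' ^ 2 * e2 + C ^ 2 * e1 +
      (C' * Real.cos β' + C * Real.cos β) * hcos + (C' * Real.sin β' + C * Real.sin β) * hsin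
  have h2 : C' = C := (pow_left_inj₀ hC'.le hC.le two_ne_zero).1 h1
  rw [h2] at hcos hsin
  exact Real.Angle.angle_eq_iff_two_pi_dvd_sub.1
    (Real.Angle.cos_sin_inj (mul_left_cancel₀ hC.ne' hcos) (mul_left_cancel₀ hC.ne' hsin))

/-- Phase constants are unique modulo `2π`. -/
lemma RadialCondition.hasPhase_unique (hcond : RadialCondition μ γ V₁ V₂ V₃)
    (hone : ∀ r : ℝ, R₀ < r → V₁ r = -γ * r ^ (-μ)) {d : ℕ} (hd : 2 ≤ d) {u v : ℝ → ℝ}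
    (huv : ∀ r, 0 < r → u r = v r) {D D' : ℝ} (hu : HasPhase d μ V₁ R₀ u D)
    (hv : HasPhase d μ V₁ R₀ v D') : ∃ n : ℤ, D' - D = 2 * Real.pi * n := by
  have hγ := hcond.gamma_pos
  have hR := hcond.radius_pos hone
  obtain ⟨C, hC, ⟨hF, -⟩, hFlim⟩ := hu
  obtain ⟨C', hC', ⟨hF', -⟩, hFlim'⟩ := hv
  beta_reduce at hFlim hFlim'
  have : Nontrivial (EuclideanSpace ℝ (Fin d)) := by
    refine Module.nontrivial_of_finrank_pos (R := ℝ) ?_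
    rw [finrank_euclideanSpace_fin]; omega
  have hae : ∀ᵐ x : EuclideanSpace ℝ (Fin d), x ≠ 0 := by simp [ae_iff]
  obtain ⟨c, hc, hpol⟩ := integral_ball_radial d hd
  set h : ℝ → ℝ := fun r => C' * wkbWave V₁ R₀ D' r - C * wkbWave V₁ R₀ D r with hdef
  set K : ℝ := c * (((2 * γ) ^ (1 / 4 : ℝ))⁻¹) ^ 2
  have hK : 0 < K :=
    mul_pos hc (pow_pos (inv_pos.2 (Real.rpow_pos_of_pos (by positivity) _)) 2)
  set β := D - liouvilleVar μ γ R₀ with hβ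
  set β' := D' - liouvilleVar μ γ R₀ with hβ'
  -- Components of `C' sin (z + β') - C sin (z + β) = X sin z + Y cos z`.
  set X := C' * Real.cos β' - C * Real.cos β
  set Y := C' * Real.sin β' - C * Real.sin β
  have hint : ∀ R, R₀ ≤ R → c * ∫ r in Ioo 0 R, h r ^ 2 = K * ∫ r in R₀..R, r ^ (μ / 2) *
      (X * Real.sin (liouvilleVar μ γ r) + Y * Real.cos (liouvilleVar μ γ r)) ^ 2 := by
    intro R hRR
    have e : (fun r => h r ^ 2) = (Ioi R₀).indicator fun r =>
        (((2 * γ) ^ (1 / 4 : ℝ))⁻¹) ^ 2 * (r ^ (μ / 2) *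
      (X * Real.sin (liouvilleVar μ γ r) + Y * Real.cos (liouvilleVar μ γ r)) ^ 2) := by
      funext r
      simp only [hdef, hcond.wkbWave_eq hone]
      by_cases hr : r ∈ Ioi R₀
      · simp only [indicator_of_mem hr]
        have hr0 : 0 < r := hR.trans hr
        rw [← hβ, ← hβ', Real.sin_add, Real.sin_add, show μ / 2 = μ / 4 + μ / 4 by ring,
          Real.rpow_add hr0]
        ring
      · simp [indicator_of_notMem hr]
    rw [e, setIntegral_indicator measurableSet_Ioi, intervalIntegral.integral_of_le hRR,
      integral_const_mul, ← mul_assoc, integral_Ioc_eq_integral_Ioo,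
      show Ioo 0 R ∩ Ioi R₀ = Ioo R₀ R from Set.ext fun r =>
        ⟨fun hr => ⟨hr.2, hr.1.2⟩, fun hr => ⟨⟨hR.trans hr.1, hr.2⟩, hr.1⟩⟩]
  have hlim : Tendsto (fun R => R ^ (-(1 + μ / 2)) * ∫ r in R₀..R, r ^ (μ / 2) *
      (X * Real.sin (liouvilleVar μ γ r) + Y * Real.cos (liouvilleVar μ γ r)) ^ 2)
      atTop (𝓝 0) := by
    -- Subtracting the two remainders cancels the common solution and leaves the difference of the
    -- two waves. Its square is at most twice the sum of the squared remainders, whose weighted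
    -- integrals vanish in the limit.
    have h1 := ((hFlim.const_mul 2).add (hFlim'.const_mul 2)).const_mul K⁻¹
    rw [mul_zero, add_zero, mul_zero] at h1
    refine squeeze_zero' ?_ ?_ h1
    · filter_upwards [eventually_ge_atTop R₀] with R hRR
      refine mul_nonneg (Real.rpow_nonneg (hR.le.trans hRR) _)
        (intervalIntegral.integral_nonneg hRR fun r hr => ?_)
      exact mul_nonneg (Real.rpow_nonneg (hR.le.trans hr.1) _) (sq_nonneg _)
    · filter_upwards [eventually_ge_atTop R₀] with R hRR
      have h2 := hpol h R
      rw [hint R hRR] at h2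
      rw [← inv_mul_cancel_left₀ hK.ne' (∫ r in R₀..R, _), ← h2, mul_left_comm]
      refine mul_le_mul_of_nonneg_left ?_ (inv_pos.2 hK).le
      rw [show -2 * ((1 + μ / 2) / 2) = -(1 + μ / 2) by ring, mul_left_comm, mul_left_comm 2,
        ← mul_add, ← integral_const_mul (2 : ℝ), ← integral_const_mul (2 : ℝ),
        ← integral_add ((hF R).integrable_sq.const_mul 2) ((hF' R).integrable_sq.const_mul 2)]
      refine mul_le_mul_of_nonneg_left ?_ (Real.rpow_nonneg (hR.le.trans hRR) _)
      refine integral_mono_of_nonneg (ae_of_all _ fun x => sq_nonneg _)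
        (((hF R).integrable_sq.const_mul 2).add ((hF' R).integrable_sq.const_mul 2)) ?_
      filter_upwards [ae_restrict_of_ae hae] with x hx
      have h3 := sub_sq_le_two_mul
        (u ‖x‖ / ‖x‖ ^ (((d : ℝ) - 1) / 2) -
          C * (wkbWave V₁ R₀ D ‖x‖ / ‖x‖ ^ (((d : ℝ) - 1) / 2)))
        (v ‖x‖ / ‖x‖ ^ (((d : ℝ) - 1) / 2) -
          C' * (wkbWave V₁ R₀ D' ‖x‖ / ‖x‖ ^ (((d : ℝ) - 1) / 2)))
      refine le_trans (le_of_eq ?_) h3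
      rw [huv _ (norm_pos_iff.2 hx)]
      simp only [hdef]
      ring
  obtain ⟨hX, hY⟩ := eq_zero_of_tendsto_mean hcond.mu_pos hcond.mu_lt_two hγ hR hlim
  obtain ⟨n, hn⟩ := exists_int_of_polar_eq hC hC' (sub_eq_zero.1 hX) (sub_eq_zero.1 hY)
  exact ⟨n, by rw [← hn]; ring⟩

end Phase


/-! ### The WKB phase and amplitude. -/

lemma abs_sqrt_sq_sub_sq_sub_le {z a : ℝ} (hz : 0 < z) (h : a ^ 2 ≤ z ^ 2) :
    |√(z ^ 2 - a ^ 2) - z| ≤ a ^ 2 / z := by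
  have h1 := Real.mul_self_sqrt (sub_nonneg.2 h)
  have h2 := Real.sqrt_nonneg (z ^ 2 - a ^ 2)
  have h3 : √(z ^ 2 - a ^ 2) ≤ z := Real.sqrt_le_iff.2 ⟨hz.le, by nlinarith [sq_nonneg a]⟩
  rw [abs_of_nonpos (by linarith), le_div_iff₀ hz]
  nlinarith

lemma isBigO_sin_sub_sin {f g : ℝ → ℝ} (F : Filter ℝ) :
    (fun r => Real.sin (f r) - Real.sin (g r)) =O[F] fun r => f r - g r := by
  refine IsBigO.of_bound 1 (Eventually.of_forall fun r => ?_)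
  rw [one_mul]
  exact Real.abs_sin_sub_sin_le _ _

/-- The value `√(k (k + 1)) / (1 - μ / 2)` of the Liouville variable at the turning point. -/
noncomputable def turningVar (μ k : ℝ) : ℝ := √(k * (k + 1)) / (1 - μ / 2)

section WKB

variable {μ γ k : ℝ}

lemma turningVar_pos (hμ : μ < 2) (hk : 0 < k) : 0 < turningVar μ k :=
  div_pos (Real.sqrt_pos.2 (by positivity)) (by linarith)

/-- In the variable `z` the model is Bessel-like with turning point `Λ = turningVar μ k`; this makes
the WKB integral elementary. -/
lemma neg_modelPotential (hμ : μ < 2) (hγ : 0 < γ) (hk : 0 < k) {r : ℝ} (hr : 0 < r) :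
    -modelPotential μ γ k r =
      2 * γ * r ^ (-μ) * (1 - (turningVar μ k / liouvilleVar μ γ r) ^ 2) := by
  have hp2 : 2 - μ ≠ 0 := by linarith
  have e1 : (turningVar μ k / liouvilleVar μ γ r) ^ 2 =
      k * (k + 1) / (2 * γ) / (r ^ (1 - μ / 2)) ^ 2 := by
    rw [turningVar, liouvilleVar, div_pow, div_pow, mul_pow, div_pow,
      Real.sq_sqrt (by positivity), Real.sq_sqrt (by positivity)]
    have := (Real.rpow_pos_of_pos hr (1 - μ / 2)).ne'
    field_simp
  have e2 : (r ^ (1 - μ / 2)) ^ 2 * r ^ μ = r ^ 2 := by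
    rw [← Real.rpow_natCast, ← Real.rpow_mul hr.le, ← Real.rpow_add hr, ← Real.rpow_natCast]
    congr 1; push_cast; ring
  rw [e1, modelPotential, Real.rpow_neg hr.le, ← e2]
  field_simp
  ring

lemma turningPoint_pos (hγ : 0 < γ) (hk : 0 < k) : 0 < turningPoint μ γ k :=
  Real.rpow_pos_of_pos (by positivity) _

lemma liouvilleVar_turningPoint (hμ : μ < 2) (hγ : 0 < γ) (hk : 0 < k) :
    liouvilleVar μ γ (turningPoint μ γ k) = turningVar μ k := by
  have hp2 : 2 - μ ≠ 0 := by linarith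
  rw [liouvilleVar, turningPoint, ← Real.rpow_mul (by positivity),
    show 1 / (2 - μ) * (1 - μ / 2) = 1 / 2 by field_simp, ← Real.sqrt_eq_rpow,
    Real.sqrt_div' _ (by positivity), turningVar]
  field_simp

lemma liouvilleVar_strictMono (hμ : μ < 2) (hγ : 0 < γ) {r s : ℝ} (hr : 0 ≤ r) (h : r < s) :
    liouvilleVar μ γ r < liouvilleVar μ γ s :=
  mul_lt_mul_of_pos_left (Real.rpow_lt_rpow hr h (by linarith))
    (div_pos (sqrt_two_mul_pos hγ) (by linarith))

/-- The WKB phase in closed form. -/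
lemma integral_sqrt_neg_modelPotential (hμ : μ < 2) (hγ : 0 < γ) (hk : 0 < k) {r : ℝ}
    (hr : turningPoint μ γ k ≤ r) :
    ∫ t in turningPoint μ γ k..r, √(-modelPotential μ γ k t) =
      √(liouvilleVar μ γ r ^ 2 - turningVar μ k ^ 2) -
        turningVar μ k * Real.arccos (turningVar μ k / liouvilleVar μ γ r) := by
  have h0 : 0 < turningPoint μ γ k := turningPoint_pos hγ hk
  have hsub : Icc (turningPoint μ γ k) r ⊆ Ioi 0 := fun x hx => h0.trans_le hx.1
  have hΛ := turningVar_pos hμ hk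
  have hd : ∀ x, 0 < x → HasDerivAt (liouvilleVar μ γ) (√(2 * γ) * x ^ (-(μ / 2))) x :=
    fun x hx => hasDerivAt_liouvilleVar hμ hx
  have hzc : ContinuousOn (liouvilleVar μ γ) (Ioi 0) :=
    fun x hx => (hd x hx).continuousAt.continuousWithinAt
  set Λ := turningVar μ k
  have hend : √(liouvilleVar μ γ (turningPoint μ γ k) ^ 2 - Λ ^ 2) -
      Λ * Real.arccos (Λ / liouvilleVar μ γ (turningPoint μ γ k)) = 0 := by
    rw [liouvilleVar_turningPoint hμ hγ hk, sub_self, Real.sqrt_zero, div_self hΛ.ne',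
      Real.arccos_one]
    simp
  rw [← sub_zero (_ - Λ * Real.arccos _), ← hend]
  -- The primitive is not differentiable at the turning point, where `arccos` is evaluated at `1`;
  -- continuity there and a derivative in the open interval suffice.
  refine intervalIntegral.integral_eq_sub_of_hasDerivAt_of_le hr
    (f := fun x => √(liouvilleVar μ γ x ^ 2 - Λ ^ 2) - Λ * Real.arccos (Λ / liouvilleVar μ γ x))
    ?_ (fun x hx => ?_) ?_
  · refine ContinuousOn.mono ?_ hsub
    exact (Real.continuous_sqrt.comp_continuousOn ((hzc.pow 2).sub continuousOn_const)).sub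
      (continuousOn_const.mul (Real.continuous_arccos.comp_continuousOn
        (continuousOn_const.div hzc fun x hx => (liouvilleVar_pos hμ hγ hx).ne')))
  · have hx0 : 0 < x := h0.trans hx.1
    have hz := liouvilleVar_pos hμ hγ hx0
    have hlt : Λ < liouvilleVar μ γ x := by
      have := liouvilleVar_strictMono hμ hγ h0.le hx.1
      rwa [liouvilleVar_turningPoint hμ hγ hk] at this
    have hdx := hd x hx0
    have hV : √(-modelPotential μ γ k x) =
        √(2 * γ) * x ^ (-(μ / 2)) * √(1 - (Λ / liouvilleVar μ γ x) ^ 2) := by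
      rw [neg_modelPotential hμ hγ hk hx0, Real.sqrt_mul (by positivity), sqrt_model hγ hx0]
    rw [hV]
    set z := liouvilleVar μ γ x
    have hpos : 0 < z ^ 2 - Λ ^ 2 := by nlinarith
    have hlt1 : Λ / z < 1 := (div_lt_one hz).2 hlt
    have hgt : 0 < Λ / z := div_pos hΛ hz
    have h1 := (((hdx.pow 2).sub_const (Λ ^ 2)).sqrt hpos.ne').sub
      (((Real.hasDerivAt_arccos (by linarith) hlt1.ne).comp x
        ((hasDerivAt_const x Λ).div hdx hz.ne')).const_mul Λ)
    refine h1.congr_deriv ?_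
    have e1 : √(1 - (Λ / z) ^ 2) = √(z ^ 2 - Λ ^ 2) / z := by
      rw [div_pow, one_sub_div (by positivity), Real.sqrt_div' _ (by positivity),
        Real.sqrt_sq hz.le]
    have hs := Real.sqrt_pos.2 hpos
    have e2 := Real.sq_sqrt hpos.le
    have e3 : liouvilleVar μ γ x = z := rfl
    simp only [Pi.pow_apply, e3]
    rw [e1]
    set w := √(z ^ 2 - Λ ^ 2)
    push_cast
    field_simp
    linear_combination -(√(2 * γ) * x ^ (-(μ / 2))) * e2
  · refine ContinuousOn.intervalIntegrable ?_
    rw [uIcc_of_le hr]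
    refine (Real.continuous_sqrt.comp_continuousOn (ContinuousOn.neg ?_)).mono hsub
    exact (continuousOn_const.mul (continuousOn_rpow_Ioi _)).add
      (continuousOn_const.div (continuousOn_id.pow 2)
        (fun z hz => (pow_pos (show 0 < z from hz) 2).ne'))

lemma isBigO_inv_liouvilleVar (μ γ : ℝ) :
    (fun r => (liouvilleVar μ γ r)⁻¹) =O[atTop] fun r : ℝ => r ^ (-(1 - μ / 2)) := by
  refine (isBigO_const_mul_self ((√(2 * γ) / (1 - μ / 2))⁻¹) _ _).congr' ?_
    (EventuallyEq.refl _ _)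
  filter_upwards [eventually_gt_atTop 0] with r hr
  rw [liouvilleVar, mul_inv, Real.rpow_neg hr.le]

/-- In the closed form, `√(z² - Λ²) = z + O(1/z)` and `arccos (Λ/z) = π/2 + O(1/z)`. -/
lemma isBigO_wkbPhase (hμ : μ < 2) (hγ : 0 < γ) (hk : 0 < k) :
    (fun r => (∫ t in turningPoint μ γ k..r, √(-modelPotential μ γ k t)) -
      (liouvilleVar μ γ r - turningVar μ k * (Real.pi / 2))) =O[atTop]
        fun r => (liouvilleVar μ γ r)⁻¹ := by
  set Λ := turningVar μ k
  have hΛ : 0 < Λ := turningVar_pos hμ hk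
  have hzlim := tendsto_liouvilleVar_atTop hμ hγ
  have h1 : (fun r => √(liouvilleVar μ γ r ^ 2 - Λ ^ 2) - liouvilleVar μ γ r) =O[atTop]
      fun r => (liouvilleVar μ γ r)⁻¹ := by
    refine IsBigO.of_bound (Λ ^ 2) ?_
    filter_upwards [hzlim.eventually (eventually_gt_atTop Λ)] with r hr
    have hz := hΛ.trans hr
    rw [Real.norm_eq_abs, Real.norm_of_nonneg (inv_pos.2 hz).le, ← div_eq_mul_inv]
    exact abs_sqrt_sq_sub_sq_sub_le hz (by nlinarith)
  have h2 : (fun r => Real.arcsin (Λ / liouvilleVar μ γ r)) =O[atTop]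
      fun r => (liouvilleVar μ γ r)⁻¹ := by
    have h3 := (Real.hasDerivAt_arcsin (x := 0) (by norm_num) (by norm_num)).isBigO_sub
    have h4 : Tendsto (fun r => Λ / liouvilleVar μ γ r) atTop (𝓝 0) :=
      hzlim.const_div_atTop Λ
    have h5 := h3.comp_tendsto h4
    refine (h5.congr_left fun r => by simp).trans ?_
    refine (isBigO_const_mul_self Λ (fun r => (liouvilleVar μ γ r)⁻¹) _).congr_left fun r => ?_
    simp [div_eq_mul_inv]
  refine (h1.add (h2.const_mul_left Λ)).congr' ?_ (EventuallyEq.refl _ _)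
  filter_upwards [eventually_ge_atTop (turningPoint μ γ k)] with r hr
  rw [integral_sqrt_neg_modelPotential hμ hγ hk hr, Real.arccos_eq_pi_div_two_sub_arcsin]
  ring

/-- The WKB form of the asymptotics of an oscillating solution. -/
lemma wkb_asymptotics (hμ : μ < 2) (hγ : 0 < γ) (hk : 0 < k) {u : ℝ → ℝ} {A ε Θ : ℝ}
    (hA : 0 < A) (hε : 0 < ε)
    (hO : (fun r => r ^ (-(μ / 4)) * u r - A * Real.sin (liouvilleVar μ γ r + Θ)) =O[atTop]
      fun r : ℝ => r ^ (-ε)) :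
    ∃ a ε : ℝ, 0 < a ∧ 0 < ε ∧
      (fun r : ℝ => a * u r * (-modelPotential μ γ k r) ^ (1 / 4 : ℝ) -
        Real.sin ((∫ t in turningPoint μ γ k..r, √(-modelPotential μ γ k t)) + Real.pi / 4 +
          (Θ + turningVar μ k * (Real.pi / 2) - Real.pi / 4)))
        =O[atTop] (fun r : ℝ => r ^ (-ε)) := by
  have hp : 0 < 1 - μ / 2 := by linarith
  have hG : (0 : ℝ) < (2 * γ) ^ (1 / 4 : ℝ) := Real.rpow_pos_of_pos (by positivity) _
  have hΛ := turningVar_pos hμ hk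
  set Λ := turningVar μ k
  -- The weaker of two rates: `ε` for the solution and `1/z ~ r^(-(1-μ/2))` for the WKB phase and
  -- amplitude.
  set e := min ε (1 - μ / 2)
  have hzlim := tendsto_liouvilleVar_atTop hμ hγ
  have hmono : ∀ {a : ℝ}, e ≤ a → (fun r : ℝ => r ^ (-a)) =O[atTop] fun r : ℝ => r ^ (-e) := by
    intro a ha
    refine IsBigO.of_bound 1 ?_
    filter_upwards [eventually_ge_atTop 1] with r hr
    have hr0 : 0 ≤ r := by linarith
    rw [one_mul, Real.norm_of_nonneg (Real.rpow_nonneg hr0 _),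
      Real.norm_of_nonneg (Real.rpow_nonneg hr0 _)]
    exact Real.rpow_le_rpow_of_exponent_le hr (by linarith)
  have hz : (fun r => (liouvilleVar μ γ r)⁻¹) =O[atTop] fun r : ℝ => r ^ (-e) :=
    (isBigO_inv_liouvilleVar μ γ).trans (hmono (min_le_right _ _))
  have hO' := hO.trans (hmono (min_le_left _ _))
  have hsin := ((isBigO_sin_sub_sin (f := fun r => (∫ t in turningPoint μ γ k..r,
    √(-modelPotential μ γ k t)) + Real.pi / 4 + (Θ + Λ * (Real.pi / 2) - Real.pi / 4))
    (g := fun r => liouvilleVar μ γ r + Θ) atTop).trans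
      (((isBigO_wkbPhase hμ hγ hk).congr_left fun r => by ring))).trans hz
  have hbdd : (fun r => r ^ (-(μ / 4)) * u r) =O[atTop] fun _ => (1 : ℝ) := by
    have h1 : (fun r => A * Real.sin (liouvilleVar μ γ r + Θ)) =O[atTop] fun _ => (1 : ℝ) := by
      refine IsBigO.of_bound |A| (Eventually.of_forall fun r => ?_)
      rw [norm_mul, norm_one, Real.norm_eq_abs, Real.norm_eq_abs]
      exact mul_le_mul_of_nonneg_left (Real.abs_sin_le_one _) (abs_nonneg _)
    have h2 := (hO.trans ((tendsto_rpow_neg_atTop hε).isBigO_one ℝ)).add h1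
    exact h2.congr_left fun r => by ring
  have hamp : (fun r => (1 - (Λ / liouvilleVar μ γ r) ^ 2) ^ (1 / 4 : ℝ) - 1) =O[atTop]
      fun r => (liouvilleVar μ γ r)⁻¹ := by
    refine IsBigO.of_bound Λ ?_
    filter_upwards [hzlim.eventually (eventually_gt_atTop Λ)] with r hr
    have hz0 := hΛ.trans hr
    rw [Real.norm_eq_abs, Real.norm_of_nonneg (inv_pos.2 hz0).le, ← div_eq_mul_inv]
    have h0 : 0 < Λ / liouvilleVar μ γ r := div_pos hΛ hz0
    have h1 : Λ / liouvilleVar μ γ r ≤ 1 := (div_le_one hz0).2 hr.le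
    set y := Λ / liouvilleVar μ γ r
    -- The amplitude factor lies between `1 - y²` and `1`, so its error is at most `y² ≤ y = Λ/z`.
    have h2 : 1 - y ^ 2 ≤ (1 - y ^ 2) ^ (1 / 4 : ℝ) :=
      Real.self_le_rpow_of_le_one (by nlinarith) (by nlinarith) (by norm_num)
    have h3 : (1 - y ^ 2) ^ (1 / 4 : ℝ) ≤ 1 :=
      Real.rpow_le_one (by nlinarith) (by nlinarith) (by norm_num)
    rw [abs_of_nonpos (by linarith)]
    nlinarith
  refine ⟨A⁻¹ * ((2 * γ) ^ (1 / 4 : ℝ))⁻¹, e, by positivity, lt_min hε hp, ?_⟩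
  have h1 := (hamp.trans hz).mul hbdd
  have h2 := ((h1.congr_right fun r => mul_one _).add hO').sub (hsin.const_mul_left A)
  refine (h2.const_mul_left A⁻¹).congr' ?_ (EventuallyEq.refl _ _)
  filter_upwards [eventually_gt_atTop 0, hzlim.eventually (eventually_gt_atTop Λ)] with r hr hrΛ
  have hz0 := hΛ.trans hrΛ
  have h0 : 0 < Λ / liouvilleVar μ γ r := div_pos hΛ hz0
  have h1 : Λ / liouvilleVar μ γ r ≤ 1 := (div_le_one hz0).2 hrΛ.le
  have hV : (-modelPotential μ γ k r) ^ (1 / 4 : ℝ) = (2 * γ) ^ (1 / 4 : ℝ) * r ^ (-(μ / 4)) *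
      (1 - (Λ / liouvilleVar μ γ r) ^ 2) ^ (1 / 4 : ℝ) := by
    rw [neg_modelPotential hμ hγ hk hr, Real.mul_rpow (by positivity) (by nlinarith),
      Real.mul_rpow (by positivity) (Real.rpow_nonneg hr.le _), ← Real.rpow_mul hr.le,
      show -μ * (1 / 4) = -(μ / 4) by ring]
  rw [hV]
  set G := (2 * γ) ^ (1 / 4 : ℝ)
  field_simp
  ring

/-- The difference between `√(k (k + 1)) = √(ν² - 1/4)` and `ν = l + d / 2 - 1` is negligible. -/
lemma tendsto_turningVar_sub (d : ℕ) (hd : 2 ≤ d) :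
    Tendsto (fun l : ℕ => turningVar μ (angK d l) - ((l : ℝ) + (d : ℝ) / 2 - 1) / (1 - μ / 2))
      atTop (𝓝 0) := by
  have hd' : (2 : ℝ) ≤ d := by exact_mod_cast hd
  have hν : Tendsto (fun l : ℕ => (l : ℝ) + ((d : ℝ) / 2 - 1)) atTop atTop :=
    tendsto_atTop_add_const_right _ _ tendsto_natCast_atTop_atTop
  have h1 : Tendsto (fun l : ℕ => √(angK d l * (angK d l + 1)) - ((l : ℝ) + ((d : ℝ) / 2 - 1)))
      atTop (𝓝 0) := by
    refine squeeze_zero_norm' ?_ (hν.const_div_atTop ((1 / 2 : ℝ) ^ 2))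
    filter_upwards [eventually_ge_atTop 1] with l hl
    have hl' : (1 : ℝ) ≤ l := by exact_mod_cast hl
    rw [show angK d l * (angK d l + 1) = ((l : ℝ) + ((d : ℝ) / 2 - 1)) ^ 2 - (1 / 2) ^ 2 by
      unfold angK; ring]
    exact abs_sqrt_sq_sub_sq_sub_le (by linarith) (pow_le_pow_left₀ (by norm_num) (by linarith) 2)
  have h2 := h1.div_const (1 - μ / 2)
  rw [zero_div] at h2
  refine h2.congr fun l => ?_
  rw [turningVar, sub_div, add_sub_assoc]

end WKB

end RadialScattering

/-! ### Conclusion. -/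

theorem proposition9p9 (d : ℕ) (hd : 2 ≤ d) (μ γ : ℝ) (V₁ V₂ V₃ V : ℝ → ℝ)
    (hcond : RadialCondition μ γ V₁ V₂ V₃)
    (hV : ∀ r : ℝ, 0 < r → V r = V₁ r + V₂ r + V₃ r) :
    -- the phase shifts
    (∀ R₀ : ℝ, 0 ≤ R₀ → (∀ r : ℝ, R₀ < r → V r < 0) →
      (∀ r : ℝ, R₀ < r → V₁ r = -γ * r ^ (-μ)) →
        IntegrableOn (fun r : ℝ => √(-2 * V₁ r) - √(-2 * V r)) (Ioi R₀) ∧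
        ∃ σ : ℕ → ℝ,
          (∀ (l : ℕ) (s : ℝ), IsPhaseShift d μ V₁ V R₀ l s ↔
            ∃ n : ℤ, s = σ l + 2 * Real.pi * (n : ℝ)) ∧
          (fun l : ℕ => σ l - (-(μ * Real.pi / (2 * (2 - μ))) * (l : ℝ) +
            halfC d μ γ V₁ V R₀)) =o[atTop] (fun _ : ℕ => (1 : ℝ))) ∧
    -- the WKB asymptotics of the regular solutions
    (∃ δ : ℕ → ℝ, Tendsto δ atTop (𝓝 0) ∧
      ∀ l : ℕ, 0 < angK d l → ∀ u : ℝ → ℝ, IsRegularSolution d V l u →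
        ∃ a ε : ℝ, 0 < a ∧ 0 < ε ∧
          (fun r : ℝ => a * u r * (-modelPotential μ γ (angK d l) r) ^ (1 / 4 : ℝ) -
            Real.sin ((∫ t in turningPoint μ γ (angK d l)..r,
              √(-modelPotential μ γ (angK d l) t)) + Real.pi / 4 + δ l))
            =O[atTop] (fun r : ℝ => r ^ (-ε))) := by
  obtain ⟨Θ, hΘ, hu⟩ := hcond.exists_phase hV hd
  have hμ := hcond.mu_lt_two
  have hγ := hcond.gamma_pos
  have hp2 : 2 - μ ≠ 0 := by linarith
  refine ⟨fun R₀ _ hneg hone => ⟨hcond.integrableOn_sub_sqrt hV hneg hone, ?_⟩, ?_⟩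
  -- The phase constant is `D = Θ_l + z(R₀)`, as `∫_{R₀}^r √(-2V₁) = z(r) - z(R₀)`.
  · refine ⟨fun l => Θ l + liouvilleVar μ γ R₀ + phaseCorrection V₁ V R₀ +
      ((d : ℝ) - 3 + 2 * (l : ℝ)) / 4 * Real.pi, fun l s => ?_, ?_⟩
    · obtain ⟨v, hv, A, ε, hA, hε, hO⟩ := hu l
      have hphase := hcond.hasPhase hone hd hv hA hε hO
      constructor
      · rintro ⟨u, hu', D, hD, rfl⟩
        obtain ⟨n, hn⟩ := hcond.hasPhase_unique hone hd
          (fun r hr => hcond.regular_unique hV hd hv hu' hr) hphase hD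
        exact ⟨n, by linarith⟩
      · rintro ⟨n, rfl⟩
        exact ⟨v, hv, _, hphase.add_int_mul_two_pi n, by ring⟩
    · refine (isLittleO_one_iff ℝ).2 (hΘ.congr fun l => ?_)
      have hp : 1 - μ / 2 = (2 - μ) / 2 := by ring
      -- The slope in `l` is `-π/(2-μ) + π/2 = -μπ/(2(2-μ))`, and `z(R₀)` is the term in
      -- `R₀^(1-μ/2)` of `c/2`.
      simp only [modelPhase, halfC, liouvilleVar]
      rw [show √(2 * γ) / (1 - μ / 2) = 2 * √(2 * γ) / (2 - μ) by rw [hp]; field_simp, hp]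
      field_simp
      ring
  -- What remains of `Θ_l` once the WKB phase `z - Λπ/2` and `π/4` are taken out. It tends to `0`
  -- because `Θ_l = π/4 - (π/2) ν/(1-μ/2) + o(1)` and `Λ - ν/(1-μ/2) → 0`.
  · refine ⟨fun l => Θ l + turningVar μ (angK d l) * (Real.pi / 2) - Real.pi / 4, ?_, ?_⟩
    · have h := hΘ.add ((tendsto_turningVar_sub (μ := μ) d hd).mul_const (Real.pi / 2))
      rw [zero_mul, add_zero] at h
      refine h.congr fun l => ?_
      simp only [modelPhase]
      ring
    · intro l hk u hu'
      obtain ⟨v, hv, A, ε, hA, hε, hO⟩ := hu l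
      refine wkb_asymptotics hμ hγ hk hA hε (hO.congr' ?_ (EventuallyEq.refl _ _))
      filter_upwards [eventually_gt_atTop 0] with r hr
      rw [hcond.regular_unique hV hd hv hu' hr]
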